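/- \textbf{Setting.} Let $M$ be a compact oriented smooth manifold without boundary, of dimension $p$, and $N$ a smooth manifold (without boundary) of dimension $n$. A \emph{Finsler structure} on $M$ is a function $F:TM\to[0,\infty)$ that is smooth on $TM\setminus\{0\}$, satisfies $F(t,\lambda s)=\lambda F(t,s)$ for $\lambda>0$, and for which $g_{\alpha\beta}=\frac12\frac{\partial^2F^2}{\partial s^\alpha\partial s^\beta}$ is positive definite on $TM\setminus\{0\}$; here $(t^\alpha,s^\alpha)$ are the coordinates of $TM$ induced by local coordinates $(t^\alpha)$ of $M$, and repeated indices are summed. Let $F$ and $\widetilde F$ be Finsler structures on $M$ and $N$. For $F$ put $(g^{\alpha\beta})=(g_{\alpha\beta})^{-1}$, $C_{\alpha\beta\gamma}=\frac12\frac{\partial g_{\alpha\beta}}{\partial s^\gamma}$, $C^\gamma_{\alpha\beta}=g^{\gamma\lambda}C_{\lambda\alpha\beta}$, $$\gamma^\mu_{\alpha\beta}=\tfrac12 g^{\mu\varepsilon}\Big(\tfrac{\partial g_{\varepsilon\alpha}}{\partial t^\beta}+\tfrac{\partial g_{\varepsilon\beta}}{\partial t^\alpha}-\tfrac{\partial g_{\alpha\beta}}{\partial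 t^\varepsilon}\Big),\quad N^\beta_\alpha=\gamma^\beta_{\alpha\varepsilon}s^\varepsilon-C^\beta_{\alpha\varepsilon}\gamma^\varepsilon_{\mu\nu}s^\mu s^\nu,\quad \tfrac{\delta}{\delta t^\alpha}=\tfrac{\partial}{\partial t^\alpha}-N^\varepsilon_\alpha\tfrac{\partial}{\partial s^\varepsilon},$$ $$\Gamma^\gamma_{\alpha\beta}=\tfrac12 g^{\gamma\mu}\Big(\tfrac{\delta g_{\mu\alpha}}{\delta t^\beta}+\tfrac{\delta g_{\mu\beta}}{\delta t^\alpha}-\tfrac{\delta g_{\alpha\beta}}{\delta t^\mu}\Big),\quad C^\gamma_{\alpha\beta|\mu}=\tfrac{\delta C^\gamma_{\alpha\beta}}{\delta t^\mu}+C^\varepsilon_{\alpha\beta}\Gamma^\gamma_{\varepsilon\mu}-C^\gamma_{\varepsilon\beta}\Gamma^\varepsilon_{\alpha\mu}-C^\gamma_{\alpha\varepsilon}\Gamma^\varepsilon_{\beta\mu},$$ and $B^\gamma_{\alpha\beta}=\Gamma^\gamma_{\alpha\beta}+C^\gamma_{\alpha\beta|\mu}s^\mu$ (the Berwald connection). The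 same objects for $\widetilde F$ carry a tilde and Latin indices; moreover $\widetilde C^i_{jkl}=\widetilde g^{im}\,\partial\widetilde C_{jkl}/\partial y^m$. Let $\varphi:M\to N$ be smooth and nondegenerate, i.e. $\operatorname{Ker}d\varphi=\{0\}$ at every point, and write $\varphi^i_\alpha=\partial\varphi^i/\partial t^\alpha$, $\varphi^i_{\alpha\beta}=\partial^2\varphi^i/\partial t^\alpha\partial t^\beta$. Below, the objects of $F$ are taken at $(t,s)$ with $s\neq0$ and those of $\widetilde F$ at $(\varphi(t),\varphi_\varepsilon(t)s^\varepsilon)$. The map $\varphi$ is \emph{affine} if in all local coordinates $$\varphi^i_{\alpha\beta}-B^\gamma_{\alpha\beta}\varphi^i_\gamma+\widetilde B^i_{jk}\varphi^j_\alpha\varphi^k_\beta=0\qquad\text{for all }i,\alpha,\beta\text{ and all }s\neq0.$$ Its \emph{tension field} has the components $$\tau^i(\varphi)=g^{\alpha\beta}\{\varphi^i_{\alpha\beta}-B^\gamma_{\alpha\beta}\varphi^i_\gamma+\widetilde B^i_{jk}\varphi^j_\alpha\varphi^k_\beta\}+4g^{\alpha\beta}\widetilde C^i_{jk}\varphi^k_\alpha\{\varphi^j_{\beta\gamma}-\Gamma^\mu_{\beta\gamma}\varphi^j_\mu+\widetilde\Gamma^j_{pq}\varphi^p_\beta\varphi^q_\gamma\}s^\gamma$$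 $$\qquad+g^{\alpha\beta}\widetilde C^i_{jkl}\varphi^k_\alpha\varphi^l_\beta\{\varphi^j_{\gamma\varepsilon}-\Gamma^\mu_{\gamma\varepsilon}\varphi^j_\mu+\widetilde\Gamma^j_{pq}\varphi^p_\gamma\varphi^q_\varepsilon\}s^\gamma s^\varepsilon .$$ Its \emph{energy} is $$E(\varphi)=\frac1{c_{p-1}}\int_{SM}\tfrac12\,g^{\alpha\beta}\,\widetilde g_{ij}\,\varphi^i_\alpha\varphi^j_\beta\;dV_{SM},$$ where $c_{p-1}$ is the volume of the Euclidean unit sphere in $\mathbb R^p$, $SM$ is the bundle of rays of nonzero tangent vectors of $M$, and $dV_{SM}=\det(g_{\alpha\beta}/F)\,d\tau\wedge dt^1\wedge\dots\wedge dt^p$ with $d\tau=\sum_\alpha(-1)^{\alpha-1}s^\alpha\,ds^1\wedge\dots\wedge\widehat{ds^\alpha}\wedge\dots\wedge ds^p$ (integrated as a positive density). The map $\varphi$ is \emph{harmonic} (in the sense of Shen and Zhang) if $\frac{d}{du}\big|_{u=0}E(\varphi_u)$ exists and equals $0$ for every smooth variation $(\varphi_u)_{|u|<\epsilon}$ of $\varphi=\varphi_0$.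 \textbf{Proposition.} Every affine map $\varphi:(M,F)\to(N,\widetilde F)$ is a harmonic map between the Finsler manifolds $(M,F)$ and $(N,\widetilde F)$, and its tension field vanishes: $\tau^i(\varphi)=0$ for all $i$ at every $(t,s)\in TM\setminus\{0\}$. -/

import Mathlib

open MeasureTheory Set
open scoped Manifold ContDiff

noncomputable section

namespace FinslerMaps

/-- The coordinate space `ℝ^p`. -/
abbrev Coord (p : ℕ) : Type := EuclideanSpace ℝ (Fin p)

/-! ### Finsler geometry in induced local coordinates `(t, s)` of the tangent bundle

`L t s` stands for the Finsler function read in a chart. -/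

section Local

variable {p : ℕ}

/-- `∂f/∂t^α`. -/
def dT (α : Fin p) (f : Coord p → Coord p → ℝ) : Coord p → Coord p → ℝ :=
  fun t s => fderiv ℝ (fun t' => f t' s) t (EuclideanSpace.single α 1)

/-- `∂f/∂s^α`. -/
def dS (α : Fin p) (f : Coord p → Coord p → ℝ) : Coord p → Coord p → ℝ :=
  fun t s => fderiv ℝ (fun s' => f t s') s (EuclideanSpace.single α 1)

/-- The fundamental tensor `g_{αβ} = ½ ∂²L²/∂s^α∂s^β`. -/
def metric (L : Coord p → Coord p → ℝ) (α β : Fin p) : Coord p → Coord p → ℝ :=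
  fun t s => (1 / 2) * dS α (dS β (fun t' s' => L t' s' ^ 2)) t s

/-- The matrix `(g_{αβ}(t, s))`. -/
def metricMatrix (L : Coord p → Coord p → ℝ) (t s : Coord p) : Matrix (Fin p) (Fin p) ℝ :=
  Matrix.of fun α β => metric L α β t s

/-- The inverse metric `g^{αβ}`. -/
def invMetric (L : Coord p → Coord p → ℝ) (α β : Fin p) : Coord p → Coord p → ℝ :=
  fun t s => (metricMatrix L t s)⁻¹ α β

/-- The Cartan tensor `C_{αβγ} = ½ ∂g_{αβ}/∂s^γ`. -/
def cartan (L : Coord p → Coord p → ℝ) (α β γ : Fin p) : Coord p → Coord p → ℝ :=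
  fun t s => (1 / 2) * dS γ (metric L α β) t s

/-- `C^γ_{αβ} = g^{γλ} C_{λαβ}`. -/
def cartanUp (L : Coord p → Coord p → ℝ) (γ α β : Fin p) : Coord p → Coord p → ℝ :=
  fun t s => ∑ l, invMetric L γ l t s * cartan L l α β t s

/-- The formal Christoffel symbols `γ^μ_{αβ}`. -/
def formalChristoffel (L : Coord p → Coord p → ℝ) (μ α β : Fin p) : Coord p → Coord p → ℝ :=
  fun t s => ∑ ε, invMetric L μ ε t s / 2 *
    (dT β (metric L ε α) t s + dT α (metric L ε β) t s - dT ε (metric L α β) t s)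

/-- The nonlinear Cartan connection
`N^β_α = γ^β_{αε} s^ε - C^β_{αε} γ^ε_{μν} s^μ s^ν`. -/
def nonlinConn (L : Coord p → Coord p → ℝ) (β α : Fin p) : Coord p → Coord p → ℝ :=
  fun t s => ∑ ε, formalChristoffel L β α ε t s * s ε -
    ∑ ε, ∑ μ, ∑ ν, cartanUp L β α ε t s * formalChristoffel L ε μ ν t s * s μ * s ν

/-- `δf/δt^α = ∂f/∂t^α - N^ε_α ∂f/∂s^ε`. -/
def deltaT (L : Coord p → Coord p → ℝ) (α : Fin p) (f : Coord p → Coord p → ℝ) :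
    Coord p → Coord p → ℝ :=
  fun t s => dT α f t s - ∑ ε, nonlinConn L ε α t s * dS ε f t s

/-- The coefficients `Γ^γ_{αβ}` of the Rund (Chern) connection. -/
def rund (L : Coord p → Coord p → ℝ) (γ α β : Fin p) : Coord p → Coord p → ℝ :=
  fun t s => ∑ μ, invMetric L γ μ t s / 2 *
    (deltaT L β (metric L μ α) t s + deltaT L α (metric L μ β) t s
      - deltaT L μ (metric L α β) t s)

/-- The horizontal covariant derivative `C^γ_{αβ|μ}` with respect to the Rund connection. -/
def cartanHor (L : Coord p → Coord p → ℝ) (γ α β μ : Fin p) : Coord p → Coord p → ℝ :=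
  fun t s => deltaT L μ (cartanUp L γ α β) t s
    + ∑ ε, cartanUp L ε α β t s * rund L γ ε μ t s
    - ∑ ε, cartanUp L γ ε β t s * rund L ε α μ t s
    - ∑ ε, cartanUp L γ α ε t s * rund L ε β μ t s

/-- The coefficients `B^γ_{αβ} = Γ^γ_{αβ} + C^γ_{αβ|μ} s^μ` of the Berwald connection. -/
def berwald (L : Coord p → Coord p → ℝ) (γ α β : Fin p) : Coord p → Coord p → ℝ :=
  fun t s => rund L γ α β t s + ∑ μ, cartanHor L γ α β μ t s * s μ

/-- `C^i_{jkl} = g^{im} ∂C_{jkl}/∂s^m`. -/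
def cartanDeriv (L : Coord p → Coord p → ℝ) (i j k l : Fin p) : Coord p → Coord p → ℝ :=
  fun t s => ∑ m, invMetric L i m t s * dS m (cartan L j k l) t s

end Local

/-! ### Maps in local coordinates -/

section LocalMaps

variable {p n : ℕ}

/-- `φ^i_α = ∂φ^i/∂t^α`. -/
def d1 (φ : Coord p → Coord n) (i : Fin n) (α : Fin p) : Coord p → ℝ :=
  fun t => fderiv ℝ (fun t' => φ t' i) t (EuclideanSpace.single α 1)

/-- `φ^i_{αβ} = ∂²φ^i/∂t^α∂t^β`. -/
def d2 (φ : Coord p → Coord n) (i : Fin n) (α β : Fin p) : Coord p → ℝ :=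
  fun t => fderiv ℝ (d1 φ i β) t (EuclideanSpace.single α 1)

/-- The image `y^i = φ^i_α s^α` of a tangent vector. -/
def push (φ : Coord p → Coord n) (t s : Coord p) : Coord n :=
  WithLp.toLp 2 fun i => ∑ α, d1 φ i α t * s α

/-- `φ^i_{αβ} - B^γ_{αβ} φ^i_γ + B̃^i_{jk} φ^j_α φ^k_β`, where `B` is taken at `(t, s)` and
`B̃` at `(φ(t), φ_ε(t) s^ε)`. -/
def affineExpr (L : Coord p → Coord p → ℝ) (L' : Coord n → Coord n → ℝ)
    (φ : Coord p → Coord n) (i : Fin n) (α β : Fin p) (t s : Coord p) : ℝ :=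
  d2 φ i α β t - ∑ γ, berwald L γ α β t s * d1 φ i γ t
    + ∑ j, ∑ k, berwald L' i j k (φ t) (push φ t s) * d1 φ j α t * d1 φ k β t

/-- The same expression with the Rund connections in place of the Berwald connections. -/
def rundExpr (L : Coord p → Coord p → ℝ) (L' : Coord n → Coord n → ℝ)
    (φ : Coord p → Coord n) (i : Fin n) (α β : Fin p) (t s : Coord p) : ℝ :=
  d2 φ i α β t - ∑ γ, rund L γ α β t s * d1 φ i γ t
    + ∑ j, ∑ k, rund L' i j k (φ t) (push φ t s) * d1 φ j α t * d1 φ k β t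

/-- The components `τ^i(φ)` of the tension field at `(t, s)`. -/
def tension (L : Coord p → Coord p → ℝ) (L' : Coord n → Coord n → ℝ)
    (φ : Coord p → Coord n) (i : Fin n) (t s : Coord p) : ℝ :=
  ∑ α, ∑ β, invMetric L α β t s * affineExpr L L' φ i α β t s
  + 4 * ∑ α, ∑ β, ∑ γ, ∑ j, ∑ k, invMetric L α β t s
      * cartanUp L' i j k (φ t) (push φ t s) * d1 φ k α t
      * rundExpr L L' φ j β γ t s * s γ
  + ∑ α, ∑ β, ∑ γ, ∑ ε, ∑ j, ∑ k, ∑ l, invMetric L α β t s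
      * cartanDeriv L' i j k l (φ t) (push φ t s) * d1 φ k α t * d1 φ l β t
      * rundExpr L L' φ j γ ε t s * s γ * s ε

/-- The energy density `½ g^{αβ}(t, s) g̃_{ij}(φ(t), φ_ε(t) s^ε) φ^i_α φ^j_β`. -/
def localEnergyDensity (L : Coord p → Coord p → ℝ) (L' : Coord n → Coord n → ℝ)
    (φ : Coord p → Coord n) (t s : Coord p) : ℝ :=
  (1 / 2) * ∑ α, ∑ β, ∑ i, ∑ j, invMetric L α β t s
    * metric L' i j (φ t) (push φ t s) * d1 φ i α t * d1 φ j β t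

end LocalMaps

/-! ### Finsler manifolds -/

section Manifold

variable {p : ℕ} {M : Type*} [TopologicalSpace M] [ChartedSpace (Coord p) M]

/-- A function on `TM` read in the coordinates `(t, s)` of `TM` induced by the chart `e`. -/
def localRep (F : TangentBundle (𝓡 p) M → ℝ) (e : OpenPartialHomeomorph M (Coord p)) :
    Coord p → Coord p → ℝ :=
  fun t s => F ⟨e.symm t, mfderiv (𝓡 p) (𝓡 p) e.symm t s⟩

variable (p M) in
/-- A Finsler structure: a function on `TM` which is smooth off the zero section, positively
homogeneous of degree one on the fibres, and strongly convex. -/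
structure FinslerStructure [IsManifold (𝓡 p) ∞ M] where
  toFun : TangentBundle (𝓡 p) M → ℝ
  nonneg : ∀ v, 0 ≤ toFun v
  smooth : ContMDiffOn (𝓡 p).tangent 𝓘(ℝ, ℝ) ∞ toFun {v | v.2 ≠ 0}
  homogeneous : ∀ (x : M) (s : TangentSpace (𝓡 p) x) (c : ℝ), 0 < c →
    toFun ⟨x, c • s⟩ = c * toFun ⟨x, s⟩
  convex : ∀ e ∈ IsManifold.maximalAtlas (𝓡 p) ∞ M, ∀ t ∈ e.target, ∀ s : Coord p, s ≠ 0 →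
    (metricMatrix (localRep toFun e) t s).PosDef

variable (p M) in
/-- An orientation of a smooth manifold, given by an oriented atlas. -/
structure SmoothOrientation where
  charts : Set (OpenPartialHomeomorph M (Coord p))
  smooth : charts ⊆ IsManifold.maximalAtlas (𝓡 p) ∞ M
  cover : ∀ x : M, ∃ e ∈ charts, x ∈ e.source
  det_pos : ∀ e ∈ charts, ∀ e' ∈ charts, ∀ x ∈ e.source ∩ e'.source,
    0 < (fderiv ℝ (fun t => e' (e.symm t)) (e x)).det

/-! ### The sphere bundle and its volume -/

variable [IsManifold (𝓡 p) ∞ M]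

instance : MeasurableSpace (TangentBundle (𝓡 p) M) := borel _

instance : BorelSpace (TangentBundle (𝓡 p) M) := ⟨rfl⟩

/-- The volume of the part of the sphere bundle `SM` lying over the domain of the chart `e`.
A ray of tangent vectors is represented in `TM` by its vector with `F = 1`, and is parametrized by
its vector `s` of coordinate norm one. In these parameters the volume form
`det(g_{αβ}/F) (∑ (-1)^{α-1} s^α ds^1 ∧ … ∧ (omit ds^α) ∧ … ∧ ds^p) ∧ dt^1 ∧ … ∧ dt^p` of `SM`
is `det(g_{αβ}/F)` times the product of the Lebesgue measure and the surface measure of the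
Euclidean unit sphere. -/
def localSphereVolume (F : TangentBundle (𝓡 p) M → ℝ) (e : OpenPartialHomeomorph M (Coord p)) :
    Measure (TangentBundle (𝓡 p) M) :=
  ((((volume : Measure (Coord p)).restrict e.target).prod
      (volume : Measure (Coord p)).toSphere).withDensity fun z =>
        ENNReal.ofReal ((localRep F e z.1 z.2)⁻¹ • metricMatrix (localRep F e) z.1 z.2).det).map
    fun z => ⟨e.symm z.1,
      (localRep F e z.1 z.2)⁻¹ • mfderiv (𝓡 p) (𝓡 p) e.symm z.1 (z.2 : Coord p)⟩

/-- The volume measure `dV_{SM}` of the sphere bundle, as a measure on `TM` carried by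
`SM = {F = 1}`. The local volumes agree over the intersection of two chart domains, and the measure
that they glue to is their supremum. -/
def sphereVolume (F : TangentBundle (𝓡 p) M → ℝ) : Measure (TangentBundle (𝓡 p) M) :=
  ⨆ e ∈ IsManifold.maximalAtlas (𝓡 p) ∞ M, localSphereVolume F e

end Manifold

/-! ### Affine maps and harmonic maps -/

section Maps

variable {p n : ℕ} {M N : Type*} [TopologicalSpace M] [ChartedSpace (Coord p) M]
  [TopologicalSpace N] [ChartedSpace (Coord n) N]

/-- A map read in two charts. -/
def localMap (φ : M → N) (e : OpenPartialHomeomorph M (Coord p))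
    (e' : OpenPartialHomeomorph N (Coord n)) : Coord p → Coord n :=
  fun t => e' (φ (e.symm t))

variable (p n) in
/-- `Ker(dφ) = {0}` at every point. -/
def Nondegenerate (φ : M → N) : Prop :=
  ∀ (x : M) (v : TangentSpace (𝓡 p) x), mfderiv (𝓡 p) (𝓡 n) φ x v = 0 → v = 0

/-- Affine maps between Finsler manifolds. -/
structure IsAffineMap [IsManifold (𝓡 p) ∞ M] [IsManifold (𝓡 n) ∞ N]
    (F : FinslerStructure p M) (F' : FinslerStructure n N) (φ : M → N) : Prop where
  smooth : ContMDiff (𝓡 p) (𝓡 n) ∞ φ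
  nondegenerate : Nondegenerate p n φ
  eq_zero : ∀ e ∈ IsManifold.maximalAtlas (𝓡 p) ∞ M, ∀ e' ∈ IsManifold.maximalAtlas (𝓡 n) ∞ N,
    ∀ t ∈ e.target, φ (e.symm t) ∈ e'.source → ∀ s : Coord p, s ≠ 0 →
      ∀ (i : Fin n) (α β : Fin p),
        affineExpr (localRep F.toFun e) (localRep F'.toFun e') (localMap φ e e') i α β t s = 0

/-- The tension field of `φ` vanishes identically on `TM \ {0}`. -/
def TensionVanishes [IsManifold (𝓡 p) ∞ M] [IsManifold (𝓡 n) ∞ N]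
    (F : FinslerStructure p M) (F' : FinslerStructure n N) (φ : M → N) : Prop :=
  ∀ e ∈ IsManifold.maximalAtlas (𝓡 p) ∞ M, ∀ e' ∈ IsManifold.maximalAtlas (𝓡 n) ∞ N,
    ∀ t ∈ e.target, φ (e.symm t) ∈ e'.source → ∀ s : Coord p, s ≠ 0 → ∀ i : Fin n,
      tension (localRep F.toFun e) (localRep F'.toFun e') (localMap φ e e') i t s = 0

/-- The energy density `e(φ)` at a tangent vector `v`, computed in the preferred charts at the
base point of `v` and at its image; its value does not depend on the charts. -/
def energyDensity (F : TangentBundle (𝓡 p) M → ℝ) (F' : TangentBundle (𝓡 n) N → ℝ) (φ : M → N)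
    (v : TangentBundle (𝓡 p) M) : ℝ :=
  let e := chartAt (Coord p) v.proj
  let e' := chartAt (Coord n) (φ v.proj)
  localEnergyDensity (localRep F e) (localRep F' e') (localMap φ e e')
    (e v.proj) (mfderiv (𝓡 p) (𝓡 p) e v.proj v.2)

/-- The energy `E(φ) = (1/c_{p-1}) ∫_{SM} e(φ) dV_{SM}`, where `c_{p-1}` is the volume of the
Euclidean unit sphere of `ℝ^p`. -/
def energy [IsManifold (𝓡 p) ∞ M] (F : TangentBundle (𝓡 p) M → ℝ)
    (F' : TangentBundle (𝓡 n) N → ℝ) (φ : M → N) : ℝ :=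
  ((volume : Measure (Coord p)).toSphere.real univ)⁻¹ *
    ∫ v, energyDensity F F' φ v ∂(sphereVolume F)

/-- A nondegenerate smooth map is harmonic if it is a critical point of the energy: the derivative
at `0` of the energy along every smooth variation exists and is zero. -/
structure IsHarmonicMap [IsManifold (𝓡 p) ∞ M] [IsManifold (𝓡 n) ∞ N]
    (F : FinslerStructure p M) (F' : FinslerStructure n N) (φ : M → N) : Prop where
  smooth : ContMDiff (𝓡 p) (𝓡 n) ∞ φ
  nondegenerate : Nondegenerate p n φ
  critical : ∀ (ε : ℝ) (Φ : ℝ × M → N), 0 < ε →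
    ContMDiffOn (𝓘(ℝ, ℝ).prod (𝓡 p)) (𝓡 n) ∞ Φ (Ioo (-ε) ε ×ˢ univ) →
    (∀ x, Φ (0, x) = φ x) →
    HasDerivAt (fun u => energy F.toFun F'.toFun fun x => Φ (u, x)) 0 0

end Maps

end FinslerMaps

end

/-! Write G^μ = γ^μ_{αβ} s^α s^β and X = s^α ∂/∂t^α - G^α ∂/∂s^α for the geodesic spray of F
(`spray`, `geo`), and X' for that of F'.

Tension. The Cartan tensor is annihilated by s. Hence the Rund and the Berwald coefficients have the
same contraction with s, namely the nonlinear connection (`sum_rund_mul`, `sum_berwald_mul`). The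
Rund brackets enter the tension field only contracted with s, and so they vanish together with the
Berwald brackets.

Harmonicity rests on four facts. (1) With u = F' ∘ dφ, the tensor g'_{ij} φ^i_α φ^j_β is half the
fibre Hessian of u², so the energy density is half its trace with respect to g
(`localEnergyDensity_eq`). The cofactors of g are divergence free in s. The divergence theorem in
the fibres therefore replaces the trace by p u²/F² (`integral_trace_eq`), and the energy becomes p/2
times the mean of u² over the sphere bundle. (2) The affine equation contracted twice with s says
that dφ carries X to X' (`spray_push`, `geo_comp_lift`). Together with the Euler–Lagrange equation
X'(∂F'²/∂y^k) = ∂F'²/∂x^k, this makes the derivative of u² along a variation with velocity V equal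
to X(W), where W = V^k ∂F'²/∂y^k (`hasDerivAt_localPull_sq`). (3) X preserves F and the measure det
g dt ds (`geo_sq`, `geo_det_eq`), so X is skew-adjoint (`integral_mul_geo`). (4) All this happens in
charts, with a partition of unity ρ_i. Integration by parts leaves -dρ_i(s) W in each chart; W is
intrinsic, and the sum over i vanishes because Σ ρ_i = 1 (`sum_differential_eq_zero`).

Integrals over the sphere bundle are replaced by integrals over the slit tangent bundle: the volume
of rays, times a constant, is the image of χ(F²) det g dt ds under v ↦ v/F(v), for a bump function χ
supported in [1, 2] (`bumpMass_smul_localSphereVolume`). The same description shows that the local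
volumes agree on overlaps. The cut-off costs nothing in (1) and (3), since X(F²) = 0 and the field
in the divergence theorem is tangent to the level sets of F. -/

noncomputable section

namespace FinslerMaps

/-! ### Calculus of functions of `(t, s)` off the zero section -/

section Calculus

variable {p : ℕ} {T : Set (Coord p)} {f g : Coord p → Coord p → ℝ} {t s : Coord p}

/-- `f` is smooth in `(t, s)` for `t ∈ T` and `s ≠ 0`. -/
def SmoothOff (T : Set (Coord p)) (f : Coord p → Coord p → ℝ) : Prop :=
  ContDiffOn ℝ ∞ (fun z : Coord p × Coord p => f z.1 z.2) (T ×ˢ {0}ᶜ)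

theorem isOpen_slit (hT : IsOpen T) : IsOpen (T ×ˢ ({0}ᶜ : Set (Coord p))) :=
  hT.prod isOpen_compl_singleton

theorem SmoothOff.contDiffAt (hf : SmoothOff T f) (hT : IsOpen T) (ht : t ∈ T) (hs : s ≠ 0) :
    ContDiffAt ℝ ∞ (fun z : Coord p × Coord p => f z.1 z.2) (t, s) :=
  ContDiffOn.contDiffAt hf ((isOpen_slit hT).mem_nhds ⟨ht, hs⟩)

theorem SmoothOff.differentiableAt (hf : SmoothOff T f) (hT : IsOpen T) (ht : t ∈ T)
    (hs : s ≠ 0) : DifferentiableAt ℝ (fun z : Coord p × Coord p => f z.1 z.2) (t, s) :=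
  (hf.contDiffAt hT ht hs).differentiableAt (by simp)

theorem hasFDerivAt_fst_slot (h : DifferentiableAt ℝ (fun z : Coord p × Coord p => f z.1 z.2) (t, s)) :
    HasFDerivAt (fun t' => f t' s)
      ((fderiv ℝ (fun z : Coord p × Coord p => f z.1 z.2) (t, s)).comp
        (ContinuousLinearMap.inl ℝ _ _)) t := by
  have h1 : HasFDerivAt (fun t' : Coord p => (t', s)) (ContinuousLinearMap.inl ℝ _ _) t :=
    hasFDerivAt_prodMk_left t s
  exact HasFDerivAt.comp (f := fun t' : Coord p => (t', s)) t h.hasFDerivAt h1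

theorem hasFDerivAt_snd_slot (h : DifferentiableAt ℝ (fun z : Coord p × Coord p => f z.1 z.2) (t, s)) :
    HasFDerivAt (fun s' => f t s')
      ((fderiv ℝ (fun z : Coord p × Coord p => f z.1 z.2) (t, s)).comp
        (ContinuousLinearMap.inr ℝ _ _)) s := by
  have h1 : HasFDerivAt (fun s' : Coord p => (t, s')) (ContinuousLinearMap.inr ℝ _ _) s :=
    hasFDerivAt_prodMk_right t s
  exact HasFDerivAt.comp (f := fun s' : Coord p => (t, s')) s h.hasFDerivAt h1

/-- Through the total derivative in (t, s), partial derivatives inherit smoothness, and mixed ones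
commute. -/
theorem dT_eq_fderiv (h : DifferentiableAt ℝ (fun z : Coord p × Coord p => f z.1 z.2) (t, s))
    (α : Fin p) : dT α f t s =
      fderiv ℝ (fun z : Coord p × Coord p => f z.1 z.2) (t, s) (EuclideanSpace.single α 1, 0) := by
  simp [dT, (hasFDerivAt_fst_slot h).fderiv]

theorem dS_eq_fderiv (h : DifferentiableAt ℝ (fun z : Coord p × Coord p => f z.1 z.2) (t, s))
    (α : Fin p) : dS α f t s =
      fderiv ℝ (fun z : Coord p × Coord p => f z.1 z.2) (t, s) (0, EuclideanSpace.single α 1) := by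
  simp [dS, (hasFDerivAt_snd_slot h).fderiv]

theorem contDiffOn_fderiv_apply {V : Type*} [NormedAddCommGroup V] [NormedSpace ℝ V]
    {f : V → ℝ} {U : Set V} (hU : IsOpen U) (hf : ContDiffOn ℝ ∞ f U) (v : V) :
    ContDiffOn ℝ ∞ (fun z => fderiv ℝ f z v) U :=
  (hf.fderiv_of_isOpen hU (by simp)).clm_apply contDiffOn_const

theorem SmoothOff.dT (hf : SmoothOff T f) (hT : IsOpen T) (α : Fin p) :
    SmoothOff T (dT α f) :=
  (contDiffOn_fderiv_apply (isOpen_slit hT) hf (EuclideanSpace.single α 1, 0)).congr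
    fun _ hz => dT_eq_fderiv (hf.differentiableAt hT hz.1 hz.2) α

theorem SmoothOff.dS (hf : SmoothOff T f) (hT : IsOpen T) (α : Fin p) :
    SmoothOff T (dS α f) :=
  (contDiffOn_fderiv_apply (isOpen_slit hT) hf (0, EuclideanSpace.single α 1)).congr
    fun _ hz => dS_eq_fderiv (hf.differentiableAt hT hz.1 hz.2) α

theorem SmoothOff.congr (hf : SmoothOff T f) (h : ∀ t ∈ T, ∀ s ≠ 0, g t s = f t s) :
    SmoothOff T g :=
  ContDiffOn.congr hf fun z hz => h z.1 hz.1 z.2 hz.2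

theorem SmoothOff.add (hf : SmoothOff T f) (hg : SmoothOff T g) :
    SmoothOff T (fun t s => f t s + g t s) := ContDiffOn.add hf hg

theorem SmoothOff.sub (hf : SmoothOff T f) (hg : SmoothOff T g) :
    SmoothOff T (fun t s => f t s - g t s) := ContDiffOn.sub hf hg

theorem SmoothOff.mul (hf : SmoothOff T f) (hg : SmoothOff T g) :
    SmoothOff T (fun t s => f t s * g t s) := ContDiffOn.mul hf hg

theorem SmoothOff.const (c : ℝ) : SmoothOff T (fun _ _ => c) := contDiffOn_const

theorem SmoothOff.const_mul (c : ℝ) (hf : SmoothOff T f) :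
    SmoothOff T (fun t s => c * f t s) := (SmoothOff.const c).mul hf

theorem SmoothOff.pow (hf : SmoothOff T f) (k : ℕ) :
    SmoothOff T (fun t s => f t s ^ k) := ContDiffOn.pow hf k

theorem SmoothOff.inv (hf : SmoothOff T f) (h : ∀ t ∈ T, ∀ s ≠ 0, f t s ≠ 0) :
    SmoothOff T (fun t s => (f t s)⁻¹) :=
  ContDiffOn.inv hf fun z hz => h z.1 hz.1 z.2 hz.2

theorem SmoothOff.sum {ι : Type*} {A : Finset ι} {f : ι → Coord p → Coord p → ℝ}
    (h : ∀ i ∈ A, SmoothOff T (f i)) : SmoothOff T (fun t s => ∑ i ∈ A, f i t s) :=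
  ContDiffOn.sum (f := fun i (z : Coord p × Coord p) => f i z.1 z.2) h

theorem SmoothOff.prod {ι : Type*} {A : Finset ι} {f : ι → Coord p → Coord p → ℝ}
    (h : ∀ i ∈ A, SmoothOff T (f i)) : SmoothOff T (fun t s => ∏ i ∈ A, f i t s) :=
  contDiffOn_prod (f := fun i (z : Coord p × Coord p) => f i z.1 z.2) h

theorem SmoothOff.coord (α : Fin p) : SmoothOff T (fun _ s => s α) :=
  ContDiff.contDiffOn (by fun_prop)

/-- The slit domain is open, so identities valid only there may still be differentiated. Tensor
identities below are differentiated in this way. -/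
theorem dT_congr (hT : IsOpen T) (h : ∀ t ∈ T, ∀ s ≠ 0, f t s = g t s) (ht : t ∈ T)
    (hs : s ≠ 0) (α : Fin p) : dT α f t s = dT α g t s := by
  unfold dT
  rw [Filter.EventuallyEq.fderiv_eq]
  filter_upwards [hT.mem_nhds ht] with t' ht' using h t' ht' s hs

theorem dS_congr (h : ∀ s ≠ 0, f t s = g t s) (hs : s ≠ 0) (α : Fin p) :
    dS α f t s = dS α g t s := by
  unfold dS
  rw [Filter.EventuallyEq.fderiv_eq]
  filter_upwards [isOpen_compl_singleton.mem_nhds hs] with s' hs' using h s' hs'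

/-! ### Product and sum rules for the partial derivatives -/

section Leibniz

theorem SmoothOff.slot_fst (hf : SmoothOff T f) (hT : IsOpen T) (ht : t ∈ T) (hs : s ≠ 0) :
    DifferentiableAt ℝ (fun t' => f t' s) t :=
  (hasFDerivAt_fst_slot (hf.differentiableAt hT ht hs)).differentiableAt

theorem SmoothOff.slot_snd (hf : SmoothOff T f) (hT : IsOpen T) (ht : t ∈ T) (hs : s ≠ 0) :
    DifferentiableAt ℝ (fun s' => f t s') s :=
  (hasFDerivAt_snd_slot (hf.differentiableAt hT ht hs)).differentiableAt

theorem dT_mul (hf : SmoothOff T f) (hg : SmoothOff T g) (hT : IsOpen T) (ht : t ∈ T)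
    (hs : s ≠ 0) (α : Fin p) : dT α (fun t s => f t s * g t s) t s =
      dT α f t s * g t s + f t s * dT α g t s := by
  unfold dT
  rw [fderiv_fun_mul (hf.slot_fst hT ht hs) (hg.slot_fst hT ht hs)]
  simp; ring

theorem dS_mul (hf : SmoothOff T f) (hg : SmoothOff T g) (hT : IsOpen T) (ht : t ∈ T)
    (hs : s ≠ 0) (α : Fin p) : dS α (fun t s => f t s * g t s) t s =
      dS α f t s * g t s + f t s * dS α g t s := by
  unfold dS
  rw [fderiv_fun_mul (hf.slot_snd hT ht hs) (hg.slot_snd hT ht hs)]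
  simp; ring

theorem dT_sum {ι : Type*} {A : Finset ι} {f : ι → Coord p → Coord p → ℝ}
    (h : ∀ i ∈ A, SmoothOff T (f i)) (hT : IsOpen T) (ht : t ∈ T) (hs : s ≠ 0) (α : Fin p) :
    dT α (fun t s => ∑ i ∈ A, f i t s) t s = ∑ i ∈ A, dT α (f i) t s := by
  unfold dT
  rw [fderiv_fun_sum fun i hi => (h i hi).slot_fst hT ht hs]
  simp

theorem dS_sum {ι : Type*} {A : Finset ι} {f : ι → Coord p → Coord p → ℝ}
    (h : ∀ i ∈ A, SmoothOff T (f i)) (hT : IsOpen T) (ht : t ∈ T) (hs : s ≠ 0) (α : Fin p) :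
    dS α (fun t s => ∑ i ∈ A, f i t s) t s = ∑ i ∈ A, dS α (f i) t s := by
  unfold dS
  rw [fderiv_fun_sum fun i hi => (h i hi).slot_snd hT ht hs]
  simp

theorem dT_const (c : ℝ) (α : Fin p) : dT α (fun _ _ => c) t s = 0 := by simp [dT]

theorem dS_const (c : ℝ) (α : Fin p) : dS α (fun _ _ => c) t s = 0 := by simp [dS]

theorem dT_const_mul (hf : SmoothOff T f) (hT : IsOpen T) (ht : t ∈ T)
    (hs : s ≠ 0) (c : ℝ) (α : Fin p) : dT α (fun t s => c * f t s) t s = c * dT α f t s := by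
  rw [dT_mul (SmoothOff.const c) hf hT ht hs, dT_const, zero_mul, zero_add]

theorem dS_const_mul (hf : SmoothOff T f) (hT : IsOpen T) (ht : t ∈ T)
    (hs : s ≠ 0) (c : ℝ) (α : Fin p) : dS α (fun t s => c * f t s) t s = c * dS α f t s := by
  rw [dS_mul (SmoothOff.const c) hf hT ht hs, dS_const, zero_mul, zero_add]

theorem dT_coord (β α : Fin p) : dT α (fun _ s => s β) t s = 0 := by simp [dT]

theorem dS_coord (β α : Fin p) :
    dS α (fun _ s => s β) t s = if β = α then 1 else 0 := by
  unfold dS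
  have : fderiv ℝ (fun s' : Coord p => s' β) s = EuclideanSpace.proj β :=
    (EuclideanSpace.proj β : Coord p →L[ℝ] ℝ).hasFDerivAt.fderiv
  rw [this]
  simp

end Leibniz

theorem fderiv_fderiv_apply_comm {V : Type*} [NormedAddCommGroup V] [NormedSpace ℝ V]
    {W : Type*} [NormedAddCommGroup W] [NormedSpace ℝ W] {f : V → W} {z : V} (hf : ContDiffAt ℝ ∞ f z) (v w : V) :
    fderiv ℝ (fun z => fderiv ℝ f z v) z w = fderiv ℝ (fun z => fderiv ℝ f z w) z v := by
  have hd : DifferentiableAt ℝ (fderiv ℝ f) z :=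
    (hf.fderiv_right (m := 1) (by norm_cast)).differentiableAt (by simp)
  rw [fderiv_clm_apply hd (differentiableAt_const _), fderiv_clm_apply hd (differentiableAt_const _)]
  have h2 : IsSymmSndFDerivAt ℝ f z := hf.isSymmSndFDerivAt (by simp; norm_cast)
  simpa using h2 w v

theorem dS_dS_comm (hf : SmoothOff T f) (hT : IsOpen T) (ht : t ∈ T) (hs : s ≠ 0)
    (α β : Fin p) : dS α (dS β f) t s = dS β (dS α f) t s := by
  have key : ∀ α β : Fin p, dS α (dS β f) t s =
      fderiv ℝ (fun z => fderiv ℝ (fun z : Coord p × Coord p => f z.1 z.2) z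
        (0, EuclideanSpace.single β 1)) (t, s) (0, EuclideanSpace.single α 1) := by
    intro α β
    rw [dS_eq_fderiv ((hf.dS hT β).differentiableAt hT ht hs)]
    rw [Filter.EventuallyEq.fderiv_eq]
    filter_upwards [(isOpen_slit hT).mem_nhds (⟨ht, hs⟩ : (t, s) ∈ T ×ˢ ({0}ᶜ : Set (Coord p)))]
      with z hz using dS_eq_fderiv (hf.differentiableAt hT hz.1 hz.2) β
  rw [key, key, fderiv_fderiv_apply_comm (hf.contDiffAt hT ht hs)]

theorem dT_dS_comm (hf : SmoothOff T f) (hT : IsOpen T) (ht : t ∈ T) (hs : s ≠ 0)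
    (α β : Fin p) : dT α (dS β f) t s = dS β (dT α f) t s := by
  rw [dT_eq_fderiv ((hf.dS hT β).differentiableAt hT ht hs),
    dS_eq_fderiv ((hf.dT hT α).differentiableAt hT ht hs)]
  have hn := (isOpen_slit hT).mem_nhds (⟨ht, hs⟩ : (t, s) ∈ T ×ˢ ({0}ᶜ : Set (Coord p)))
  have e1 : fderiv ℝ (fun z : Coord p × Coord p => dS β f z.1 z.2) (t, s) =
      fderiv ℝ (fun z => fderiv ℝ (fun z : Coord p × Coord p => f z.1 z.2) z
        (0, EuclideanSpace.single β 1)) (t, s) := by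
    apply Filter.EventuallyEq.fderiv_eq
    filter_upwards [hn] with z hz using dS_eq_fderiv (hf.differentiableAt hT hz.1 hz.2) β
  have e2 : fderiv ℝ (fun z : Coord p × Coord p => dT α f z.1 z.2) (t, s) =
      fderiv ℝ (fun z => fderiv ℝ (fun z : Coord p × Coord p => f z.1 z.2) z
        (EuclideanSpace.single α 1, 0)) (t, s) := by
    apply Filter.EventuallyEq.fderiv_eq
    filter_upwards [hn] with z hz using dT_eq_fderiv (hf.differentiableAt hT hz.1 hz.2) α
  rw [e1, e2, fderiv_fderiv_apply_comm (hf.contDiffAt hT ht hs)]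

/-- Linear expansion of a vector in the standard basis. -/
theorem sum_smul_single (v : Coord p) :
    ∑ α, v α • (EuclideanSpace.single α (1 : ℝ) : Coord p) = v := by
  ext i
  simp [Finset.sum_apply, Pi.single_apply]

theorem fderiv_snd_eq_sum_dS (t s v : Coord p) :
    fderiv ℝ (fun s' => f t s') s v = ∑ α, v α * dS α f t s := by
  conv_lhs => rw [← sum_smul_single v]
  simp [dS]

theorem fderiv_fst_eq_sum_dT (t s v : Coord p) :
    fderiv ℝ (fun t' => f t' s) t v = ∑ α, v α * dT α f t s := by
  conv_lhs => rw [← sum_smul_single v]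
  simp [dT]

theorem fderiv_eq_sum_dT_dS
    (h : DifferentiableAt ℝ (fun z : Coord p × Coord p => f z.1 z.2) (t, s)) (v w : Coord p) :
    fderiv ℝ (fun z : Coord p × Coord p => f z.1 z.2) (t, s) (v, w) =
      ∑ α, v α * dT α f t s + ∑ α, w α * dS α f t s := by
  rw [← fderiv_fst_eq_sum_dT, ← fderiv_snd_eq_sum_dS, (hasFDerivAt_fst_slot h).fderiv,
    (hasFDerivAt_snd_slot h).fderiv]
  simp [← map_add]

/-- Euler's relation of degree `k` in the variable `s`. -/
def EulerDeg (T : Set (Coord p)) (k : ℝ) (f : Coord p → Coord p → ℝ) : Prop :=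
  ∀ t ∈ T, ∀ s ≠ 0, ∑ α, s α * dS α f t s = k * f t s

/-- Differentiate f(t, c s) = c^k f(t, s) in c at c = 1. The infinitesimal form is the one that
passes to derivatives in t and s. -/
theorem EulerDeg.of_homogeneous {k : ℕ} (hf : SmoothOff T f) (hT : IsOpen T)
    (h : ∀ t ∈ T, ∀ s ≠ 0, ∀ c : ℝ, 0 < c → f t (c • s) = c ^ k * f t s) :
    EulerDeg T k f := by
  intro t ht s hs
  rw [← fderiv_snd_eq_sum_dS]
  have h1 : HasDerivAt (fun c : ℝ => f t (c • s)) (fderiv ℝ (fun s' => f t s') s s) 1 := by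
    have hd : HasFDerivAt (fun s' => f t s') (fderiv ℝ (fun s' => f t s') s) ((1 : ℝ) • s) := by
      rw [one_smul]; exact (hf.slot_snd hT ht hs).hasFDerivAt
    have := hd.comp_hasDerivAt (1 : ℝ) ((hasDerivAt_id (1 : ℝ)).smul_const s)
    simpa [Function.comp_def] using this
  have h2 : HasDerivAt (fun c : ℝ => f t (c • s)) (k * f t s) 1 := by
    have : HasDerivAt (fun c : ℝ => c ^ k * f t s) (k * f t s) 1 := by
      simpa using (hasDerivAt_pow k (1 : ℝ)).mul_const (f t s)
    refine this.congr_of_eventuallyEq ?_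
    filter_upwards [lt_mem_nhds (zero_lt_one (α := ℝ))] with c hc using h t ht s hs c hc
  exact h1.unique h2

/-- Differentiating Euler's relation in s^β, the factor s^α contributes one extra copy of ∂f/∂s^β,
which lowers the degree by one. -/
theorem EulerDeg.dS {k : ℝ} (h : EulerDeg T k f) (hf : SmoothOff T f) (hT : IsOpen T)
    (β : Fin p) : EulerDeg T (k - 1) (dS β f) := by
  intro t ht s hs
  have h1 := dS_congr (f := fun t s => ∑ α, s α * FinslerMaps.dS α f t s) (g := fun t s => k * f t s)
    (t := t) (h t ht) hs β
  rw [dS_const_mul hf hT ht hs, dS_sum (fun α _ => (SmoothOff.coord α).mul (hf.dS hT α)) hT ht hs]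
    at h1
  simp_rw [fun α => dS_mul (SmoothOff.coord α) (hf.dS hT α) hT ht hs β, dS_coord,
    Finset.sum_add_distrib, fun α => dS_dS_comm hf hT ht hs β α] at h1
  simp at h1
  linarith

theorem EulerDeg.dT {k : ℝ} (h : EulerDeg T k f) (hf : SmoothOff T f) (hT : IsOpen T)
    (β : Fin p) : EulerDeg T k (dT β f) := by
  intro t ht s hs
  have h1 := dT_congr (f := fun t s => ∑ α, s α * FinslerMaps.dS α f t s) (g := fun t s => k * f t s)
    hT h ht hs β
  rw [dT_const_mul hf hT ht hs, dT_sum (fun α _ => (SmoothOff.coord α).mul (hf.dS hT α)) hT ht hs]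
    at h1
  simp_rw [fun α => dT_mul (SmoothOff.coord α) (hf.dS hT α) hT ht hs β, dT_coord, zero_mul,
    zero_add, fun α => dT_dS_comm hf hT ht hs β α] at h1
  exact h1

theorem EulerDeg.const_mul {k : ℝ} (h : EulerDeg T k f) (hf : SmoothOff T f) (hT : IsOpen T)
    (c : ℝ) : EulerDeg T k (fun t s => c * f t s) := by
  intro t ht s hs
  simp_rw [dS_const_mul hf hT ht hs]
  have := h t ht s hs
  calc _ = c * ∑ α, s α * FinslerMaps.dS α f t s := by
        rw [Finset.mul_sum]; exact Finset.sum_congr rfl fun _ _ => by ring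
    _ = _ := by rw [this]; ring

end Calculus

end FinslerMaps

end

noncomputable section

namespace FinslerMaps

/-! ### Local Finsler geometry -/

section LocalFinsler

variable {p : ℕ} {T : Set (Coord p)} {L : Coord p → Coord p → ℝ} {t s : Coord p}

/-- A Finsler structure in induced coordinates over the open set `T`. -/
structure IsLocalFinsler (L : Coord p → Coord p → ℝ) (T : Set (Coord p)) : Prop where
  isOpen : IsOpen T
  smooth : SmoothOff T L
  nonneg : ∀ t s, 0 ≤ L t s
  homogeneous : ∀ t s, ∀ c : ℝ, 0 < c → L t (c • s) = c * L t s
  posDef : ∀ t ∈ T, ∀ s ≠ 0, (metricMatrix L t s).PosDef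

theorem SmoothOff.det {ι : Type*} [Fintype ι] [DecidableEq ι] {m : ι → ι → Coord p → Coord p → ℝ}
    (hm : ∀ i j, SmoothOff T (m i j)) :
    SmoothOff T (fun t s => (Matrix.of fun i j => m i j t s).det) := by
  simp_rw [Matrix.det_apply']
  exact SmoothOff.sum fun σ _ => (SmoothOff.const _).mul (SmoothOff.prod fun i _ => hm _ _)

theorem SmoothOff.metric {h : Coord p → Coord p → ℝ} (hh : SmoothOff T h) (hT : IsOpen T)
    (α β : Fin p) : SmoothOff T (metric h α β) :=
  (((hh.pow 2).dS hT β).dS hT α).const_mul _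

theorem metric_symm {h : Coord p → Coord p → ℝ} (hh : SmoothOff T h) (hT : IsOpen T)
    (ht : t ∈ T) (hs : s ≠ 0) (α β : Fin p) : metric h α β t s = metric h β α t s := by
  rw [metric, metric, dS_dS_comm (hh.pow 2) hT ht hs]

theorem invMetric_eq (L : Coord p → Coord p → ℝ) (t s : Coord p) (α β : Fin p) :
    invMetric L α β t s =
      ((metricMatrix L t s).det)⁻¹ * (metricMatrix L t s).adjugate α β := by
  rw [invMetric, Matrix.inv_def, Ring.inverse_eq_inv']
  rfl

namespace IsLocalFinsler

theorem smooth_metric (h : IsLocalFinsler L T) (α β : Fin p) : SmoothOff T (metric L α β) :=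
  h.smooth.metric h.isOpen α β

theorem metric_symm (h : IsLocalFinsler L T) (ht : t ∈ T) (hs : s ≠ 0) (α β : Fin p) :
    metric L α β t s = metric L β α t s :=
  FinslerMaps.metric_symm h.smooth h.isOpen ht hs α β

theorem smooth_det (h : IsLocalFinsler L T) : SmoothOff T (fun t s => (metricMatrix L t s).det) :=
  SmoothOff.det h.smooth_metric

theorem det_pos (h : IsLocalFinsler L T) (ht : t ∈ T) (hs : s ≠ 0) : 0 < (metricMatrix L t s).det :=
  (h.posDef t ht s hs).det_pos

/-- Each cofactor is the determinant of g with one row replaced by a constant basis vector. -/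
theorem smooth_adjugate (h : IsLocalFinsler L T) (α β : Fin p) :
    SmoothOff T (fun t s => (metricMatrix L t s).adjugate α β) := by
  simp_rw [Matrix.adjugate_apply]
  refine (SmoothOff.det (T := T) (m := fun i j t s =>
    if i = β then (Pi.single α 1 : Fin p → ℝ) j else metric L i j t s) ?_).congr ?_
  · intro i j
    by_cases hi : i = β
    · simp only [hi, if_true]; exact SmoothOff.const _
    · simp only [hi, if_false]; exact h.smooth_metric i j
  · intro t _ s _
    congr 1
    ext i j
    by_cases hi : i = β
    · subst hi; simp
    · simp [hi, metricMatrix]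

theorem smooth_invMetric (h : IsLocalFinsler L T) (α β : Fin p) : SmoothOff T (invMetric L α β) :=
  ((h.smooth_det.inv fun _ ht _ hs => (h.det_pos ht hs).ne').mul (h.smooth_adjugate α β)).congr
    fun _ _ _ _ => invMetric_eq L _ _ α β

theorem sum_metric_mul_inv (h : IsLocalFinsler L T) (ht : t ∈ T) (hs : s ≠ 0) (α γ : Fin p) :
    ∑ β, metric L α β t s * invMetric L β γ t s = if α = γ then 1 else 0 := by
  have := Matrix.mul_nonsing_inv (metricMatrix L t s) (h.det_pos ht hs).ne'.isUnit
  simpa [Matrix.mul_apply, Matrix.one_apply, metricMatrix, invMetric]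
    using congrFun (congrFun this α) γ

theorem sum_inv_mul_metric (h : IsLocalFinsler L T) (ht : t ∈ T) (hs : s ≠ 0) (α γ : Fin p) :
    ∑ β, invMetric L α β t s * metric L β γ t s = if α = γ then 1 else 0 := by
  have := Matrix.nonsing_inv_mul (metricMatrix L t s) (h.det_pos ht hs).ne'.isUnit
  simpa [Matrix.mul_apply, Matrix.one_apply, metricMatrix, invMetric]
    using congrFun (congrFun this α) γ

theorem invMetric_symm (h : IsLocalFinsler L T) (ht : t ∈ T) (hs : s ≠ 0) (α β : Fin p) :
    invMetric L α β t s = invMetric L β α t s := by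
  have h1 : (metricMatrix L t s).transpose = metricMatrix L t s := by
    ext α β; exact h.metric_symm ht hs β α
  have h2 := congrFun (congrFun (Matrix.transpose_nonsing_inv (metricMatrix L t s)) β) α
  rw [h1] at h2
  exact h2

theorem euler_sq (h : IsLocalFinsler L T) : EulerDeg T 2 (fun t s => L t s ^ 2) := by
  have := EulerDeg.of_homogeneous (k := 2) (h.smooth.pow 2) h.isOpen (T := T)
    (fun t _ s _ c hc => by rw [h.homogeneous t s c hc]; ring)
  exact_mod_cast this

theorem euler_metric (h : IsLocalFinsler L T) (α β : Fin p) : EulerDeg T 0 (metric L α β) := by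
  have h1 := (h.euler_sq.dS (h.smooth.pow 2) h.isOpen β).dS ((h.smooth.pow 2).dS h.isOpen β)
    h.isOpen α
  have h2 := h1.const_mul (((h.smooth.pow 2).dS h.isOpen β).dS h.isOpen α) h.isOpen (1 / 2)
  have h0 : (2 : ℝ) - 1 - 1 = 0 := by norm_num
  rw [h0] at h2
  exact h2

/-- Euler's relation for ∂F²/∂s^α, which has degree one. -/
theorem sum_metric_mul (h : IsLocalFinsler L T) (ht : t ∈ T) (hs : s ≠ 0) (α : Fin p) :
    ∑ β, metric L α β t s * s β = (1 / 2) * dS α (fun t s => L t s ^ 2) t s := by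
  have h1 := (h.euler_sq.dS (h.smooth.pow 2) h.isOpen α) t ht s hs
  norm_num at h1
  rw [← h1, Finset.mul_sum]
  refine Finset.sum_congr rfl fun β _ => ?_
  rw [h.metric_symm ht hs, metric]; ring

theorem sum_metric_mul_mul (h : IsLocalFinsler L T) (ht : t ∈ T) (hs : s ≠ 0) :
    ∑ α, ∑ β, metric L α β t s * s β * s α = L t s ^ 2 := by
  have h1 := h.euler_sq t ht s hs
  simp_rw [← Finset.sum_mul, h.sum_metric_mul ht hs]
  have : ∑ α, 1 / 2 * dS α (fun t s => L t s ^ 2) t s * s α =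
      1 / 2 * ∑ α, s α * dS α (fun t s => L t s ^ 2) t s := by
    rw [Finset.mul_sum]; exact Finset.sum_congr rfl fun _ _ => by ring
  rw [this, h1]; ring

/-- Only nonnegativity of F is assumed. Strict positivity comes from F² = g_{αβ} s^α s^β and
convexity. -/
theorem pos (h : IsLocalFinsler L T) (ht : t ∈ T) (hs : s ≠ 0) : 0 < L t s := by
  have h1 := h.posDef t ht s hs
  have h2 := h1.dotProduct_mulVec_pos (x := fun i => s i)
    (fun h0 => hs (by ext i; exact congrFun h0 i))
  have h3 := h.sum_metric_mul_mul ht hs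
  have h4 : 0 < L t s ^ 2 := by
    rw [← h3]
    refine lt_of_lt_of_eq h2 ?_
    simp only [dotProduct, Matrix.mulVec, metricMatrix, Finset.mul_sum, Matrix.of_apply,
      Pi.star_apply, star_trivial]
    exact Finset.sum_congr rfl fun α _ => Finset.sum_congr rfl fun β _ => by ring
  exact lt_of_le_of_ne (h.nonneg t s) fun h0 => by rw [← h0] at h4; simp at h4

theorem smooth_cartan (h : IsLocalFinsler L T) (α β γ : Fin p) : SmoothOff T (cartan L α β γ) :=
  ((h.smooth_metric α β).dS h.isOpen γ).const_mul _

theorem cartan_symm (h : IsLocalFinsler L T) (ht : t ∈ T) (hs : s ≠ 0) (α β γ : Fin p) :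
    cartan L α β γ t s = cartan L β α γ t s := by
  rw [cartan, cartan, dS_congr (fun s hs => h.metric_symm ht hs α β) hs]

/-- C is a quarter of the third fibre derivative of F², hence totally symmetric. -/
theorem cartan_symm_right (h : IsLocalFinsler L T) (ht : t ∈ T) (hs : s ≠ 0) (α β γ : Fin p) :
    cartan L α β γ t s = cartan L α γ β t s := by
  have hQ := h.smooth.pow 2
  have key : ∀ α β γ : Fin p, cartan L α β γ t s =
      1 / 4 * dS γ (dS β (dS α fun t s => L t s ^ 2)) t s := by
    intro α β γ
    rw [cartan, dS_congr (fun s hs => h.metric_symm ht hs α β) hs]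
    unfold metric
    rw [dS_const_mul ((hQ.dS h.isOpen α).dS h.isOpen β) h.isOpen ht hs]
    ring
  rw [key, key, dS_dS_comm (hQ.dS h.isOpen α) h.isOpen ht hs]

/-- Euler's relation for g_{αβ}, which has degree zero. The cancellations among the connections all
go back to this. -/
theorem sum_cartan_mul (h : IsLocalFinsler L T) (ht : t ∈ T) (hs : s ≠ 0) (α β : Fin p) :
    ∑ γ, cartan L α β γ t s * s γ = 0 := by
  have h1 := h.euler_metric α β t ht s hs
  rw [zero_mul] at h1
  calc _ = 1 / 2 * ∑ γ, s γ * dS γ (metric L α β) t s := by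
        rw [Finset.mul_sum]; exact Finset.sum_congr rfl fun _ _ => by rw [cartan]; ring
    _ = 0 := by rw [h1, mul_zero]

theorem smooth_cartanUp (h : IsLocalFinsler L T) (γ α β : Fin p) : SmoothOff T (cartanUp L γ α β) :=
  SmoothOff.sum fun l _ => (h.smooth_invMetric γ l).mul (h.smooth_cartan l α β)

theorem cartanUp_symm (h : IsLocalFinsler L T) (ht : t ∈ T) (hs : s ≠ 0) (γ α β : Fin p) :
    cartanUp L γ α β t s = cartanUp L γ β α t s := by
  unfold cartanUp
  exact Finset.sum_congr rfl fun l _ => by rw [h.cartan_symm_right ht hs]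

theorem sum_cartanUp_mul (h : IsLocalFinsler L T) (ht : t ∈ T) (hs : s ≠ 0) (γ α : Fin p) :
    ∑ β, cartanUp L γ α β t s * s β = 0 := by
  unfold cartanUp
  simp_rw [Finset.sum_mul]
  rw [Finset.sum_comm]
  refine Finset.sum_eq_zero fun l _ => ?_
  simp_rw [mul_assoc]
  rw [← Finset.mul_sum, h.sum_cartan_mul ht hs, mul_zero]

end IsLocalFinsler

/-- The coefficients `γ^μ_{αβ} s^α s^β` of the geodesic spray. -/
def spray (L : Coord p → Coord p → ℝ) (μ : Fin p) : Coord p → Coord p → ℝ :=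
  fun t s => ∑ α, ∑ β, formalChristoffel L μ α β t s * s α * s β

theorem nonlinConn_eq (L : Coord p → Coord p → ℝ) (β α : Fin p) (t s : Coord p) :
    nonlinConn L β α t s = ∑ ε, formalChristoffel L β α ε t s * s ε -
      ∑ ε, cartanUp L β α ε t s * spray L ε t s := by
  simp only [nonlinConn, spray, Finset.mul_sum, mul_assoc]

theorem deltaT_metric (L : Coord p → Coord p → ℝ) (α β μ : Fin p) (t s : Coord p) :
    deltaT L μ (metric L α β) t s =
      dT μ (metric L α β) t s - 2 * ∑ ε, nonlinConn L ε μ t s * cartan L α β ε t s := by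
  rw [deltaT, Finset.mul_sum]
  congr 1
  exact Finset.sum_congr rfl fun ε _ => by rw [cartan]; ring

namespace IsLocalFinsler

/-- The Cartan term of N^ε_α dies against s^α, and the remaining term is the spray by definition. -/
theorem sum_nonlinConn_mul (h : IsLocalFinsler L T) (ht : t ∈ T) (hs : s ≠ 0) (ε : Fin p) :
    ∑ α, nonlinConn L ε α t s * s α = spray L ε t s := by
  simp_rw [nonlinConn_eq, sub_mul, Finset.sum_sub_distrib, Finset.sum_mul]
  have : ∑ α, ∑ i, cartanUp L ε α i t s * spray L i t s * s α = 0 := by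
    rw [Finset.sum_comm]
    refine Finset.sum_eq_zero fun i _ => ?_
    calc _ = (∑ α, cartanUp L ε i α t s * s α) * spray L i t s := by
          rw [Finset.sum_mul]
          exact Finset.sum_congr rfl fun α _ => by rw [h.cartanUp_symm ht hs]; ring
      _ = 0 := by rw [h.sum_cartanUp_mul ht hs, zero_mul]
  rw [this, sub_zero, spray]
  exact Finset.sum_congr rfl fun α _ => Finset.sum_congr rfl fun β _ => by ring

theorem rund_symm (h : IsLocalFinsler L T) (ht : t ∈ T) (hs : s ≠ 0) (γ α β : Fin p) :
    rund L γ α β t s = rund L γ β α t s := by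
  unfold rund
  refine Finset.sum_congr rfl fun μ _ => ?_
  simp_rw [deltaT_metric, dT_congr h.isOpen (fun t ht s hs => h.metric_symm ht hs α β) ht hs,
    h.cartan_symm ht hs α β]
  ring

/-- The vertical part of δ/δt^μ produces the Cartan tensor, which the contraction with s kills. -/
theorem sum_mul_deltaT_metric (h : IsLocalFinsler L T) (ht : t ∈ T) (hs : s ≠ 0) (α μ : Fin p) :
    ∑ β, deltaT L μ (metric L α β) t s * s β = ∑ β, dT μ (metric L α β) t s * s β := by
  simp_rw [deltaT_metric, sub_mul, Finset.sum_sub_distrib]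
  have : ∑ β, 2 * (∑ ε, nonlinConn L ε μ t s * cartan L α β ε t s) * s β = 0 := by
    simp_rw [mul_assoc, ← Finset.mul_sum, Finset.sum_mul]
    rw [Finset.sum_comm]
    have : ∀ ε, ∑ β, nonlinConn L ε μ t s * cartan L α β ε t s * s β = 0 := by
      intro ε
      simp_rw [mul_assoc, ← Finset.mul_sum, h.cartan_symm_right ht hs α _ ε,
        h.sum_cartan_mul ht hs, mul_zero]
    simp [this]
  rw [this, sub_zero]

/-- Of the three δ-derivatives in Γ, only the one taken along s keeps its vertical part. As N^ε_α
s^α = G^ε, that part is the Cartan term of N; the partial derivatives give the term with the formal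
Christoffel symbols. -/
theorem sum_rund_mul (h : IsLocalFinsler L T) (ht : t ∈ T) (hs : s ≠ 0) (γ β : Fin p) :
    ∑ α, rund L γ β α t s * s α = nonlinConn L γ β t s := by
  have e1 : ∀ μ, ∑ α, (deltaT L α (metric L μ β) t s + deltaT L β (metric L μ α) t s
      - deltaT L μ (metric L β α) t s) * s α =
      ∑ α, (dT α (metric L μ β) t s + dT β (metric L μ α) t s - dT μ (metric L β α) t s) * s α
        - 2 * ∑ ε, cartan L μ β ε t s * spray L ε t s := by
    intro μ
    have hx : ∑ α, deltaT L α (metric L μ β) t s * s α = ∑ α, dT α (metric L μ β) t s * s α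
        - 2 * ∑ ε, cartan L μ β ε t s * spray L ε t s := by
      simp_rw [deltaT_metric, sub_mul, Finset.sum_sub_distrib, ← h.sum_nonlinConn_mul ht hs,
        Finset.mul_sum, Finset.sum_mul]
      congr 1
      rw [Finset.sum_comm]
      exact Finset.sum_congr rfl fun α _ => Finset.sum_congr rfl fun ε _ => by ring
    simp_rw [sub_mul, add_mul, Finset.sum_sub_distrib, Finset.sum_add_distrib]
    rw [hx, h.sum_mul_deltaT_metric ht hs, h.sum_mul_deltaT_metric ht hs]
    ring
  unfold rund
  simp_rw [Finset.sum_mul]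
  rw [Finset.sum_comm]
  simp_rw [mul_assoc, ← Finset.mul_sum, e1, nonlinConn_eq, mul_sub, Finset.sum_sub_distrib]
  congr 1
  · unfold formalChristoffel
    simp_rw [Finset.sum_mul, Finset.mul_sum]
    rw [Finset.sum_comm]
    exact Finset.sum_congr rfl fun α _ => Finset.sum_congr rfl fun ε _ => by ring
  · unfold cartanUp
    simp_rw [Finset.sum_mul, Finset.mul_sum]
    rw [Finset.sum_comm]
    exact Finset.sum_congr rfl fun α _ => Finset.sum_congr rfl fun ε _ => by ring

/-- Apply δ/δt^μ to C^γ_{αβ} s^β = 0 and use δs^β/δt^μ = -N^β_μ. -/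
theorem sum_deltaT_cartanUp_mul (h : IsLocalFinsler L T) (ht : t ∈ T) (hs : s ≠ 0) (γ α μ : Fin p) :
    ∑ β, deltaT L μ (cartanUp L γ α β) t s * s β =
      ∑ β, cartanUp L γ α β t s * nonlinConn L β μ t s := by
  have hz : ∀ t ∈ T, ∀ s ≠ 0, ∑ β, cartanUp L γ α β t s * s β = (fun _ _ => (0 : ℝ)) t s :=
    fun t ht s hs => h.sum_cartanUp_mul ht hs γ α
  have hsm : ∀ β ∈ Finset.univ, SmoothOff T (fun t s => cartanUp L γ α β t s * s β) :=
    fun β _ => (h.smooth_cartanUp γ α β).mul (SmoothOff.coord β)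
  have h1 := dT_congr (f := fun t s => ∑ β, cartanUp L γ α β t s * s β)
    (g := fun _ _ => (0 : ℝ)) h.isOpen hz ht hs μ
  have h2 : ∀ ε, _ := fun ε => dS_congr (f := fun t s => ∑ β, cartanUp L γ α β t s * s β)
    (g := fun _ _ => (0 : ℝ)) (hz t ht) hs ε
  rw [dT_const, dT_sum hsm h.isOpen ht hs] at h1
  simp_rw [dS_const, dS_sum hsm h.isOpen ht hs,
    fun β ε => dS_mul (h.smooth_cartanUp γ α β) (SmoothOff.coord β) h.isOpen ht hs ε, dS_coord,
    Finset.sum_add_distrib] at h2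
  simp_rw [fun β => dT_mul (h.smooth_cartanUp γ α β) (SmoothOff.coord β) h.isOpen ht hs μ,
    dT_coord, mul_zero, add_zero] at h1
  simp_rw [deltaT, sub_mul, Finset.sum_sub_distrib, h1, Finset.sum_mul]
  rw [Finset.sum_comm, zero_sub, ← Finset.sum_neg_distrib]
  refine Finset.sum_congr rfl fun ε _ => ?_
  have h3 := h2 ε
  simp at h3
  simp_rw [mul_assoc, ← Finset.mul_sum]
  rw [eq_neg_of_add_eq_zero_left h3]; ring

/-- Two connection terms contain C contracted with s. The third contracts Γ with s, giving N, and
cancels the derivative of C. -/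
theorem sum_cartanHor_mul (h : IsLocalFinsler L T) (ht : t ∈ T) (hs : s ≠ 0) (γ α μ : Fin p) :
    ∑ β, cartanHor L γ α β μ t s * s β = 0 := by
  simp_rw [cartanHor, sub_mul, add_mul, Finset.sum_sub_distrib, Finset.sum_add_distrib,
    h.sum_deltaT_cartanUp_mul ht hs, Finset.sum_mul]
  have e1 : ∑ β, ∑ ε, cartanUp L ε α β t s * rund L γ ε μ t s * s β = 0 := by
    rw [Finset.sum_comm]
    refine Finset.sum_eq_zero fun ε _ => ?_
    calc _ = (∑ β, cartanUp L ε α β t s * s β) * rund L γ ε μ t s := by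
          rw [Finset.sum_mul]; exact Finset.sum_congr rfl fun _ _ => by ring
      _ = 0 := by rw [h.sum_cartanUp_mul ht hs, zero_mul]
  have e2 : ∑ β, ∑ ε, cartanUp L γ ε β t s * rund L ε α μ t s * s β = 0 := by
    rw [Finset.sum_comm]
    refine Finset.sum_eq_zero fun ε _ => ?_
    calc _ = (∑ β, cartanUp L γ ε β t s * s β) * rund L ε α μ t s := by
          rw [Finset.sum_mul]; exact Finset.sum_congr rfl fun _ _ => by ring
      _ = 0 := by rw [h.sum_cartanUp_mul ht hs, zero_mul]
  have e3 : ∑ β, ∑ ε, cartanUp L γ α ε t s * rund L ε β μ t s * s β =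
      ∑ β, cartanUp L γ α β t s * nonlinConn L β μ t s := by
    rw [Finset.sum_comm]
    refine Finset.sum_congr rfl fun ε _ => ?_
    simp_rw [mul_assoc, ← Finset.mul_sum, h.rund_symm ht hs ε _ μ, h.sum_rund_mul ht hs]
  rw [e1, e2, e3]; ring

/-- The Berwald and the Rund connections have the same contraction with `s`. -/
theorem sum_berwald_mul (h : IsLocalFinsler L T) (ht : t ∈ T) (hs : s ≠ 0) (γ α : Fin p) :
    ∑ β, berwald L γ α β t s * s β = nonlinConn L γ α t s := by
  simp_rw [berwald, add_mul, Finset.sum_add_distrib, h.sum_rund_mul ht hs, Finset.sum_mul]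
  rw [Finset.sum_comm]
  have : ∀ μ, ∑ β, cartanHor L γ α β μ t s * s μ * s β = 0 := by
    intro μ
    calc _ = (∑ β, cartanHor L γ α β μ t s * s β) * s μ := by
          rw [Finset.sum_mul]; exact Finset.sum_congr rfl fun _ _ => by ring
      _ = 0 := by rw [h.sum_cartanHor_mul ht hs, zero_mul]
  simp [this]

end IsLocalFinsler

end LocalFinsler

/-! ### The affine equation contracted with s, and the tension field -/

section Tension

variable {p n : ℕ} {T : Set (Coord p)} {L : Coord p → Coord p → ℝ}
  {T' : Set (Coord n)} {L' : Coord n → Coord n → ℝ} {φ : Coord p → Coord n} {t s : Coord p}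

theorem push_apply (φ : Coord p → Coord n) (t s : Coord p) (i : Fin n) :
    push φ t s i = ∑ α, d1 φ i α t * s α := rfl

/-- Contraction of `∑_{jk} A_{jk} φ^j_α φ^k_β` with `s`. -/
theorem sum_conn_push (A : Fin n → Fin n → ℝ) (α : Fin p) :
    ∑ β, (∑ j, ∑ k, A j k * d1 φ j α t * d1 φ k β t) * s β =
      ∑ j, (∑ k, A j k * push φ t s k) * d1 φ j α t := by
  simp_rw [push_apply, Finset.mul_sum, Finset.sum_mul]
  rw [Finset.sum_comm]
  refine Finset.sum_congr rfl fun j _ => ?_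
  rw [Finset.sum_comm]
  exact Finset.sum_congr rfl fun k _ => Finset.sum_congr rfl fun β _ => by ring

theorem sum_conn_mul (A : Fin p → Fin p → ℝ) (i : Fin n) :
    ∑ β, (∑ γ, A γ β * d1 φ i γ t) * s β = ∑ γ, (∑ β, A γ β * s β) * d1 φ i γ t := by
  simp_rw [Finset.sum_mul]
  rw [Finset.sum_comm]
  exact Finset.sum_congr rfl fun k _ => Finset.sum_congr rfl fun β _ => by ring

/-- Contracting φ^k_β with s^β gives the image vector y^k, so on the target as on the source the
Berwald coefficients reduce to the nonlinear connection. -/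
theorem sum_affineExpr_mul (h : IsLocalFinsler L T) (h' : IsLocalFinsler L' T')
    (ht : t ∈ T) (hs : s ≠ 0) (ht' : φ t ∈ T') (hs' : push φ t s ≠ 0)
    (i : Fin n) (α : Fin p) : ∑ β, affineExpr L L' φ i α β t s * s β =
      ∑ β, d2 φ i α β t * s β - ∑ γ, nonlinConn L γ α t s * d1 φ i γ t
        + ∑ j, nonlinConn L' i j (φ t) (push φ t s) * d1 φ j α t := by
  simp_rw [affineExpr, add_mul, sub_mul, Finset.sum_add_distrib, Finset.sum_sub_distrib]
  rw [sum_conn_push, sum_conn_mul]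
  simp_rw [h.sum_berwald_mul ht hs, h'.sum_berwald_mul ht' hs']

/-- Both brackets see their connections only through the contraction with s, where Rund and Berwald
coincide. -/
theorem sum_rundExpr_mul (h : IsLocalFinsler L T) (h' : IsLocalFinsler L' T')
    (ht : t ∈ T) (hs : s ≠ 0) (ht' : φ t ∈ T') (hs' : push φ t s ≠ 0)
    (i : Fin n) (α : Fin p) : ∑ β, rundExpr L L' φ i α β t s * s β =
      ∑ β, affineExpr L L' φ i α β t s * s β := by
  rw [sum_affineExpr_mul h h' ht hs ht' hs']
  simp_rw [rundExpr, add_mul, sub_mul, Finset.sum_add_distrib, Finset.sum_sub_distrib]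
  rw [sum_conn_push, sum_conn_mul]
  simp_rw [h.sum_rund_mul ht hs, h'.sum_rund_mul ht' hs']

/-- The tension field of an affine map vanishes. -/
theorem tension_eq_zero (h : IsLocalFinsler L T) (h' : IsLocalFinsler L' T')
    (ht : t ∈ T) (hs : s ≠ 0) (ht' : φ t ∈ T') (hs' : push φ t s ≠ 0)
    (ha : ∀ i α β, affineExpr L L' φ i α β t s = 0) (i : Fin n) :
    tension L L' φ i t s = 0 := by
  -- The Rund brackets occur in the tension only through this contraction; in the last term one of
  -- the two factors s already suffices.
  have hr : ∀ j α, ∑ β, rundExpr L L' φ j α β t s * s β = 0 := fun j α => by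
    rw [sum_rundExpr_mul h h' ht hs ht' hs']; simp [ha]
  unfold tension
  have e2 : ∑ α, ∑ β, ∑ γ, ∑ j, ∑ k, invMetric L α β t s
      * cartanUp L' i j k (φ t) (push φ t s) * d1 φ k α t
      * rundExpr L L' φ j β γ t s * s γ = 0 := by
    refine Finset.sum_eq_zero fun α _ => Finset.sum_eq_zero fun β _ => ?_
    rw [Finset.sum_comm]
    refine Finset.sum_eq_zero fun j _ => ?_
    rw [Finset.sum_comm]
    refine Finset.sum_eq_zero fun k _ => ?_
    simp_rw [mul_assoc, ← Finset.mul_sum, hr, mul_zero]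
  have e3 : ∑ α, ∑ β, ∑ γ, ∑ ε, ∑ j, ∑ k, ∑ l, invMetric L α β t s
      * cartanDeriv L' i j k l (φ t) (push φ t s) * d1 φ k α t * d1 φ l β t
      * rundExpr L L' φ j γ ε t s * s γ * s ε = 0 := by
    refine Finset.sum_eq_zero fun α _ => Finset.sum_eq_zero fun β _ =>
      Finset.sum_eq_zero fun γ _ => ?_
    rw [Finset.sum_comm]
    refine Finset.sum_eq_zero fun j _ => ?_
    rw [Finset.sum_comm]
    refine Finset.sum_eq_zero fun k _ => ?_
    rw [Finset.sum_comm]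
    refine Finset.sum_eq_zero fun l _ => ?_
    simp_rw [mul_right_comm _ (s γ), mul_assoc, ← mul_assoc (rundExpr _ _ _ _ _ _ _ _),
      ← Finset.mul_sum, ← Finset.sum_mul, hr]
    simp
  rw [e2, e3]
  simp [ha]

/-- An affine map carries the geodesic spray to the geodesic spray. -/
theorem spray_push (h : IsLocalFinsler L T) (h' : IsLocalFinsler L' T')
    (ht : t ∈ T) (hs : s ≠ 0) (ht' : φ t ∈ T') (hs' : push φ t s ≠ 0)
    (ha : ∀ i α β, affineExpr L L' φ i α β t s = 0) (i : Fin n) :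
    ∑ α, ∑ β, d2 φ i α β t * s β * s α =
      ∑ γ, spray L γ t s * d1 φ i γ t - spray L' i (φ t) (push φ t s) := by
  -- A second contraction with s turns both nonlinear connections into sprays.
  have h2 : ∑ α, (∑ β, affineExpr L L' φ i α β t s * s β) * s α = 0 := by simp [ha]
  simp_rw [sum_affineExpr_mul h h' ht hs ht' hs', add_mul, sub_mul, Finset.sum_add_distrib, Finset.sum_sub_distrib] at h2
  have e1 : ∑ α, (∑ γ, nonlinConn L γ α t s * d1 φ i γ t) * s α =
      ∑ γ, spray L γ t s * d1 φ i γ t := by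
    rw [sum_conn_mul]
    simp_rw [h.sum_nonlinConn_mul ht hs]
  have e2 : ∑ α, (∑ j, nonlinConn L' i j (φ t) (push φ t s) * d1 φ j α t) * s α =
      spray L' i (φ t) (push φ t s) := by
    rw [← h'.sum_nonlinConn_mul ht' hs']
    simp_rw [push_apply, Finset.mul_sum, Finset.sum_mul]
    rw [Finset.sum_comm]
    exact Finset.sum_congr rfl fun _ _ => Finset.sum_congr rfl fun _ _ => by ring
  rw [e1, e2] at h2
  simp_rw [Finset.sum_mul] at h2
  linarith

end Tension

end FinslerMaps

end

noncomputable section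

namespace FinslerMaps

/-! ### Jacobi's formula and the geodesic spray -/

/-- Jacobi's formula for the derivative of a determinant. -/
theorem fderiv_det {V ι : Type*} [NormedAddCommGroup V] [NormedSpace ℝ V] [Fintype ι]
    [DecidableEq ι] {m : V → Matrix ι ι ℝ} {z : V}
    (hm : ∀ i j, DifferentiableAt ℝ (fun z => m z i j) z) (v : V) :
    fderiv ℝ (fun z => (m z).det) z v =
      ∑ i, ∑ j, (m z).adjugate j i * fderiv ℝ (fun z => m z i j) z v := by
  simp_rw [Matrix.det_apply']
  have hprod : ∀ σ : Equiv.Perm ι, HasFDerivAt (fun z => ∏ i, m z (σ i) i)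
      (∑ i, (∏ j ∈ Finset.univ.erase i, m z (σ j) j) • fderiv ℝ (fun z => m z (σ i) i) z) z :=
    fun σ => HasFDerivAt.finsetProd (u := Finset.univ) (g := fun i z => m z (σ i) i)
      fun i _ => (hm (σ i) i).hasFDerivAt
  rw [fderiv_fun_sum fun σ _ => ((hprod σ).const_mul _).differentiableAt]
  simp_rw [fun σ => ((hprod σ).const_mul ((Equiv.Perm.sign σ : ℤ) : ℝ)).fderiv]
  simp only [FunLike.coe_sum, FunLike.coe_smul, Finset.sum_apply, Pi.smul_apply, smul_eq_mul,
    Finset.mul_sum]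
  rw [Finset.sum_comm]
  -- Cramer's rule: a row of the adjugate paired with a vector is the determinant with the
  -- corresponding column replaced by that vector.
  have hcol : ∀ j, ∑ i, (m z).adjugate j i * fderiv ℝ (fun z => m z i j) z v =
      ((m z).updateCol j fun i => fderiv ℝ (fun z => m z i j) z v).det := by
    intro j
    rw [← Matrix.cramer_apply, Matrix.cramer_eq_adjugate_mulVec]
    rfl
  refine Eq.trans (Finset.sum_congr rfl fun j _ => ?_) Finset.sum_comm
  rw [hcol, Matrix.det_apply']
  refine Finset.sum_congr rfl fun σ _ => ?_
  rw [← Finset.mul_prod_erase Finset.univ _ (Finset.mem_univ j)]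
  simp only [Matrix.updateCol_self]
  rw [Finset.prod_congr rfl fun k hk => Matrix.updateCol_ne (Finset.ne_of_mem_erase hk)]
  ring

theorem dS_add {p : ℕ} {T : Set (Coord p)} {f g : Coord p → Coord p → ℝ} {t s : Coord p}
    (hf : SmoothOff T f) (hg : SmoothOff T g) (hT : IsOpen T) (ht : t ∈ T) (hs : s ≠ 0)
    (α : Fin p) : dS α (fun t s => f t s + g t s) t s = dS α f t s + dS α g t s := by
  unfold dS
  rw [fderiv_fun_add (hf.slot_snd hT ht hs) (hg.slot_snd hT ht hs)]
  rfl

/-! ### Homogeneity degrees of products and inverses -/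

section EulerAlgebra

variable {p : ℕ} {T : Set (Coord p)} {f g : Coord p → Coord p → ℝ} {k l : ℝ}

theorem EulerDeg.mul (hf : EulerDeg T k f) (hg : EulerDeg T l g) (sf : SmoothOff T f)
    (sg : SmoothOff T g) (hT : IsOpen T) : EulerDeg T (k + l) (fun t s => f t s * g t s) := by
  intro t ht s hs
  simp_rw [dS_mul sf sg hT ht hs]
  have h1 := hf t ht s hs
  have h2 := hg t ht s hs
  calc _ = (∑ α, s α * FinslerMaps.dS α f t s) * g t s
        + f t s * ∑ α, s α * FinslerMaps.dS α g t s := by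
        rw [Finset.sum_mul, Finset.mul_sum, ← Finset.sum_add_distrib]
        exact Finset.sum_congr rfl fun _ _ => by ring
    _ = _ := by rw [h1, h2]; ring

theorem EulerDeg.congr (hf : EulerDeg T k f) (h : ∀ t ∈ T, ∀ s ≠ 0, g t s = f t s) :
    EulerDeg T k g := by
  intro t ht s hs
  simp_rw [dS_congr (h t ht) hs, h t ht s hs]
  exact hf t ht s hs

/-- Solve the Leibniz rule for g. Applied to f · f⁻¹ = 1, it yields the degree of an inverse. -/
theorem EulerDeg.of_mul (hfg : EulerDeg T (k + l) (fun t s => f t s * g t s))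
    (hf : EulerDeg T k f) (sf : SmoothOff T f)
    (sg : SmoothOff T g) (hT : IsOpen T) (h0 : ∀ t ∈ T, ∀ s ≠ 0, f t s ≠ 0) : EulerDeg T l g := by
  intro t ht s hs
  have h1 := hfg t ht s hs
  simp_rw [dS_mul sf sg hT ht hs] at h1
  have h2 := hf t ht s hs
  have h3 : (∑ α, s α * FinslerMaps.dS α f t s) * g t s
        + f t s * ∑ α, s α * FinslerMaps.dS α g t s = (k + l) * (f t s * g t s) := by
    rw [← h1, Finset.sum_mul, Finset.mul_sum, ← Finset.sum_add_distrib]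
    exact Finset.sum_congr rfl fun _ _ => by ring
  rw [h2] at h3
  apply mul_left_cancel₀ (h0 t ht s hs)
  linarith

theorem EulerDeg.const (c : ℝ) : EulerDeg T 0 (fun _ _ => c) := by
  intro t _ s _
  simp [dS_const]

theorem EulerDeg.inv (hf : EulerDeg T k f) (sf : SmoothOff T f) (hT : IsOpen T)
    (h0 : ∀ t ∈ T, ∀ s ≠ 0, f t s ≠ 0) : EulerDeg T (-k) (fun t s => (f t s)⁻¹) := by
  refine EulerDeg.of_mul (k := k) (f := f) ?_ hf sf (sf.inv h0) hT h0
  rw [add_neg_cancel]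
  exact (EulerDeg.const (T := T) 1).congr fun t ht s hs => mul_inv_cancel₀ (h0 t ht s hs)

end EulerAlgebra

/-! ### The spray as a derivation: Euler–Lagrange equation, conservation of F, Liouville's theorem
-/

section Spray

variable {p : ℕ} {T : Set (Coord p)} {L f g : Coord p → Coord p → ℝ} {t s : Coord p}

/-- The derivative along the geodesic spray. -/
def geo (L f : Coord p → Coord p → ℝ) : Coord p → Coord p → ℝ :=
  fun t s => ∑ α, s α * dT α f t s - ∑ α, spray L α t s * dS α f t s

theorem geo_mul (hf : SmoothOff T f) (hg : SmoothOff T g) (hT : IsOpen T) (ht : t ∈ T)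
    (hs : s ≠ 0) : geo L (fun t s => f t s * g t s) t s =
      geo L f t s * g t s + f t s * geo L g t s := by
  simp_rw [geo, dT_mul hf hg hT ht hs, dS_mul hf hg hT ht hs, sub_mul, mul_sub, Finset.sum_mul,
    Finset.mul_sum, mul_add, Finset.sum_add_distrib]
  have e : ∀ a b c d a' b' c' d' : ℝ, a = a' → b = b' → c = c' → d = d' →
    a + b - (c + d) = a' - c' + (b' - d') := by intros; subst_vars; ring
  apply e <;> exact Finset.sum_congr rfl fun _ _ => by ring

theorem geo_congr (hT : IsOpen T) (h : ∀ t ∈ T, ∀ s ≠ 0, f t s = g t s) (ht : t ∈ T)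
    (hs : s ≠ 0) : geo L f t s = geo L g t s := by
  simp_rw [geo, dT_congr hT h ht hs, dS_congr (h t ht) hs]

theorem geo_sum {ι : Type*} {A : Finset ι} {f : ι → Coord p → Coord p → ℝ}
    (h : ∀ i ∈ A, SmoothOff T (f i)) (hT : IsOpen T) (ht : t ∈ T) (hs : s ≠ 0) :
    geo L (fun t s => ∑ i ∈ A, f i t s) t s = ∑ i ∈ A, geo L (f i) t s := by
  simp_rw [geo, dT_sum h hT ht hs, dS_sum h hT ht hs, Finset.mul_sum, Finset.sum_sub_distrib]
  rw [Finset.sum_comm]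
  congr 1
  rw [Finset.sum_comm]

theorem geo_const (c : ℝ) : geo L (fun _ _ => c) t s = 0 := by
  simp [geo, dT_const, dS_const]

theorem geo_coord (β : Fin p) : geo L (fun _ s => s β) t s = - spray L β t s := by
  simp [geo, dT_coord, dS_coord]

namespace IsLocalFinsler

theorem dS_det (h : IsLocalFinsler L T) (ht : t ∈ T) (hs : s ≠ 0) (ε : Fin p) :
    dS ε (fun t s => (metricMatrix L t s).det) t s =
      (metricMatrix L t s).det * ∑ α, ∑ β, invMetric L β α t s * dS ε (metric L α β) t s := by
  unfold dS
  rw [fderiv_det (m := fun s' => metricMatrix L t s')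
    fun i j => (h.smooth_metric i j).slot_snd h.isOpen ht hs, Finset.mul_sum]
  refine Finset.sum_congr rfl fun α _ => ?_
  rw [Finset.mul_sum]
  refine Finset.sum_congr rfl fun β _ => ?_
  rw [invMetric_eq, ← mul_assoc, ← mul_assoc, mul_inv_cancel₀ (h.det_pos ht hs).ne', one_mul]
  rfl

theorem dT_det (h : IsLocalFinsler L T) (ht : t ∈ T) (hs : s ≠ 0) (ε : Fin p) :
    dT ε (fun t s => (metricMatrix L t s).det) t s =
      (metricMatrix L t s).det * ∑ α, ∑ β, invMetric L β α t s * dT ε (metric L α β) t s := by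
  unfold dT
  rw [fderiv_det (m := fun t' => metricMatrix L t' s)
    fun i j => (h.smooth_metric i j).slot_fst h.isOpen ht hs, Finset.mul_sum]
  refine Finset.sum_congr rfl fun α _ => ?_
  rw [Finset.mul_sum]
  refine Finset.sum_congr rfl fun β _ => ?_
  rw [invMetric_eq, ← mul_assoc, ← mul_assoc, mul_inv_cancel₀ (h.det_pos ht hs).ne', one_mul]
  rfl

/-- The spray derivative is a combination of partial derivatives, so Jacobi's formula passes to it.
-/
theorem geo_det (h : IsLocalFinsler L T) (ht : t ∈ T) (hs : s ≠ 0) :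
    geo L (fun t s => (metricMatrix L t s).det) t s =
      (metricMatrix L t s).det * ∑ α, ∑ β, invMetric L β α t s * geo L (metric L α β) t s := by
  have e : ∀ (c : Fin p → ℝ) (X : Fin p → Fin p → Fin p → ℝ),
      ∑ ε, c ε * ((metricMatrix L t s).det * ∑ α, ∑ β, invMetric L β α t s * X ε α β) =
      (metricMatrix L t s).det * ∑ α, ∑ β, invMetric L β α t s * ∑ ε, c ε * X ε α β := by
    intro c X
    simp_rw [Finset.mul_sum]
    rw [Finset.sum_comm]
    refine Finset.sum_congr rfl fun α _ => ?_
    rw [Finset.sum_comm]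
    exact Finset.sum_congr rfl fun _ _ => Finset.sum_congr rfl fun _ _ => by ring
  simp_rw [geo, h.dS_det ht hs, h.dT_det ht hs, mul_sub, Finset.sum_sub_distrib, mul_sub]
  rw [e _ fun ε α β => dT ε (metric L α β) t s, e _ fun ε α β => dS ε (metric L α β) t s]

theorem euler_det (h : IsLocalFinsler L T)
    : EulerDeg T 0 (fun t s => (metricMatrix L t s).det) := by
  intro t ht s hs
  simp_rw [h.dS_det ht hs, Finset.mul_sum]
  rw [Finset.sum_comm, zero_mul]
  refine Finset.sum_eq_zero fun α _ => ?_
  rw [Finset.sum_comm]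
  refine Finset.sum_eq_zero fun β _ => ?_
  have h1 := h.euler_metric α β t ht s hs
  rw [zero_mul] at h1
  calc _ = (metricMatrix L t s).det * invMetric L β α t s * ∑ ε, s ε * dS ε (metric L α β) t s := by
        rw [Finset.mul_sum]; exact Finset.sum_congr rfl fun _ _ => by ring
    _ = 0 := by rw [h1, mul_zero]

/-- Differentiate g g⁻¹ = 1 and multiply by g⁻¹ from the left. -/
theorem dS_invMetric (h : IsLocalFinsler L T) (ht : t ∈ T) (hs : s ≠ 0) (ε α γ : Fin p) :
    dS ε (invMetric L α γ) t s =
      - ∑ μ, ∑ ν, invMetric L α μ t s * dS ε (metric L μ ν) t s * invMetric L ν γ t s := by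
  have h1 : ∀ μ, ∑ ν, (dS ε (metric L μ ν) t s * invMetric L ν γ t s +
      metric L μ ν t s * dS ε (invMetric L ν γ) t s) = 0 := by
    intro μ
    have h2 := dS_congr (f := fun t s => ∑ β, metric L μ β t s * invMetric L β γ t s)
      (g := fun _ _ => if μ = γ then 1 else 0) (fun s hs => h.sum_metric_mul_inv ht hs μ γ) hs ε
    rw [dS_const, dS_sum (fun β _ => (h.smooth_metric μ β).mul (h.smooth_invMetric β γ))
      h.isOpen ht hs] at h2
    rw [← h2]
    exact Finset.sum_congr rfl fun β _ =>
      (dS_mul (h.smooth_metric μ β) (h.smooth_invMetric β γ) h.isOpen ht hs ε).symm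
  have h3 : ∑ μ, invMetric L α μ t s * ∑ ν, (dS ε (metric L μ ν) t s * invMetric L ν γ t s +
      metric L μ ν t s * dS ε (invMetric L ν γ) t s) = 0 := by simp [h1]
  simp_rw [Finset.sum_add_distrib, mul_add, Finset.sum_add_distrib, Finset.mul_sum] at h3
  have h4 : ∑ μ, ∑ ν, invMetric L α μ t s * (metric L μ ν t s * dS ε (invMetric L ν γ) t s) =
      dS ε (invMetric L α γ) t s := by
    rw [Finset.sum_comm]
    simp_rw [← mul_assoc, ← Finset.sum_mul, h.sum_inv_mul_metric ht hs]
    simp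
  rw [h4] at h3
  simp_rw [mul_assoc]
  linarith

/-- The cofactors of the Hessian matrix `g` are divergence free. -/
theorem sum_dS_det_mul_invMetric (h : IsLocalFinsler L T) (ht : t ∈ T) (hs : s ≠ 0) (α : Fin p) :
    ∑ β, dS β (fun t s => (metricMatrix L t s).det * invMetric L β α t s) t s = 0 := by
  -- This is where it matters that g is a Hessian: ∂g_{μν}/∂s^ε is symmetric in all indices.
  have hsym : ∀ μ ν ε, dS ε (metric L μ ν) t s = dS ν (metric L μ ε) t s := by
    intro μ ν ε
    have := h.cartan_symm_right ht hs μ ν ε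
    simp only [cartan] at this
    linarith
  simp_rw [fun β => dS_mul h.smooth_det (h.smooth_invMetric β α) h.isOpen ht hs β,
    h.dS_det ht hs, h.dS_invMetric ht hs, mul_neg, ← sub_eq_add_neg, Finset.sum_sub_distrib,
    Finset.mul_sum, Finset.sum_mul]
  rw [sub_eq_zero]
  -- One triple sum comes from differentiating the determinant, the other from differentiating the
  -- inverse. They agree after exchanging the first and last summation indices.
  have e : ∀ f g : Fin p → Fin p → Fin p → ℝ, (∀ a b c, f a b c = g c b a) →
      ∑ a, ∑ b, ∑ c, f a b c = ∑ a, ∑ b, ∑ c, g a b c := by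
    intro f g hfg
    simp_rw [hfg]
    calc _ = ∑ a, ∑ c, ∑ b, g c b a := Finset.sum_congr rfl fun a _ => Finset.sum_comm
      _ = ∑ c, ∑ a, ∑ b, g c b a := Finset.sum_comm
      _ = _ := Finset.sum_congr rfl fun a _ => Finset.sum_comm
  apply e
  intro β μ ν
  rw [hsym μ ν β]
  ring

theorem smooth_spray (h : IsLocalFinsler L T) (μ : Fin p) : SmoothOff T (spray L μ) :=
  SmoothOff.sum fun α _ => SmoothOff.sum fun β _ => ((SmoothOff.sum fun ε _ =>
    ((((h.smooth_invMetric μ ε).mul (SmoothOff.const (1 / 2))).congr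
      fun t _ s _ => by ring).mul ((((h.smooth_metric ε α).dT h.isOpen β).add
        ((h.smooth_metric ε β).dT h.isOpen α)).sub ((h.smooth_metric α β).dT h.isOpen ε)))).mul
      (SmoothOff.coord α)).mul (SmoothOff.coord β)

theorem smooth_geo (h : IsLocalFinsler L T) (hf : SmoothOff T f) : SmoothOff T (geo L f) :=
  (SmoothOff.sum fun α _ => (SmoothOff.coord α).mul (hf.dT h.isOpen α)).sub
    (SmoothOff.sum fun α _ => (h.smooth_spray α).mul (hf.dS h.isOpen α))

theorem sum_dT_metric_mul (h : IsLocalFinsler L T) (ht : t ∈ T) (hs : s ≠ 0) (α ε : Fin p) :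
    ∑ β, dT ε (metric L α β) t s * s β = (1 / 2) * dT ε (dS α (fun t s => L t s ^ 2)) t s := by
  have h1 := dT_congr (f := fun t s => ∑ β, metric L α β t s * s β)
    (g := fun t s => (1 / 2) * dS α (fun t s => L t s ^ 2) t s) h.isOpen
    (fun t ht s hs => h.sum_metric_mul ht hs α) ht hs ε
  rw [dT_const_mul ((h.smooth.pow 2).dS h.isOpen α) h.isOpen ht hs,
    dT_sum (fun β _ => (h.smooth_metric α β).mul (SmoothOff.coord β)) h.isOpen ht hs] at h1
  rw [← h1]
  refine Finset.sum_congr rfl fun β _ => ?_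
  rw [dT_mul (h.smooth_metric α β) (SmoothOff.coord β) h.isOpen ht hs, dT_coord, mul_zero, add_zero]

/-- The Euler–Lagrange equation of the energy `L² / 2`, in terms of the spray. -/
theorem sum_metric_mul_spray (h : IsLocalFinsler L T) (ht : t ∈ T) (hs : s ≠ 0) (β : Fin p) :
    ∑ μ, spray L μ t s * metric L μ β t s =
      (1 / 2) * ∑ γ, s γ * dT γ (dS β (fun t s => L t s ^ 2)) t s
        - (1 / 2) * dT β (fun t s => L t s ^ 2) t s := by
  have hQ := h.smooth.pow 2
  -- Lowering the index removes the inverse metric from the Christoffel symbols. The three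
  -- derivatives of g are then contracted with s separately.
  have e1 : ∑ μ, spray L μ t s * metric L μ β t s =
      ∑ α, ∑ γ, (1 / 2) * (dT γ (metric L β α) t s + dT α (metric L β γ) t s
        - dT β (metric L α γ) t s) * s α * s γ := by
    have e0 : ∀ α γ, ∑ μ, formalChristoffel L μ α γ t s * metric L μ β t s =
        (1 / 2) * (dT γ (metric L β α) t s + dT α (metric L β γ) t s
        - dT β (metric L α γ) t s) := by
      intro α γ
      simp_rw [formalChristoffel, Finset.sum_mul]
      rw [Finset.sum_comm]
      have : ∀ ε, ∑ μ, invMetric L μ ε t s / 2 * (dT γ (metric L ε α) t s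
          + dT α (metric L ε γ) t s - dT ε (metric L α γ) t s) * metric L μ β t s =
          (if ε = β then 1 else 0) * ((1 / 2) * (dT γ (metric L ε α) t s
          + dT α (metric L ε γ) t s - dT ε (metric L α γ) t s)) := by
        intro ε
        rw [← h.sum_inv_mul_metric ht hs, Finset.sum_mul]
        exact Finset.sum_congr rfl fun μ _ => by rw [h.invMetric_symm ht hs μ ε]; ring
      simp_rw [this]
      simp
    simp_rw [← e0, spray, Finset.sum_mul]
    rw [Finset.sum_comm]
    refine Finset.sum_congr rfl fun α _ => ?_
    rw [Finset.sum_comm]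
    exact Finset.sum_congr rfl fun _ _ => Finset.sum_congr rfl fun _ _ => by ring
  have e2 : ∑ α, ∑ γ, dT γ (metric L β α) t s * s α * s γ =
      ∑ γ, s γ * ((1 / 2) * dT γ (dS β (fun t s => L t s ^ 2)) t s) := by
    rw [Finset.sum_comm]
    refine Finset.sum_congr rfl fun γ _ => ?_
    rw [← h.sum_dT_metric_mul ht hs, Finset.mul_sum]
    exact Finset.sum_congr rfl fun _ _ => by ring
  have e3 : ∑ α, ∑ γ, dT α (metric L β γ) t s * s α * s γ =
      ∑ γ, s γ * ((1 / 2) * dT γ (dS β (fun t s => L t s ^ 2)) t s) := by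
    refine Finset.sum_congr rfl fun γ _ => ?_
    rw [← h.sum_dT_metric_mul ht hs, Finset.mul_sum]
    exact Finset.sum_congr rfl fun _ _ => by ring
  -- Here both free indices are contracted with s. Euler's relation of degree two for ∂F²/∂t^β
  -- recovers that derivative without a factor ½.
  have e4 : ∑ α, ∑ γ, dT β (metric L α γ) t s * s α * s γ =
      dT β (fun t s => L t s ^ 2) t s := by
    have h1 := (h.euler_sq.dT hQ h.isOpen β) t ht s hs
    have h2 : ∑ α, ∑ γ, dT β (metric L α γ) t s * s α * s γ =
        ∑ α, s α * (1 / 2 * dS α (dT β (fun t s => L t s ^ 2)) t s) := by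
      refine Finset.sum_congr rfl fun α _ => ?_
      rw [← dT_dS_comm hQ h.isOpen ht hs, ← h.sum_dT_metric_mul ht hs, Finset.mul_sum]
      exact Finset.sum_congr rfl fun _ _ => by ring
    rw [h2]
    calc _ = 1 / 2 * ∑ α, s α * dS α (dT β (fun t s => L t s ^ 2)) t s := by
          rw [Finset.mul_sum]; exact Finset.sum_congr rfl fun _ _ => by ring
      _ = _ := by rw [h1]; ring
  have e5 : ∑ γ, s γ * (1 / 2 * dT γ (dS β fun t s => L t s ^ 2) t s) =
      1 / 2 * ∑ γ, s γ * dT γ (dS β fun t s => L t s ^ 2) t s := by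
    rw [Finset.mul_sum]; exact Finset.sum_congr rfl fun _ _ => by ring
  have e6 : ∑ α, ∑ γ, (1 / 2) * (dT γ (metric L β α) t s + dT α (metric L β γ) t s
        - dT β (metric L α γ) t s) * s α * s γ =
      1 / 2 * (∑ α, ∑ γ, dT γ (metric L β α) t s * s α * s γ
        + ∑ α, ∑ γ, dT α (metric L β γ) t s * s α * s γ
        - ∑ α, ∑ γ, dT β (metric L α γ) t s * s α * s γ) := by
    simp_rw [← Finset.sum_add_distrib, ← Finset.sum_sub_distrib, Finset.mul_sum]
    exact Finset.sum_congr rfl fun _ _ => Finset.sum_congr rfl fun _ _ => by ring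
  rw [e1, e6, e2, e3, e4, e5]; ring

/-- The Euler–Lagrange equation with g read as half the Hessian of F²: along the spray the momentum
∂F²/∂s^β changes by ∂F²/∂t^β. On the source it yields conservation of F and Liouville's theorem, on
the target the first variation. -/
theorem geo_dS_sq (h : IsLocalFinsler L T) (ht : t ∈ T) (hs : s ≠ 0) (β : Fin p) :
    geo L (dS β (fun t s => L t s ^ 2)) t s = dT β (fun t s => L t s ^ 2) t s := by
  have h1 := h.sum_metric_mul_spray ht hs β
  have h2 : ∑ μ, spray L μ t s * metric L μ β t s =
      1 / 2 * ∑ α, spray L α t s * dS α (dS β fun t s => L t s ^ 2) t s := by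
    rw [Finset.mul_sum]; exact Finset.sum_congr rfl fun _ _ => by rw [metric]; ring
  rw [geo]
  linarith

/-- The Finsler function is constant along the spray. -/
theorem geo_sq (h : IsLocalFinsler L T)
    (ht : t ∈ T) (hs : s ≠ 0) : geo L (fun t s => L t s ^ 2) t s = 0 := by
  have hQ := h.smooth.pow 2
  -- Apply X to Euler's relation s^α ∂F²/∂s^α = 2F². By the Euler–Lagrange equation the left side
  -- becomes X(F²), while the right side is 2X(F²).
  have h1 := geo_congr (L := L) (f := fun t s => ∑ α, s α * dS α (fun t s => L t s ^ 2) t s)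
    (g := fun t s => 2 * L t s ^ 2) h.isOpen h.euler_sq ht hs
  rw [geo_mul (SmoothOff.const 2) hQ h.isOpen ht hs, geo_const,
    geo_sum (fun α _ => (SmoothOff.coord α).mul (hQ.dS h.isOpen α)) h.isOpen ht hs] at h1
  simp_rw [fun α => geo_mul (L := L) (SmoothOff.coord α) (hQ.dS h.isOpen α) h.isOpen ht hs,
    geo_coord, h.geo_dS_sq ht hs, Finset.sum_add_distrib] at h1
  have h2 : geo L (fun t s => L t s ^ 2) t s =
      ∑ α, s α * dT α (fun t s => L t s ^ 2) t s
        - ∑ α, spray L α t s * dS α (fun t s => L t s ^ 2) t s := rfl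
  simp_rw [neg_mul, Finset.sum_neg_distrib] at h1
  linarith

/-- Liouville's theorem: the spray preserves the measure `det g ds dt`. -/
theorem geo_det_eq (h : IsLocalFinsler L T) (ht : t ∈ T) (hs : s ≠ 0) :
    geo L (fun t s => (metricMatrix L t s).det) t s =
      (metricMatrix L t s).det * ∑ α, dS α (spray L α) t s := by
  have hQ := h.smooth.pow 2
  rw [h.geo_det ht hs]
  congr 1
  -- This is the Euler–Lagrange equation X(∂F²/∂s^β) = ∂F²/∂t^β differentiated in s^δ. The mixed
  -- derivatives appear antisymmetrized in δ and β.
  have h1 : ∀ δ β, dT δ (dS β fun t s => L t s ^ 2) t s - dT β (dS δ fun t s => L t s ^ 2) t s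
      + 2 * geo L (metric L δ β) t s
      - 2 * ∑ α, dS δ (spray L α) t s * metric L α β t s = 0 := by
    intro δ β
    have h2 := dS_congr (f := geo L (dS β (fun t s => L t s ^ 2)))
      (g := dT β (fun t s => L t s ^ 2)) (fun s hs => h.geo_dS_sq ht hs β) hs δ
    have s1 : ∀ α, SmoothOff T (fun t s => s α * dT α (dS β fun t s => L t s ^ 2) t s) :=
      fun α => (SmoothOff.coord α).mul ((hQ.dS h.isOpen β).dT h.isOpen α)
    have s2 : ∀ α, SmoothOff T (fun t s => (-1) * (spray L α t s * dS α (dS β fun t s => L t s ^ 2) t s)) :=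
      fun α => ((h.smooth_spray α).mul ((hQ.dS h.isOpen β).dS h.isOpen α)).const_mul _
    have h3 := dS_congr (f := geo L (dS β (fun t s => L t s ^ 2)))
      (g := fun t s => ∑ α, (s α * dT α (dS β fun t s => L t s ^ 2) t s +
        (-1) * (spray L α t s * dS α (dS β fun t s => L t s ^ 2) t s))) (t := t)
      (fun s hs => by simp only [geo]; rw [Finset.sum_add_distrib, ← Finset.mul_sum]; ring) hs δ
    rw [dS_sum (fun α _ => (s1 α).add (s2 α)) h.isOpen ht hs] at h3
    have h4 : ∀ α, dS δ (fun t s => s α * dT α (dS β fun t s => L t s ^ 2) t s +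
        (-1) * (spray L α t s * dS α (dS β fun t s => L t s ^ 2) t s)) t s =
        (if α = δ then 1 else 0) * dT α (dS β fun t s => L t s ^ 2) t s
        + s α * (2 * dT α (metric L δ β) t s)
        - dS δ (spray L α) t s * (2 * metric L α β t s)
        - spray L α t s * (2 * dS α (metric L δ β) t s) := by
      intro α
      have a1 : dS δ (fun t s => s α * dT α (dS β fun t s => L t s ^ 2) t s +
        (-1) * (spray L α t s * dS α (dS β fun t s => L t s ^ 2) t s)) t s =
        dS δ (fun t s => s α * dT α (dS β fun t s => L t s ^ 2) t s) t s +
        dS δ (fun t s => (-1) * (spray L α t s * dS α (dS β fun t s => L t s ^ 2) t s)) t s := by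
        exact dS_add (s1 α) (s2 α) h.isOpen ht hs δ
      have a2 : dT α (metric L δ β) t s = 1 / 2 * dS δ (dT α (dS β fun t s => L t s ^ 2)) t s := by
        rw [← dT_dS_comm (hQ.dS h.isOpen β) h.isOpen ht hs,
          ← dT_const_mul ((hQ.dS h.isOpen β).dS h.isOpen δ) h.isOpen ht hs]
        rfl
      have a3 : dS α (metric L δ β) t s = 1 / 2 * dS δ (dS α (dS β fun t s => L t s ^ 2)) t s := by
        rw [dS_dS_comm (hQ.dS h.isOpen β) h.isOpen ht hs,
          ← dS_const_mul ((hQ.dS h.isOpen β).dS h.isOpen δ) h.isOpen ht hs]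
        rfl
      rw [a1, dS_const_mul ((h.smooth_spray α).mul ((hQ.dS h.isOpen β).dS h.isOpen α)) h.isOpen ht hs,
        dS_mul (SmoothOff.coord α) ((hQ.dS h.isOpen β).dT h.isOpen α) h.isOpen ht hs,
        dS_mul (h.smooth_spray α) ((hQ.dS h.isOpen β).dS h.isOpen α) h.isOpen ht hs, dS_coord, a2,
        a3, metric]
      ring
    rw [h2] at h3
    simp_rw [h4, Finset.sum_sub_distrib, Finset.sum_add_distrib] at h3
    rw [← dT_dS_comm hQ h.isOpen ht hs] at h3
    simp only [ite_mul, one_mul, zero_mul, Finset.sum_ite_eq', Finset.mem_univ, if_true] at h3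
    have h5 : 2 * geo L (metric L δ β) t s = ∑ α, s α * (2 * dT α (metric L δ β) t s)
        - ∑ α, spray L α t s * (2 * dS α (metric L δ β) t s) := by
      rw [geo, mul_sub, Finset.mul_sum, Finset.mul_sum]
      congr 1 <;> exact Finset.sum_congr rfl fun _ _ => by ring
    have h6 : 2 * ∑ α, dS δ (spray L α) t s * metric L α β t s =
        ∑ α, dS δ (spray L α) t s * (2 * metric L α β t s) := by
      rw [Finset.mul_sum]; exact Finset.sum_congr rfl fun _ _ => by ring
    rw [h5, h6]
    linarith
  -- Taking the trace with the symmetric g^{βδ} removes the antisymmetric part and leaves g^{βδ}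
  -- X(g_{δβ}) = ∂G^δ/∂s^δ, which is the logarithmic derivative of det g.
  have h7 : ∑ δ, ∑ β, invMetric L β δ t s * (dT δ (dS β fun t s => L t s ^ 2) t s
      - dT β (dS δ fun t s => L t s ^ 2) t s + 2 * geo L (metric L δ β) t s
      - 2 * ∑ α, dS δ (spray L α) t s * metric L α β t s) = 0 := by simp [h1]
  simp_rw [mul_sub, mul_add, mul_sub, Finset.sum_sub_distrib, Finset.sum_add_distrib,
    Finset.sum_sub_distrib] at h7
  have h8 : ∑ δ, ∑ β, invMetric L β δ t s * dT δ (dS β fun t s => L t s ^ 2) t s =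
      ∑ δ, ∑ β, invMetric L β δ t s * dT β (dS δ fun t s => L t s ^ 2) t s := by
    rw [Finset.sum_comm]
    exact Finset.sum_congr rfl fun β _ => Finset.sum_congr rfl fun δ _ => by
      rw [h.invMetric_symm ht hs]
  have h9 : ∑ δ, ∑ β, invMetric L β δ t s * (2 * ∑ α, dS δ (spray L α) t s * metric L α β t s) =
      2 * ∑ δ, dS δ (spray L δ) t s := by
    rw [Finset.mul_sum]
    refine Finset.sum_congr rfl fun δ _ => ?_
    simp_rw [Finset.mul_sum]
    rw [Finset.sum_comm]
    have : ∀ α, ∑ β, invMetric L β δ t s * (2 * (dS δ (spray L α) t s * metric L α β t s)) =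
        2 * dS δ (spray L α) t s * if α = δ then 1 else 0 := by
      intro α
      rw [← h.sum_metric_mul_inv ht hs, Finset.mul_sum]
      exact Finset.sum_congr rfl fun _ _ => by ring
    simp [this]
  have h10 : ∑ δ, ∑ β, invMetric L β δ t s * (2 * geo L (metric L δ β) t s) =
      2 * ∑ δ, ∑ β, invMetric L β δ t s * geo L (metric L δ β) t s := by
    simp_rw [Finset.mul_sum]
    exact Finset.sum_congr rfl fun _ _ => Finset.sum_congr rfl fun _ _ => by ring
  rw [h8, h9, h10] at h7
  linarith

end IsLocalFinsler

end Spray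

end FinslerMaps

end

noncomputable section

namespace FinslerMaps

/-! ### Integration by parts in the coordinates `(t, s)` -/

section Integrals

variable {p : ℕ} {T : Set (Coord p)} {K : Set (Coord p × Coord p)}
  {L f g : Coord p → Coord p → ℝ} {t s : Coord p}

/-- Off U the complement of K is a neighbourhood on which f vanishes. So no regularity is required
at s = 0 or outside the coordinate domain. -/
theorem continuous_of_zero_off_compact {V : Type*} [TopologicalSpace V] [T2Space V] {U K : Set V}
    {f : V → ℝ} (hU : IsOpen U) (hf : ContinuousOn f U) (hK : IsCompact K) (hKU : K ⊆ U)
    (h0 : ∀ z ∉ K, f z = 0) : Continuous f := by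
  rw [continuous_iff_continuousAt]
  intro z
  by_cases hz : z ∈ U
  · exact hf.continuousAt (hU.mem_nhds hz)
  · refine (continuousAt_const (y := (0 : ℝ))).congr ?_
    filter_upwards [hK.isClosed.isOpen_compl.mem_nhds fun h => hz (hKU h)] with w hw
      using (h0 w hw).symm

theorem integrable_of_zero_off_compact {V : Type*} [TopologicalSpace V] [T2Space V]
    [MeasurableSpace V] [OpensMeasurableSpace V] {μ : Measure V} [IsFiniteMeasureOnCompacts μ]
    {U K : Set V}
    {f : V → ℝ} (hU : IsOpen U) (hf : ContinuousOn f U) (hK : IsCompact K) (hKU : K ⊆ U)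
    (h0 : ∀ z ∉ K, f z = 0) : Integrable f μ :=
  (continuous_of_zero_off_compact hU hf hK hKU h0).integrable_of_hasCompactSupport
    (HasCompactSupport.intro hK h0)

theorem SmoothOff.contDiff_of_compact (hf : SmoothOff T f) (hT : IsOpen T) (hK : IsCompact K)
    (hKT : K ⊆ T ×ˢ {0}ᶜ) (h0 : ∀ z ∉ K, f z.1 z.2 = 0) :
    ContDiff ℝ ∞ (fun z : Coord p × Coord p => f z.1 z.2) := by
  rw [contDiff_iff_contDiffAt]
  intro z
  by_cases hz : z ∈ T ×ˢ ({0}ᶜ : Set (Coord p))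
  · exact hf.contDiffAt hT hz.1 hz.2
  · refine (contDiffAt_const (c := (0 : ℝ))).congr_of_eventuallyEq ?_
    filter_upwards [hK.isClosed.isOpen_compl.mem_nhds fun h => hz (hKT h)] with w hw
      using h0 w hw

theorem SmoothOff.integrable (hf : SmoothOff T f) (hT : IsOpen T) (hK : IsCompact K)
    (hKT : K ⊆ T ×ˢ {0}ᶜ) (h0 : ∀ z ∉ K, f z.1 z.2 = 0) :
    Integrable (fun z : Coord p × Coord p => f z.1 z.2) :=
  integrable_of_zero_off_compact (isOpen_slit hT) (ContDiffOn.continuousOn hf) hK hKT h0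

/-- Integration by parts against the constant function 1. -/
theorem integral_fderiv_eq_zero {V : Type*} [NormedAddCommGroup V] [NormedSpace ℝ V]
    [MeasurableSpace V] [BorelSpace V] [FiniteDimensional ℝ V] (μ : Measure V) [μ.IsAddHaarMeasure]
    {f : V → ℝ} (hf : ContDiff ℝ ∞ f) (hc : HasCompactSupport f) (v : V) :
    ∫ z, fderiv ℝ f z v ∂μ = 0 := by
  have hi : Integrable f μ := hf.continuous.integrable_of_hasCompactSupport hc
  have hi' : Integrable (fun z => fderiv ℝ f z v) μ := by
    refine Continuous.integrable_of_hasCompactSupport ?_ ?_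
    · exact (hf.continuous_fderiv (by simp)).clm_apply continuous_const
    · exact hc.fderiv_apply ℝ v
  have := integral_mul_fderiv_eq_neg_fderiv_mul_of_integrable (μ := μ) (f := fun _ => (1 : ℝ))
    (g := f) (v := v) (by simp) (by simpa using hi') (by simpa using hi)
    (fun _ _ => differentiableAt_const _) (fun x _ => hf.differentiable (by simp) x)
  simpa using this

theorem dS_eq_zero_off (hK : IsCompact K) (h0 : ∀ z ∉ K, f z.1 z.2 = 0)
    (hz : (t, s) ∉ K) (α : Fin p) : dS α f t s = 0 := by
  unfold dS
  rw [Filter.EventuallyEq.fderiv_eq (f := fun _ => (0 : ℝ))]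
  · simp
  · have hc : Continuous fun s' : Coord p => (t, s') := by fun_prop
    filter_upwards [(hK.isClosed.isOpen_compl.preimage hc).mem_nhds hz] with w hw using h0 _ hw

theorem dT_eq_zero_off (hK : IsCompact K) (h0 : ∀ z ∉ K, f z.1 z.2 = 0)
    (hz : (t, s) ∉ K) (α : Fin p) : dT α f t s = 0 := by
  unfold dT
  rw [Filter.EventuallyEq.fderiv_eq (f := fun _ => (0 : ℝ))]
  · simp
  · have hc : Continuous fun t' : Coord p => (t', s) := by fun_prop
    filter_upwards [(hK.isClosed.isOpen_compl.preimage hc).mem_nhds hz] with w hw using h0 _ hw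

instance isAddHaarMeasure_volume_prod :
    (volume : Measure (Coord p × Coord p)).IsAddHaarMeasure :=
  Measure.prod.instIsAddHaarMeasure volume volume

theorem integral_dS_eq_zero (hf : SmoothOff T f) (hT : IsOpen T) (hK : IsCompact K)
    (hKT : K ⊆ T ×ˢ {0}ᶜ) (h0 : ∀ z ∉ K, f z.1 z.2 = 0) (α : Fin p) :
    ∫ z : Coord p × Coord p, dS α f z.1 z.2 = 0 := by
  have hd := hf.contDiff_of_compact hT hK hKT h0
  rw [← integral_fderiv_eq_zero volume hd (HasCompactSupport.intro hK h0)
    (0, EuclideanSpace.single α 1)]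
  exact integral_congr_ae (Filter.Eventually.of_forall fun z =>
    dS_eq_fderiv (hd.differentiable (by simp) z) α)

theorem integral_dT_eq_zero (hf : SmoothOff T f) (hT : IsOpen T) (hK : IsCompact K)
    (hKT : K ⊆ T ×ˢ {0}ᶜ) (h0 : ∀ z ∉ K, f z.1 z.2 = 0) (α : Fin p) :
    ∫ z : Coord p × Coord p, dT α f z.1 z.2 = 0 := by
  have hd := hf.contDiff_of_compact hT hK hKT h0
  rw [← integral_fderiv_eq_zero volume hd (HasCompactSupport.intro hK h0)
    (EuclideanSpace.single α 1, 0)]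
  exact integral_congr_ae (Filter.Eventually.of_forall fun z =>
    dT_eq_fderiv (hd.differentiable (by simp) z) α)

theorem integral_sum_dS_eq_zero {Z : Fin p → Coord p → Coord p → ℝ}
    (hf : ∀ α, SmoothOff T (Z α)) (hT : IsOpen T) (hK : IsCompact K)
    (hKT : K ⊆ T ×ˢ {0}ᶜ) (h0 : ∀ α, ∀ z ∉ K, Z α z.1 z.2 = 0) :
    ∫ z : Coord p × Coord p, ∑ α, dS α (Z α) z.1 z.2 = 0 := by
  rw [integral_finsetSum _ fun α _ => ((hf α).dS hT α).integrable hT hK hKT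
    fun z hz => dS_eq_zero_off hK (h0 α) hz α]
  exact Finset.sum_eq_zero fun α _ => integral_dS_eq_zero (hf α) hT hK hKT (h0 α) α

theorem integral_sum_dT_eq_zero {Z : Fin p → Coord p → Coord p → ℝ}
    (hf : ∀ α, SmoothOff T (Z α)) (hT : IsOpen T) (hK : IsCompact K)
    (hKT : K ⊆ T ×ˢ {0}ᶜ) (h0 : ∀ α, ∀ z ∉ K, Z α z.1 z.2 = 0) :
    ∫ z : Coord p × Coord p, ∑ α, dT α (Z α) z.1 z.2 = 0 := by
  rw [integral_finsetSum _ fun α _ => ((hf α).dT hT α).integrable hT hK hKT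
    fun z hz => dT_eq_zero_off hK (h0 α) hz α]
  exact Finset.sum_eq_zero fun α _ => integral_dT_eq_zero (hf α) hT hK hKT (h0 α) α

namespace IsLocalFinsler

/-- Since ∂F²/∂s^α = 2 g_{αγ} s^γ, raising the index returns twice the radial vector. -/
theorem sum_dS_sq_mul_invMetric (h : IsLocalFinsler L T) (ht : t ∈ T) (hs : s ≠ 0) (β : Fin p) :
    ∑ α, dS α (fun t s => L t s ^ 2) t s * invMetric L α β t s = 2 * s β := by
  have h1 : ∀ α, dS α (fun t s => L t s ^ 2) t s = 2 * ∑ γ, metric L γ α t s * s γ := by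
    intro α
    simp_rw [h.metric_symm ht hs _ α, h.sum_metric_mul ht hs]; ring
  simp_rw [h1, Finset.mul_sum, Finset.sum_mul]
  rw [Finset.sum_comm]
  have : ∀ γ, ∑ α, 2 * (metric L γ α t s * s γ) * invMetric L α β t s =
      2 * s γ * if γ = β then 1 else 0 := by
    intro γ
    rw [← h.sum_metric_mul_inv ht hs, Finset.mul_sum]
    exact Finset.sum_congr rfl fun _ _ => by ring
  simp [this]

/-- The trace of the fibrewise Hessian of a function of degree two integrates like the function
itself, for a weight that depends on the fibre variable only through `L`. -/
theorem integral_trace_eq (h : IsLocalFinsler L T)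
    {κ η u : Coord p → Coord p → ℝ} (hκ : SmoothOff T κ)
    (hK : IsCompact K) (hKT : K ⊆ T ×ˢ {0}ᶜ) (h0 : ∀ z ∉ K, κ z.1 z.2 = 0)
    (hη : ∀ t ∈ T, ∀ s ≠ 0, ∀ α, dS α κ t s = η t s * dS α (fun t s => L t s ^ 2) t s)
    (hu : SmoothOff T u) (eu : EulerDeg T 1 u) :
    ∫ z : Coord p × Coord p, κ z.1 z.2 * (metricMatrix L z.1 z.2).det *
      (∑ α, ∑ β, invMetric L α β z.1 z.2 * metric u α β z.1 z.2
        - p * (u z.1 z.2 ^ 2 * (L z.1 z.2 ^ 2)⁻¹)) = 0 := by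
  have hT := h.isOpen
  have hq := hu.pow 2
  have eq2 : EulerDeg T 2 (fun t s => u t s ^ 2) := by
    have := eu.mul eu hu hu hT
    norm_num at this
    exact this.congr fun t _ s _ => by ring
  have hQ := h.smooth.pow 2
  have hQ0 : ∀ t ∈ T, ∀ s ≠ 0, L t s ^ 2 ≠ 0 := fun t ht s hs => (pow_pos (h.pos ht hs) 2).ne'
  have hr : SmoothOff T (fun t s => (metricMatrix L t s).det * (u t s ^ 2 * (L t s ^ 2)⁻¹)) :=
    h.smooth_det.mul (hq.mul (hQ.inv hQ0))
  have er : EulerDeg T 0 (fun t s => (metricMatrix L t s).det * (u t s ^ 2 * (L t s ^ 2)⁻¹)) := by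
    have := h.euler_det.mul (eq2.mul (h.euler_sq.inv hQ hT hQ0) hq (hQ.inv hQ0) hT) h.smooth_det
      (hq.mul (hQ.inv hQ0)) hT
    norm_num at this
    exact this
  have hd : ∀ α β, SmoothOff T (fun t s => (metricMatrix L t s).det * invMetric L α β t s) :=
    fun α β => h.smooth_det.mul (h.smooth_invMetric α β)
  have hdq : ∀ β, SmoothOff T (fun t s => (1 / 2) * dS β (fun t s => u t s ^ 2) t s) :=
    fun β => (hq.dS hT β).const_mul _
  have hY1 : ∀ α, SmoothOff T (fun t s => ∑ β, (metricMatrix L t s).det * invMetric L α β t s *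
      ((1 / 2) * dS β (fun t s => u t s ^ 2) t s)) :=
    fun α => SmoothOff.sum fun β _ => (hd α β).mul (hdq β)
  have hY2 : ∀ α, SmoothOff T (fun t s => (-1) *
      ((metricMatrix L t s).det * (u t s ^ 2 * (L t s ^ 2)⁻¹) * s α)) :=
    fun α => (hr.mul (SmoothOff.coord α)).const_mul _
  -- Y is det g times the g-gradient of u²/2, corrected by a radial field so that it becomes tangent
  -- to the level sets of F.
  set Y : Fin p → Coord p → Coord p → ℝ := fun α t s =>
    (∑ β, (metricMatrix L t s).det * invMetric L α β t s *
      ((1 / 2) * dS β (fun t s => u t s ^ 2) t s)) + (-1) *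
      ((metricMatrix L t s).det * (u t s ^ 2 * (L t s ^ 2)⁻¹) * s α) with hYdef
  have hY : ∀ α, SmoothOff T (Y α) := fun α => (hY1 α).add (hY2 α)
  rw [← integral_sum_dS_eq_zero (Z := fun α t s => κ t s * Y α t s)
    (fun α => hκ.mul (hY α)) hT hK hKT (fun α z hz => by simp [h0 z hz])]
  refine integral_congr_ae (Filter.Eventually.of_forall fun ⟨t, s⟩ => ?_)
  by_cases hz : (t, s) ∈ K
  swap
  · simp only
    rw [Finset.sum_eq_zero fun α _ => dS_eq_zero_off hK (fun z hz => by simp [h0 z hz]) hz α,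
      show κ t s = 0 from h0 _ hz]
    simp
  obtain ⟨ht, hs⟩ := hKT hz
  simp only [mem_compl_iff, mem_singleton_iff] at ht hs
  have hQt := hQ0 t ht s hs
  simp_rw [fun α => dS_mul hκ (hY α) hT ht hs α, hη t ht s hs, Finset.sum_add_distrib]
  -- Tangency: the gradient part pairs with d(F²) to 2u² det g by Euler's relation for u², and the
  -- radial part to -2u² det g. The weight κ therefore contributes nothing.
  have e1 : ∑ α, η t s * dS α (fun t s => L t s ^ 2) t s * Y α t s = 0 := by
    have a1 : ∑ α, dS α (fun t s => L t s ^ 2) t s * (∑ β, (metricMatrix L t s).det *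
        invMetric L α β t s * ((1 / 2) * dS β (fun t s => u t s ^ 2) t s)) =
        2 * ((metricMatrix L t s).det * u t s ^ 2) := by
      simp_rw [Finset.mul_sum]
      rw [Finset.sum_comm]
      calc _ = ∑ β, (∑ α, dS α (fun t s => L t s ^ 2) t s * invMetric L α β t s) *
            ((metricMatrix L t s).det * ((1 / 2) * dS β (fun t s => u t s ^ 2) t s)) := by
            refine Finset.sum_congr rfl fun β _ => ?_
            rw [Finset.sum_mul]; exact Finset.sum_congr rfl fun _ _ => by ring
        _ = (metricMatrix L t s).det * ∑ β, s β * dS β (fun t s => u t s ^ 2) t s := by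
            simp_rw [h.sum_dS_sq_mul_invMetric ht hs, Finset.mul_sum]
            exact Finset.sum_congr rfl fun _ _ => by ring
        _ = _ := by rw [eq2 t ht s hs]; ring
    have a2 : ∑ α, dS α (fun t s => L t s ^ 2) t s * ((-1) *
      ((metricMatrix L t s).det * (u t s ^ 2 * (L t s ^ 2)⁻¹) * s α)) =
        - 2 * ((metricMatrix L t s).det * u t s ^ 2) := by
      calc _ = - ((metricMatrix L t s).det * (u t s ^ 2 * (L t s ^ 2)⁻¹)) *
            ∑ α, s α * dS α (fun t s => L t s ^ 2) t s := by
            rw [Finset.mul_sum]; exact Finset.sum_congr rfl fun _ _ => by ring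
        _ = _ := by rw [h.euler_sq t ht s hs, show ∀ d q Q : ℝ, -(d * (q * Q⁻¹)) * (2 * Q) =
              -2 * (d * q) * (Q⁻¹ * Q) from fun d q Q => by ring, inv_mul_cancel₀ hQt, mul_one]
    simp_rw [mul_assoc, ← Finset.mul_sum, hYdef, mul_add, Finset.sum_add_distrib]
    rw [a1, a2]; ring
  -- As the cofactors are divergence free, the gradient part gives det g times the trace. The radial
  -- part has a coefficient of degree zero, so its divergence is -p times that coefficient.
  have e2 : ∑ α, dS α (Y α) t s = (metricMatrix L t s).det *
      (∑ α, ∑ β, invMetric L α β t s * metric u α β t s - p * (u t s ^ 2 * (L t s ^ 2)⁻¹)) := by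
    simp_rw [hYdef, fun α => dS_add (hY1 α) (hY2 α) hT ht hs α, Finset.sum_add_distrib]
    have b1 : ∑ α, dS α (fun t s => ∑ β, (metricMatrix L t s).det * invMetric L α β t s *
        ((1 / 2) * dS β (fun t s => u t s ^ 2) t s)) t s =
        (metricMatrix L t s).det * ∑ α, ∑ β, invMetric L α β t s * metric u α β t s := by
      simp_rw [fun α => dS_sum (fun β (_ : β ∈ Finset.univ) => (hd α β).mul (hdq β)) hT ht hs α,
        fun α β => dS_mul (hd α β) (hdq β) hT ht hs α, Finset.sum_add_distrib]
      have c1 : ∑ α, ∑ β, dS α (fun t s => (metricMatrix L t s).det * invMetric L α β t s) t s *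
          (1 / 2 * dS β (fun t s => u t s ^ 2) t s) = 0 := by
        rw [Finset.sum_comm]
        refine Finset.sum_eq_zero fun β _ => ?_
        rw [← Finset.sum_mul, h.sum_dS_det_mul_invMetric ht hs, zero_mul]
      rw [c1, zero_add, Finset.mul_sum]
      refine Finset.sum_congr rfl fun α _ => ?_
      rw [Finset.mul_sum]
      refine Finset.sum_congr rfl fun β _ => ?_
      rw [dS_const_mul (hq.dS hT β) hT ht hs, metric]; ring
    have b2 : ∑ α, dS α (fun t s => (-1) *
        ((metricMatrix L t s).det * (u t s ^ 2 * (L t s ^ 2)⁻¹) * s α)) t s =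
        - (p * ((metricMatrix L t s).det * (u t s ^ 2 * (L t s ^ 2)⁻¹))) := by
      simp_rw [fun α => dS_const_mul (hr.mul (SmoothOff.coord α)) hT ht hs (-1) α,
        fun α => dS_mul hr (SmoothOff.coord α) hT ht hs α, dS_coord]
      have c1 := er t ht s hs
      rw [zero_mul] at c1
      rw [← Finset.mul_sum, Finset.sum_add_distrib]
      simp_rw [mul_comm _ (s _), c1]
      simp
    rw [b1, b2]; ring
  rw [e1, ← Finset.mul_sum, e2]; ring

/-- The spray preserves the measure `det g ds dt`. -/
theorem integral_geo_mul_det (h : IsLocalFinsler L T)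
    (hf : SmoothOff T f) (hK : IsCompact K) (hKT : K ⊆ T ×ˢ {0}ᶜ)
    (h0 : ∀ z ∉ K, f z.1 z.2 = 0) :
    ∫ z : Coord p × Coord p, geo L f z.1 z.2 * (metricMatrix L z.1 z.2).det = 0 := by
  have hT := h.isOpen
  have hfd := hf.mul h.smooth_det
  have s1 : ∀ α, SmoothOff T (fun t s => f t s * (metricMatrix L t s).det * s α) :=
    fun α => hfd.mul (SmoothOff.coord α)
  have s2 : ∀ α, SmoothOff T (fun t s => f t s * (metricMatrix L t s).det * spray L α t s) :=
    fun α => hfd.mul (h.smooth_spray α)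
  have z1 : ∀ α, ∀ z ∉ K, f z.1 z.2 * (metricMatrix L z.1 z.2).det * z.2 α = 0 :=
    fun α z hz => by simp [h0 z hz]
  have z2 : ∀ α, ∀ z ∉ K, f z.1 z.2 * (metricMatrix L z.1 z.2).det * spray L α z.1 z.2 = 0 :=
    fun α z hz => by simp [h0 z hz]
  -- The divergence of f det g X in (t, s) is X(f) det g, because Liouville's theorem cancels the
  -- terms in which f is not differentiated.
  have i1 := integral_sum_dT_eq_zero s1 hT hK hKT z1
  have i2 := integral_sum_dS_eq_zero s2 hT hK hKT z2
  have i3 : ∫ z : Coord p × Coord p,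
      (∑ α, dT α (fun t s => f t s * (metricMatrix L t s).det * s α) z.1 z.2 -
        ∑ α, dS α (fun t s => f t s * (metricMatrix L t s).det * spray L α t s) z.1 z.2) = 0 := by
    rw [integral_sub, i1, i2, sub_zero]
    · exact (SmoothOff.sum fun α _ => (s1 α).dT hT α).integrable hT hK hKT
        fun z hz => Finset.sum_eq_zero fun α _ => dT_eq_zero_off hK (z1 α) hz α
    · exact (SmoothOff.sum fun α _ => (s2 α).dS hT α).integrable hT hK hKT
        fun z hz => Finset.sum_eq_zero fun α _ => dS_eq_zero_off hK (z2 α) hz α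
  rw [← i3]
  refine integral_congr_ae (Filter.Eventually.of_forall fun ⟨t, s⟩ => ?_)
  by_cases hz : (t, s) ∈ K
  swap
  · simp only [geo]
    simp [Finset.sum_eq_zero fun α (_ : α ∈ Finset.univ) => dT_eq_zero_off
        (f := fun t s => f t s * (metricMatrix L t s).det * s α) hK (z1 α) hz α,
      Finset.sum_eq_zero fun α (_ : α ∈ Finset.univ) => dS_eq_zero_off
        (f := fun t s => f t s * (metricMatrix L t s).det * spray L α t s) hK (z2 α) hz α,
      dT_eq_zero_off hK h0 hz, dS_eq_zero_off hK h0 hz]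
  obtain ⟨ht, hs⟩ := hKT hz
  simp only [mem_compl_iff, mem_singleton_iff] at ht hs
  simp_rw [fun α => dT_mul hfd (SmoothOff.coord α) hT ht hs α,
    fun α => dS_mul hfd (h.smooth_spray α) hT ht hs α, dT_coord, mul_zero, add_zero,
    Finset.sum_add_distrib, ← Finset.mul_sum]
  have e1 := geo_mul (L := L) hf h.smooth_det hT ht hs
  rw [h.geo_det_eq ht hs] at e1
  have e2 : geo L (fun t s => f t s * (metricMatrix L t s).det) t s =
      ∑ α, dT α (fun t s => f t s * (metricMatrix L t s).det) t s * s α -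
      ∑ α, dS α (fun t s => f t s * (metricMatrix L t s).det) t s * spray L α t s := by
    rw [geo]
    congr 1 <;> exact Finset.sum_congr rfl fun _ _ => by ring
  linarith

/-- Invariance of det g dt ds applied to the product κW makes X skew-adjoint. The support condition
is needed on κ only. -/
theorem integral_mul_geo (h : IsLocalFinsler L T) {κ W : Coord p → Coord p → ℝ} (hκ : SmoothOff T κ)
    (hK : IsCompact K) (hKT : K ⊆ T ×ˢ {0}ᶜ) (h0 : ∀ z ∉ K, κ z.1 z.2 = 0) (hW : SmoothOff T W) :
    ∫ z : Coord p × Coord p, κ z.1 z.2 * (metricMatrix L z.1 z.2).det * geo L W z.1 z.2 =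
      - ∫ z : Coord p × Coord p, geo L κ z.1 z.2 * (metricMatrix L z.1 z.2).det * W z.1 z.2 := by
  have hT := h.isOpen
  have h1 := h.integral_geo_mul_det (hκ.mul hW) hK hKT (fun z hz => by simp [h0 z hz])
  rw [← add_eq_zero_iff_eq_neg, ← integral_add, ← h1]
  · refine integral_congr_ae (Filter.Eventually.of_forall fun ⟨t, s⟩ => ?_)
    by_cases hz : (t, s) ∈ K
    · obtain ⟨ht, hs⟩ := hKT hz
      simp only
      rw [geo_mul hκ hW hT ht hs]; ring
    · have z1 : ∀ z ∉ K, κ z.1 z.2 * W z.1 z.2 = 0 := fun z hz => by simp [h0 z hz]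
      simp [geo, dT_eq_zero_off hK h0 hz, dS_eq_zero_off hK h0 hz, show κ t s = 0 from h0 _ hz,
        dT_eq_zero_off (f := fun t s => κ t s * W t s) hK z1 hz,
        dS_eq_zero_off (f := fun t s => κ t s * W t s) hK z1 hz]
  · exact ((hκ.mul h.smooth_det).mul (h.smooth_geo hW)).integrable hT hK hKT
      fun z hz => by simp [h0 z hz]
  · exact (((h.smooth_geo hκ).mul h.smooth_det).mul hW).integrable hT hK hKT
      fun z hz => by simp [geo, dT_eq_zero_off hK h0 hz, dS_eq_zero_off hK h0 hz]

end IsLocalFinsler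

end Integrals

end FinslerMaps

end

noncomputable section

namespace FinslerMaps

/-! ### Induced charts of the tangent bundle -/

section Charts

variable {p : ℕ} {M : Type*} [TopologicalSpace M] [ChartedSpace (Coord p) M]

/-- The parametrization of the tangent bundle over the domain of a chart. -/
def bundleParam (e : OpenPartialHomeomorph M (Coord p)) (z : Coord p × Coord p) :
    TangentBundle (𝓡 p) M :=
  ⟨e.symm z.1, mfderiv (𝓡 p) (𝓡 p) e.symm z.1 z.2⟩

/-- The coordinates `(t, s)` of a tangent vector. -/
def bundleCoord (e : OpenPartialHomeomorph M (Coord p)) (v : TangentBundle (𝓡 p) M) :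
    Coord p × Coord p :=
  (e v.proj, mfderiv (𝓡 p) (𝓡 p) e v.proj v.2)

/-- The derivative of the inverse of a chart, as an endomorphism of `ℝ^p`. -/
def chartLin (e : OpenPartialHomeomorph M (Coord p)) (t : Coord p) : Coord p →L[ℝ] Coord p :=
  mfderiv (𝓡 p) (𝓡 p) e.symm t

theorem bundleParam_eq (e : OpenPartialHomeomorph M (Coord p)) (t s : Coord p) :
    bundleParam e (t, s) = ⟨e.symm t, (chartLin e t s : Coord p)⟩ := rfl

theorem contMDiff_totalSpaceMk :
    ContMDiff 𝓘(ℝ, Coord p × Coord p) (𝓡 p).tangent ∞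
      (fun z : Coord p × Coord p => (⟨z.1, z.2⟩ : TangentBundle (𝓡 p) (Coord p))) := by
  have h := contMDiff_tangentBundleModelSpaceHomeomorph_symm (I := 𝓡 p) (n := ∞)
  rw [tangentBundleModelSpaceHomeomorph_coe_symm] at h
  rw [modelWithCornersSelf_prod]
  exact h

theorem contMDiff_toProd :
    ContMDiff (𝓡 p).tangent 𝓘(ℝ, Coord p × Coord p) ∞
      (fun v : TangentBundle (𝓡 p) (Coord p) => ((v.1, v.2) : Coord p × Coord p)) := by
  have h := contMDiff_tangentBundleModelSpaceHomeomorph (I := 𝓡 p) (n := ∞)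
  rw [tangentBundleModelSpaceHomeomorph_coe] at h
  rw [modelWithCornersSelf_prod]
  exact h

theorem mdifferentiable_of_mem_maximalAtlas {e : OpenPartialHomeomorph M (Coord p)}
    (he : e ∈ IsManifold.maximalAtlas (𝓡 p) ∞ M) : e.MDifferentiable (𝓡 p) (𝓡 p) :=
  ⟨(contMDiffOn_of_mem_maximalAtlas he).mdifferentiableOn (by simp),
    (contMDiffOn_symm_of_mem_maximalAtlas he).mdifferentiableOn (by simp)⟩

variable [IsManifold (𝓡 p) ∞ M] {e e' : OpenPartialHomeomorph M (Coord p)}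

theorem contMDiffOn_bundleParam (he : e ∈ IsManifold.maximalAtlas (𝓡 p) ∞ M) :
    ContMDiffOn 𝓘(ℝ, Coord p × Coord p) (𝓡 p).tangent ∞ (bundleParam e) (e.target ×ˢ univ) := by
  have h1 := (contMDiffOn_symm_of_mem_maximalAtlas he).contMDiffOn_tangentMapWithin (m := ∞)
    (by simp) e.open_target.uniqueMDiffOn
  have h2 := h1.comp (contMDiff_totalSpaceMk (p := p)).contMDiffOn (s := e.target ×ˢ univ)
    (fun z hz => hz.1)
  refine h2.congr fun z hz => ?_
  simp only [Function.comp, tangentMapWithin, bundleParam]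
  rw [mfderivWithin_of_isOpen e.open_target hz.1]

theorem contMDiffOn_bundleCoord (he : e ∈ IsManifold.maximalAtlas (𝓡 p) ∞ M) :
    ContMDiffOn (𝓡 p).tangent 𝓘(ℝ, Coord p × Coord p) ∞ (bundleCoord e)
      (Bundle.TotalSpace.proj ⁻¹' e.source) := by
  have h1 := (contMDiffOn_of_mem_maximalAtlas he).contMDiffOn_tangentMapWithin (m := ∞)
    (by simp) e.open_source.uniqueMDiffOn
  have h2 := (contMDiff_toProd (p := p)).comp_contMDiffOn h1
  refine h2.congr fun z hz => ?_
  simp only [Function.comp, tangentMapWithin, bundleCoord]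
  rw [mfderivWithin_of_isOpen e.open_source hz]

theorem bundleParam_bundleCoord (he : e ∈ IsManifold.maximalAtlas (𝓡 p) ∞ M)
    {v : TangentBundle (𝓡 p) M} (hv : v.proj ∈ e.source) :
    bundleParam e (bundleCoord e v) = v := by
  have h := (mdifferentiable_of_mem_maximalAtlas he).symm_comp_deriv hv
  obtain ⟨x, v⟩ := v
  simp only [bundleParam, bundleCoord]
  have h1 : mfderiv (𝓡 p) (𝓡 p) e.symm (e x) (mfderiv (𝓡 p) (𝓡 p) e x v) = v :=
    congrArg (fun A : Coord p →L[ℝ] Coord p => A v) h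
  have h2 : ∀ y : M, y = x → ∀ w : Coord p, w = v →
      (⟨y, w⟩ : TangentBundle (𝓡 p) M) = ⟨x, v⟩ := by
    rintro _ rfl _ rfl; rfl
  exact h2 _ (e.left_inv hv) _ h1

theorem chartLin_injective (he : e ∈ IsManifold.maximalAtlas (𝓡 p) ∞ M)
    {t : Coord p} (ht : t ∈ e.target) :
    Function.Injective (chartLin e t) :=
  (mdifferentiable_of_mem_maximalAtlas he).symm.mfderiv_injective ht

theorem chartLin_ne_zero (he : e ∈ IsManifold.maximalAtlas (𝓡 p) ∞ M)
    {t s : Coord p} (ht : t ∈ e.target) (hs : s ≠ 0) :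
    chartLin e t s ≠ 0 := fun h0 =>
  hs (chartLin_injective he ht (h0.trans (map_zero _).symm))

/-- A Finsler structure in induced coordinates. -/
theorem isLocalFinsler_localRep (he : e ∈ IsManifold.maximalAtlas (𝓡 p) ∞ M)
    (F : FinslerStructure p M) :
    IsLocalFinsler (localRep F.toFun e) e.target where
  isOpen := e.open_target
  nonneg t s := F.nonneg _
  homogeneous t s c hc := by
    change F.toFun ⟨e.symm t, (chartLin e t (c • s) : Coord p)⟩ =
      c * F.toFun ⟨e.symm t, (chartLin e t s : Coord p)⟩
    rw [map_smul]
    exact F.homogeneous _ _ c hc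
  posDef := F.convex e he
  smooth := by
    have h1 := F.smooth.comp ((contMDiffOn_bundleParam he).mono
      (prod_mono_right (subset_univ ({0}ᶜ : Set (Coord p))))) (fun z hz =>
        chartLin_ne_zero he hz.1 hz.2)
    exact contMDiffOn_iff_contDiffOn.1 h1

/-- Chain rule for e⁻¹ = e'⁻¹ ∘ (e' ∘ e⁻¹). It supplies the Jacobian that compares local volumes. -/
theorem chartLin_transition (he : e ∈ IsManifold.maximalAtlas (𝓡 p) ∞ M)
    (he' : e' ∈ IsManifold.maximalAtlas (𝓡 p) ∞ M) {t : Coord p}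
    (ht : t ∈ e.target) (ht' : e.symm t ∈ e'.source) :
    HasFDerivAt (fun t => e' (e.symm t)) (fderiv ℝ (fun t => e' (e.symm t)) t) t ∧
      chartLin e t = (chartLin e' (e' (e.symm t))).comp (fderiv ℝ (fun t => e' (e.symm t)) t) := by
  have h1 : MDifferentiableAt (𝓡 p) (𝓡 p) e.symm t :=
    (mdifferentiable_of_mem_maximalAtlas he).mdifferentiableAt_symm ht
  have h2 : MDifferentiableAt (𝓡 p) (𝓡 p) e' (e.symm t) :=
    (mdifferentiable_of_mem_maximalAtlas he').mdifferentiableAt ht'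
  have h3 : MDifferentiableAt (𝓡 p) (𝓡 p) (e' ∘ e.symm) t := h2.comp t h1
  have h4 : DifferentiableAt ℝ (fun t => e' (e.symm t)) t := mdifferentiableAt_iff_differentiableAt.1 h3
  refine ⟨h4.hasFDerivAt, ?_⟩
  have h5 := mfderiv_comp t h2 h1
  have h6 := (mdifferentiable_of_mem_maximalAtlas he').symm_comp_deriv ht'
  rw [mfderiv_eq_fderiv] at h5
  change chartLin e t = (chartLin e' (e' (e.symm t))).comp (fderiv ℝ (e' ∘ e.symm) t)
  rw [h5]
  change _ = ((mfderiv (𝓡 p) (𝓡 p) e'.symm (e' (e.symm t))).comp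
    (mfderiv (𝓡 p) (𝓡 p) e' (e.symm t))).comp (mfderiv (𝓡 p) (𝓡 p) e.symm t)
  rw [h6]
  rfl

end Charts

end FinslerMaps

end

noncomputable section

namespace FinslerMaps

/-! ### The fundamental tensor under linear changes of the fibre variable -/

section LinearChange

variable {p n : ℕ}

theorem metric_eq_hessian {h : Coord p → Coord p → ℝ} {t s : Coord p}
    (hs : ContDiffAt ℝ ∞ (fun s' => h t s') s) (α β : Fin p) :
    metric h α β t s = (1 / 2) * fderiv ℝ (fderiv ℝ (fun s' => h t s' ^ 2)) s
      (EuclideanSpace.single α 1) (EuclideanSpace.single β 1) := by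
  have hd : DifferentiableAt ℝ (fderiv ℝ (fun s' => h t s' ^ 2)) s :=
    ((hs.pow 2).fderiv_right (m := 1) (by norm_cast)).differentiableAt (by simp)
  unfold metric dS
  rw [fderiv_clm_apply hd (differentiableAt_const _)]
  simp

/-- The matrix of a linear map between coordinate spaces. -/
def coordMatrix (A : Coord p →L[ℝ] Coord n) : Matrix (Fin n) (Fin p) ℝ :=
  Matrix.of fun i α => A (EuclideanSpace.single α 1) i

theorem coordMatrix_det (A : Coord p →L[ℝ] Coord p) : (coordMatrix A).det = A.det := by
  have : coordMatrix A = LinearMap.toMatrix (EuclideanSpace.basisFun (Fin p) ℝ).toBasis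
      (EuclideanSpace.basisFun (Fin p) ℝ).toBasis (A : Coord p →ₗ[ℝ] Coord p) := by
    ext i α
    simp [coordMatrix, LinearMap.toMatrix_apply]
  rw [this, LinearMap.det_toMatrix]

/-- The second-order chain rule has no first-derivative term for a linear substitution, so the
Hessian changes by congruence. The lemma covers coordinate changes, pull-back by dφ and rescaling of
s. Only the fibre functions matter, whence the free base points t and t'. -/
theorem metricMatrix_comp_linear {f : Coord n → ℝ} (A : Coord p →L[ℝ] Coord n)
    {h : Coord p → Coord p → ℝ} {k : Coord n → Coord n → ℝ} {t s : Coord p} {t' : Coord n}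
    (hh : ∀ s, h t s = f (A s)) (hk : ∀ y, k t' y = f y) (hf : ContDiffAt ℝ ∞ f (A s)) :
    metricMatrix h t s = (coordMatrix A).transpose * metricMatrix k t' (A s) * coordMatrix A := by
  have hh' : h t = fun s => f (A s) := funext hh
  have hk' : k t' = f := funext hk
  have hq : ContDiffAt ℝ ∞ (fun y => f y ^ 2) (A s) := hf.pow 2
  have hd : DifferentiableAt ℝ (fderiv ℝ (fun y => f y ^ 2)) (A s) :=
    (hq.fderiv_right (m := 1) (by norm_cast)).differentiableAt (by simp)
  have hcomp : ContDiffAt ℝ ∞ (fun s => f (A s)) s := hf.comp s A.contDiff.contDiffAt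
  have key : ∀ α β : Fin p, metric h α β t s = (1 / 2) * fderiv ℝ (fderiv ℝ (fun y => f y ^ 2)) (A s)
      (A (EuclideanSpace.single α 1)) (A (EuclideanSpace.single β 1)) := by
    intro α β
    rw [metric_eq_hessian (by rw [hh']; exact hcomp)]
    simp_rw [hh']
    congr 1
    have h1 : fderiv ℝ (fun s => f (A s) ^ 2) =ᶠ[nhds s]
        fun s => (fderiv ℝ (fun y => f y ^ 2) (A s)).comp A := by
      have h2 : ∀ᶠ y in nhds (A s), ContDiffAt ℝ 1 (fun y => f y ^ 2) y :=
        (hq.of_le (by norm_cast)).eventually (by simp)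
      filter_upwards [A.continuous.continuousAt.eventually h2] with s' hs'
      exact fderiv_comp (f := A) s' (hs'.differentiableAt (by simp)) A.differentiableAt |>.trans
        (by rw [A.fderiv])
    rw [h1.fderiv_eq]
    have h3 : HasFDerivAt (fun s => fderiv ℝ (fun y => f y ^ 2) (A s))
        ((fderiv ℝ (fderiv ℝ (fun y => f y ^ 2)) (A s)).comp A) s :=
      hd.hasFDerivAt.comp s A.hasFDerivAt
    have h4 := h3.clm_comp (hasFDerivAt_const A s)
    rw [h4.fderiv]
    simp
  ext α β
  rw [show metricMatrix h t s α β = metric h α β t s from rfl, key]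
  have e1 : ∀ i j, metricMatrix k t' (A s) i j = (1 / 2) * fderiv ℝ (fderiv ℝ (fun y => f y ^ 2)) (A s)
      (EuclideanSpace.single i 1) (EuclideanSpace.single j 1) := by
    intro i j
    rw [show metricMatrix k t' (A s) i j = metric k i j t' (A s) from rfl,
      metric_eq_hessian (by rw [hk']; exact hf)]
    simp_rw [hk']
  conv_lhs => rw [← sum_smul_single (A (EuclideanSpace.single α 1)),
    ← sum_smul_single (A (EuclideanSpace.single β 1))]
  simp only [map_sum, map_smul, FunLike.coe_sum, FunLike.coe_smul, Finset.sum_apply,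
    Pi.smul_apply, smul_eq_mul, Matrix.mul_apply, Matrix.transpose_apply, e1, coordMatrix,
    Matrix.of_apply, Finset.mul_sum, Finset.sum_mul]
  exact Finset.sum_congr rfl fun _ _ => Finset.sum_congr rfl fun _ _ => by ring

/-- The Hessian of s ↦ F(c s)² is c² g(c s) by the chain rule and c² g(s) by homogeneity. -/
theorem metricMatrix_smul {h : Coord p → Coord p → ℝ} {t s : Coord p} {c : ℝ} (hc : 0 < c)
    (hh : ∀ s, ∀ c : ℝ, 0 < c → h t (c • s) = c * h t s)
    (hs : ContDiffAt ℝ ∞ (fun s' => h t s') (c • s)) :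
    metricMatrix h t (c • s) = metricMatrix h t s := by
  have h1 := metricMatrix_comp_linear (f := h t) (c • ContinuousLinearMap.id ℝ (Coord p))
    (h := fun t' s' => h t (c • s')) (k := h) (t := t) (s := s) (t' := t)
    (fun s => rfl) (fun y => rfl) hs
  have hm : coordMatrix (c • ContinuousLinearMap.id ℝ (Coord p)) = c • (1 : Matrix (Fin p) (Fin p) ℝ) := by
    ext i j
    simp [coordMatrix, Matrix.one_apply]
  have h2 : metricMatrix (fun t' s' => h t (c • s')) t s = (c ^ 2) • metricMatrix h t s := by
    ext α β
    simp only [metricMatrix, metric, dS, Matrix.of_apply, Matrix.smul_apply, smul_eq_mul]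
    have e1 : (fun s' => h t (c • s') ^ 2) = fun s' => (c ^ 2) • h t s' ^ 2 := by
      funext s'; rw [hh _ c hc, smul_eq_mul]; ring
    have e2 : ∀ g : Coord p → ℝ, fderiv ℝ (fun s => (c ^ 2) • g s) = (c ^ 2) • fderiv ℝ g :=
      fun g => fderiv_const_smul_field (f := g) (c ^ 2)
    simp_rw [e1, e2, Pi.smul_apply, smul_apply, e2, Pi.smul_apply,
      smul_apply, smul_eq_mul]
    ring
  rw [h2, hm] at h1
  simp only [Matrix.transpose_smul, Matrix.transpose_one, Matrix.smul_mul, Matrix.mul_smul,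
    one_mul, mul_one, smul_smul] at h1
  have hc2 : c ^ 2 ≠ 0 := by positivity
  have h3 : (c ^ 2) • metricMatrix h t s = (c ^ 2) • metricMatrix h t (c • s) := by
    rw [h1]; congr 1; ring
  exact (smul_right_injective _ hc2 h3).symm

end LinearChange

/-! ### Integration in polar coordinates -/

section Polar

/-- A smooth bump function supported in `[1, 2]`. -/
def bump : ContDiffBump (3 / 2 : ℝ) := ⟨1 / 4, 1 / 2, by norm_num, by norm_num⟩

theorem bump_eq_zero {x : ℝ} (h : x ∉ Ioo (1 : ℝ) 2) : bump x = 0 := by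
  apply bump.zero_of_le_dist
  by_contra h1
  apply h
  rw [not_le, Real.dist_eq, abs_lt] at h1
  simp only [bump] at h1
  constructor <;> linarith

theorem bump_nonneg (x : ℝ) : 0 ≤ bump x := bump.nonneg

theorem contDiff_bump : ContDiff ℝ ∞ (fun x => bump x) := bump.contDiff

theorem continuous_bump : Continuous (fun x => bump x) := bump.continuous

/-- The radial integral `∫ χ(r²) r^{p-1} dr`. -/
def bumpMass (p : ℕ) : ℝ := ∫ r in Ioi (0 : ℝ), bump (r ^ 2) * r ^ (p - 1)

theorem integrableOn_bump (p : ℕ) {a : ℝ} (ha : 0 < a) :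
    IntegrableOn (fun r : ℝ => bump ((a * r) ^ 2) * r ^ (p - 1)) (Ioi 0) := by
  apply Integrable.integrableOn
  apply Continuous.integrable_of_hasCompactSupport
  · exact (continuous_bump.comp (by fun_prop)).mul (by fun_prop)
  · refine HasCompactSupport.intro (isCompact_Icc (a := -(2 / a)) (b := 2 / a)) fun r hr => ?_
    have : bump ((a * r) ^ 2) = 0 := by
      apply bump_eq_zero
      intro h
      apply hr
      have h2 : (a * r) ^ 2 < 2 ^ 2 := by linarith [h.2]
      have h3 := abs_lt_of_sq_lt_sq' h2 (by norm_num)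
      constructor
      · rw [← neg_div, div_le_iff₀ ha]; linarith [h3.1]
      · rw [le_div_iff₀ ha]; linarith [h3.2]
    simp [this]

theorem bumpMass_pos (p : ℕ) : 0 < bumpMass p := by
  unfold bumpMass
  have hi := integrableOn_bump p (a := 1) one_pos
  simp only [one_mul] at hi
  rw [setIntegral_pos_iff_support_of_nonneg_ae _ hi]
  · have hsub : Ioo (6 / 5 : ℝ) (13 / 10) ⊆
        Function.support (fun r : ℝ => bump (r ^ 2) * r ^ (p - 1)) ∩ Ioi 0 := by
      intro r hr
      have hr0 : 0 < r := by linarith [hr.1]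
      refine ⟨?_, hr0⟩
      have h1 : bump (r ^ 2) = 1 := by
        apply bump.one_of_mem_closedBall
        rw [Metric.mem_closedBall, Real.dist_eq, abs_le]
        simp only [bump]
        constructor <;> nlinarith [hr.1, hr.2]
      simp [h1, hr0.ne']
    exact lt_of_lt_of_le (by simp; norm_num) (measure_mono hsub)
  · filter_upwards [ae_restrict_mem measurableSet_Ioi] with r hr
    exact mul_nonneg (bump_nonneg _) (pow_nonneg (le_of_lt hr) _)

/-- The substitution r ↦ a r gives a^{-(p-1)} from the power of r and a⁻¹ from dr. For p = 0 the
truncated exponent `p - 1` would break this count. -/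
theorem lintegral_bump_scaled {p : ℕ} (hp : 0 < p) {a : ℝ} (ha : 0 < a) :
    ∫⁻ r in Ioi (0 : ℝ), ENNReal.ofReal (bump ((a * r) ^ 2)) * ENNReal.ofReal (r ^ (p - 1)) =
      ENNReal.ofReal (bumpMass p) * ENNReal.ofReal ((a⁻¹) ^ p) := by
  have h1 : ∫⁻ r in Ioi (0 : ℝ), ENNReal.ofReal (bump ((a * r) ^ 2)) * ENNReal.ofReal (r ^ (p - 1)) =
      ∫⁻ r in Ioi (0 : ℝ), ENNReal.ofReal (bump ((a * r) ^ 2) * r ^ (p - 1)) := by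
    refine lintegral_congr fun r => ?_
    rw [ENNReal.ofReal_mul (bump_nonneg _)]
  rw [h1, ← ofReal_integral_eq_lintegral_ofReal (integrableOn_bump p ha),
    ← ENNReal.ofReal_mul (bumpMass_pos p).le]
  · congr 1
    have h2 := integral_comp_mul_left_Ioi (fun r : ℝ => bump (r ^ 2) * r ^ (p - 1)) 0 ha
    simp only [mul_zero, smul_eq_mul] at h2
    have h3 : ∀ r : ℝ, bump ((a * r) ^ 2) * r ^ (p - 1) =
        (a⁻¹) ^ (p - 1) * (bump ((a * r) ^ 2) * (a * r) ^ (p - 1)) := by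
      intro r
      rw [mul_pow a r (p - 1), inv_pow]
      field_simp
    simp_rw [h3]
    rw [integral_const_mul, h2, bumpMass]
    obtain ⟨q, rfl⟩ : ∃ q, p = q + 1 := ⟨p - 1, by omega⟩
    simp only [Nat.add_sub_cancel, pow_succ]
    ring
  · filter_upwards [ae_restrict_mem measurableSet_Ioi] with r hr
    exact mul_nonneg (bump_nonneg _) (pow_nonneg (le_of_lt hr) _)

/-- Polar coordinates for a function of degree zero and the weight `χ(f²)`. -/
theorem lintegral_bump_mul {p : ℕ} (hp : 0 < p) {f : Coord p → ℝ} {k : Coord p → ENNReal}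
    (hf : ∀ s ≠ 0, 0 < f s) (hfh : ∀ s, ∀ c : ℝ, 0 < c → f (c • s) = c * f s)
    (hfc : Continuous fun θ : Metric.sphere (0 : Coord p) 1 => f θ)
    (hk : ∀ s ≠ 0, ∀ c : ℝ, 0 < c → k (c • s) = k s)
    (hkm : Measurable fun θ : Metric.sphere (0 : Coord p) 1 => k θ) :
    ∫⁻ s in ({0}ᶜ : Set (Coord p)), ENNReal.ofReal (bump (f s ^ 2)) * k s =
      ENNReal.ofReal (bumpMass p) * ∫⁻ θ, ENNReal.ofReal (((f (θ : Coord p))⁻¹) ^ p) * k θ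
        ∂(volume : Measure (Coord p)).toSphere := by
  have hmp := (volume : Measure (Coord p)).measurePreserving_homeomorphUnitSphereProd
  have hfr : Module.finrank ℝ (Coord p) = p := by simp
  have hθ : ∀ θ : Metric.sphere (0 : Coord p) 1, (θ : Coord p) ≠ 0 := fun θ =>
    ne_zero_of_mem_unit_sphere θ
  rw [← lintegral_subtype_comap (measurableSet_singleton 0).compl]
  -- Homogeneity separates the variables: f(rθ) = r f(θ), and k depends on θ alone.
  have e1 : ∀ s : ({0}ᶜ : Set (Coord p)), ENNReal.ofReal (bump (f s ^ 2)) * k s =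
      (fun z : Metric.sphere (0 : Coord p) 1 × Ioi (0 : ℝ) =>
        ENNReal.ofReal (bump ((f z.1 * z.2) ^ 2)) * k z.1) (homeomorphUnitSphereProd (Coord p) s) := by
    intro s
    have hs : (s : Coord p) ≠ 0 := s.2
    have hn : 0 < ‖(s : Coord p)‖ := norm_pos_iff.2 hs
    simp only [homeomorphUnitSphereProd_apply_fst_coe, homeomorphUnitSphereProd_apply_snd_coe]
    rw [hfh _ _ (inv_pos.2 hn), hk _ hs _ (inv_pos.2 hn)]
    congr 4
    field_simp
  rw [lintegral_congr e1, hmp.lintegral_comp_emb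
      (homeomorphUnitSphereProd (Coord p)).measurableEmbedding
      (fun z : Metric.sphere (0 : Coord p) 1 × Ioi (0 : ℝ) =>
        ENNReal.ofReal (bump ((f z.1 * z.2) ^ 2)) * k z.1), hfr,
    lintegral_prod]
  · rw [← lintegral_const_mul']
    · refine lintegral_congr fun θ => ?_
      simp only
      rw [lintegral_mul_const'']
      · rw [Measure.volumeIoiPow, lintegral_withDensity_eq_lintegral_mul₀]
        · have := lintegral_subtype_comap (measurableSet_Ioi (a := (0 : ℝ))) (fun r : ℝ => ENNReal.ofReal (r ^ (p - 1)) *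
            ENNReal.ofReal (bump ((f θ * r) ^ 2))) (μ := volume)
          simp only [Pi.mul_apply]
          rw [this]
          simp_rw [mul_comm (ENNReal.ofReal (_ ^ (p - 1)))]
          rw [lintegral_bump_scaled hp (hf _ (hθ θ)), mul_assoc]
        · fun_prop
        · refine (ENNReal.continuous_ofReal.comp (continuous_bump.comp ?_)).measurable.aemeasurable
          fun_prop
      · refine (ENNReal.continuous_ofReal.comp (continuous_bump.comp ?_)).measurable.aemeasurable
        fun_prop
    · exact ENNReal.ofReal_ne_top
  · refine (Measurable.mul ?_ (hkm.comp measurable_fst)).aemeasurable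
    exact (ENNReal.continuous_ofReal.comp (continuous_bump.comp
      (((hfc.comp continuous_fst).mul (continuous_subtype_val.comp continuous_snd)).pow 2))).measurable

end Polar

end FinslerMaps

end

noncomputable section

namespace FinslerMaps

/-! ### The volume of the sphere bundle -/

section SphereVolume

variable {p : ℕ} {M : Type*} [TopologicalSpace M] [ChartedSpace (Coord p) M]

/-- The vector of Finsler norm one in the direction with coordinates `(t, s)`. -/
def normParam (F : TangentBundle (𝓡 p) M → ℝ) (e : OpenPartialHomeomorph M (Coord p))
    (z : Coord p × Coord p) : TangentBundle (𝓡 p) M :=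
  bundleParam e (z.1, (localRep F e z.1 z.2)⁻¹ • z.2)

/-- A Finsler function restricted to a tangent space. -/
def fibreFun (F : TangentBundle (𝓡 p) M → ℝ) (x : M) : Coord p → Coord p → ℝ :=
  fun _ v => F ⟨x, v⟩

/-- The measure of the part of a set of rays lying over the point `x`. -/
def fibreMass (F : TangentBundle (𝓡 p) M → ℝ) (B : Set (TangentBundle (𝓡 p) M)) (x : M) : ENNReal :=
  ∫⁻ v in ({0}ᶜ : Set (Coord p)), ENNReal.ofReal (bump (fibreFun F x 0 v ^ 2)) *
    (ENNReal.ofReal (metricMatrix (fibreFun F x) 0 v).det *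
      B.indicator 1 (⟨x, ((fibreFun F x 0 v)⁻¹ • v : Coord p)⟩ : TangentBundle (𝓡 p) M))

/-- The measure of the part of a set of rays lying over the point with coordinates `t`. -/
def chartFibreMass (F : TangentBundle (𝓡 p) M → ℝ) (e : OpenPartialHomeomorph M (Coord p))
    (B : Set (TangentBundle (𝓡 p) M)) (t : Coord p) : ENNReal :=
  ∫⁻ s in ({0}ᶜ : Set (Coord p)), ENNReal.ofReal (bump (localRep F e t s ^ 2)) *
    (ENNReal.ofReal (metricMatrix (localRep F e) t s).det *
      B.indicator 1 (normParam F e (t, s)))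

theorem normParam_eq (F : TangentBundle (𝓡 p) M → ℝ) (e : OpenPartialHomeomorph M (Coord p))
    (z : Coord p × Coord p) : normParam F e z = ⟨e.symm z.1,
      (localRep F e z.1 z.2)⁻¹ • mfderiv (𝓡 p) (𝓡 p) e.symm z.1 z.2⟩ := by
  change (⟨e.symm z.1, (chartLin e z.1 ((localRep F e z.1 z.2)⁻¹ • z.2) : Coord p)⟩ :
    TangentBundle (𝓡 p) M) = _
  rw [map_smul]
  rfl

variable [IsManifold (𝓡 p) ∞ M] {e e' : OpenPartialHomeomorph M (Coord p)}

/-- The preferred chart at x identifies T_xM linearly with a coordinate fibre, on which the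
structure is known to be smooth. -/
theorem contDiffAt_fibreFun (F : FinslerStructure p M) (x : M) {v : Coord p} (hv : v ≠ 0) :
    ContDiffAt ℝ ∞ (fun v => fibreFun F.toFun x 0 v) v := by
  have he := IsManifold.chart_mem_maximalAtlas (I := 𝓡 p) (n := ∞) x
  set e := chartAt (Coord p) x
  have hx : x ∈ e.source := mem_chart_source _ x
  let A : Coord p →L[ℝ] Coord p := mfderiv (𝓡 p) (𝓡 p) e x
  have hA : A v ≠ 0 := fun h0 => hv
    ((mdifferentiable_of_mem_maximalAtlas he).mfderiv_injective hx (h0.trans (map_zero A).symm))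
  have h1 : (fun v => fibreFun F.toFun x 0 v) = fun v => localRep F.toFun e (e x) (A v) := by
    funext v
    exact (congrArg F.toFun (bundleParam_bundleCoord he (v := ⟨x, v⟩) hx)).symm
  rw [h1]
  have h2 := (isLocalFinsler_localRep he F).smooth.contDiffAt e.open_target (e.map_source hx) hA
  exact h2.comp (f := fun v => (e x, A v)) v (contDiffAt_const.prodMk A.contDiff.contDiffAt)

theorem chartLin_det_ne_zero (he : e ∈ IsManifold.maximalAtlas (𝓡 p) ∞ M) {t : Coord p}
    (ht : t ∈ e.target) : (chartLin e t).det ≠ 0 := by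
  have h1 : LinearMap.ker (chartLin e t : Coord p →ₗ[ℝ] Coord p) = ⊥ :=
    LinearMap.ker_eq_bot.2 (chartLin_injective he ht)
  exact ((LinearMap.isUnit_iff_isUnit_det _).1
    ((LinearMap.isUnit_iff_ker_eq_bot _).2 h1)).ne_zero

/-- Substitute v = As with A the derivative of the inverse chart: det g acquires (det A)² and
Lebesgue measure 1/|det A|. What remains is a fibre mass free of charts, times the factor |det A|
needed on the base. -/
theorem chartFibreMass_eq (he : e ∈ IsManifold.maximalAtlas (𝓡 p) ∞ M)
    (F : FinslerStructure p M) (B : Set (TangentBundle (𝓡 p) M)) {t : Coord p}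
    (ht : t ∈ e.target) : chartFibreMass F.toFun e B t =
      ENNReal.ofReal |(chartLin e t).det| * fibreMass F.toFun B (e.symm t) := by
  set A := chartLin e t with hA
  have hdet : A.det ≠ 0 := chartLin_det_ne_zero he ht
  have hinj : Function.Injective A := chartLin_injective he ht
  have hL : ∀ s, localRep F.toFun e t s = fibreFun F.toFun (e.symm t) 0 (A s) := fun s => rfl
  set G : Coord p → ENNReal := ({0}ᶜ : Set (Coord p)).indicator fun v =>
    ENNReal.ofReal (bump (fibreFun F.toFun (e.symm t) 0 v ^ 2)) *
    (ENNReal.ofReal (metricMatrix (fibreFun F.toFun (e.symm t)) 0 v).det *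
      B.indicator 1 (⟨e.symm t, ((fibreFun F.toFun (e.symm t) 0 v)⁻¹ • v : Coord p)⟩ :
        TangentBundle (𝓡 p) M)) with hG
  have h1 : chartFibreMass F.toFun e B t = ∫⁻ s, ENNReal.ofReal (A.det ^ 2) * G (A s) := by
    rw [chartFibreMass, ← lintegral_indicator (measurableSet_singleton 0).compl]
    refine lintegral_congr fun s => ?_
    by_cases hs : s = 0
    · simp [hs, hG]
    have hAs : A s ≠ 0 := chartLin_ne_zero he ht hs
    rw [hG, indicator_of_mem (s := ({0}ᶜ : Set (Coord p))) hs,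
      indicator_of_mem (s := ({0}ᶜ : Set (Coord p))) hAs]
    have hm : (metricMatrix (localRep F.toFun e) t s).det =
        A.det ^ 2 * (metricMatrix (fibreFun F.toFun (e.symm t)) 0 (A s)).det := by
      rw [metricMatrix_comp_linear (f := fibreFun F.toFun (e.symm t) 0) A
        (k := fibreFun F.toFun (e.symm t)) (t' := 0) hL (fun _ => rfl)
        (contDiffAt_fibreFun F _ hAs), Matrix.det_mul, Matrix.det_mul, Matrix.det_transpose,
        coordMatrix_det]
      ring
    have hn : normParam F.toFun e (t, s) =
        (⟨e.symm t, ((fibreFun F.toFun (e.symm t) 0 (A s))⁻¹ • A s : Coord p)⟩ :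
          TangentBundle (𝓡 p) M) := by
      rw [normParam_eq]; rfl
    rw [hm, hn, ENNReal.ofReal_mul (sq_nonneg _), hL]
    ring
  have hemb : MeasurableEmbedding (A : Coord p → Coord p) :=
    (A : Coord p →ₗ[ℝ] Coord p).continuous_of_finiteDimensional.measurableEmbedding hinj
  have h2 : ∫⁻ s, G (A s) = ENNReal.ofReal |(A.det)⁻¹| * ∫⁻ v, G v := by
    have h3 := Measure.map_linearMap_addHaar_eq_smul_addHaar (volume : Measure (Coord p))
      (f := (A : Coord p →ₗ[ℝ] Coord p)) hdet
    rw [← hemb.lintegral_map]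
    change ∫⁻ v, G v ∂(Measure.map (A : Coord p →ₗ[ℝ] Coord p) volume) = _
    rw [h3, lintegral_smul_measure]
    rfl
  rw [h1, lintegral_const_mul' _ _ ENNReal.ofReal_ne_top, h2, ← mul_assoc,
    ← ENNReal.ofReal_mul (sq_nonneg _), fibreMass,
    ← lintegral_indicator (measurableSet_singleton 0).compl]
  congr 2
  rw [abs_inv, ← sq_abs, sq, mul_assoc, mul_inv_cancel₀ (abs_ne_zero.2 hdet), mul_one]

theorem continuousOn_scale (he : e ∈ IsManifold.maximalAtlas (𝓡 p) ∞ M)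
    (F : FinslerStructure p M) :
    ContinuousOn (fun z : Coord p × Coord p => (z.1, (localRep F.toFun e z.1 z.2)⁻¹ • z.2))
      (e.target ×ˢ {0}ᶜ) := by
  have h := isLocalFinsler_localRep he F
  have hc : ContinuousOn (fun z : Coord p × Coord p => localRep F.toFun e z.1 z.2)
    (e.target ×ˢ {0}ᶜ) := ContDiffOn.continuousOn h.smooth
  exact continuousOn_fst.prodMk
    ((hc.inv₀ fun z hz => (h.pos hz.1 hz.2).ne').smul continuousOn_snd)

theorem scale_mem (he : e ∈ IsManifold.maximalAtlas (𝓡 p) ∞ M)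
    (F : FinslerStructure p M) {z : Coord p × Coord p} (hz : z ∈ e.target ×ˢ ({0}ᶜ : Set (Coord p))) :
    (z.1, (localRep F.toFun e z.1 z.2)⁻¹ • z.2) ∈ e.target ×ˢ ({0}ᶜ : Set (Coord p)) :=
  ⟨hz.1, smul_ne_zero (inv_ne_zero ((isLocalFinsler_localRep he F).pos hz.1 hz.2).ne') hz.2⟩

theorem continuousOn_normParam (he : e ∈ IsManifold.maximalAtlas (𝓡 p) ∞ M)
    (F : FinslerStructure p M) :
    ContinuousOn (normParam F.toFun e) (e.target ×ˢ {0}ᶜ) :=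
  (contMDiffOn_bundleParam he).continuousOn.comp (continuousOn_scale he F)
    fun z hz => ⟨(scale_mem he F hz).1, mem_univ _⟩

theorem normParam_smul (he : e ∈ IsManifold.maximalAtlas (𝓡 p) ∞ M)
    (F : FinslerStructure p M) (t s : Coord p) {c : ℝ} (hc : 0 < c) :
    normParam F.toFun e (t, c • s) = normParam F.toFun e (t, s) := by
  simp only [normParam]
  rw [(isLocalFinsler_localRep he F).homogeneous t s c hc, mul_inv, smul_smul, mul_comm,
    ← mul_assoc, mul_inv_cancel₀ hc.ne', one_mul]

theorem mapsTo_sphere (T : Set (Coord p)) : MapsTo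
    (fun z : Coord p × Metric.sphere (0 : Coord p) 1 => ((z.1, (z.2 : Coord p)) : Coord p × Coord p))
    (T ×ˢ univ) (T ×ˢ {0}ᶜ) := fun z hz => ⟨hz.1, ne_zero_of_mem_unit_sphere z.2⟩

theorem continuous_sphere_incl : Continuous
    (fun z : Coord p × Metric.sphere (0 : Coord p) 1 => ((z.1, (z.2 : Coord p)) : Coord p × Coord p)) := by
  fun_prop

theorem continuous_sphere_slice {X : Type*} [TopologicalSpace X] {f : Coord p × Coord p → X}
    {T : Set (Coord p)} (hf : ContinuousOn f (T ×ˢ {0}ᶜ)) {t : Coord p} (ht : t ∈ T) :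
    Continuous (fun θ : Metric.sphere (0 : Coord p) 1 => f (t, (θ : Coord p))) := by
  have hc : Continuous fun θ : Metric.sphere (0 : Coord p) 1 => (t, (θ : Coord p)) := by fun_prop
  exact hf.comp_continuous hc fun θ => ⟨ht, ne_zero_of_mem_unit_sphere θ⟩

theorem continuousOn_det (he : e ∈ IsManifold.maximalAtlas (𝓡 p) ∞ M) (F : FinslerStructure p M) :
    ContinuousOn (fun z : Coord p × Coord p => (metricMatrix (localRep F.toFun e) z.1 z.2).det)
      (e.target ×ˢ {0}ᶜ) := ContDiffOn.continuousOn (isLocalFinsler_localRep he F).smooth_det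

/-- In polar coordinates the radial integral of χ((Lr)²) r^{p-1} is a constant times L^{-p}. This is
exactly the factor by which det(g/L) differs from det g. -/
theorem localSphereVolume_apply (hp : 0 < p) (he : e ∈ IsManifold.maximalAtlas (𝓡 p) ∞ M)
    (F : FinslerStructure p M) {B : Set (TangentBundle (𝓡 p) M)} (hB : MeasurableSet B) :
    ENNReal.ofReal (bumpMass p) * localSphereVolume F.toFun e B =
      ∫⁻ t in e.target, chartFibreMass F.toFun e B t := by
  have h := isLocalFinsler_localRep he F
  set σ := (volume : Measure (Coord p)).toSphere
  have hprod : ((volume : Measure (Coord p)).restrict e.target).prod σ =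
      ((volume : Measure (Coord p)).prod σ).restrict (e.target ×ˢ univ) := by
    rw [← Measure.prod_restrict, Measure.restrict_univ]
  have hms : MeasurableSet (e.target ×ˢ (univ : Set (Metric.sphere (0 : Coord p) 1))) :=
    e.open_target.measurableSet.prod MeasurableSet.univ
  have hcL : ContinuousOn (fun z : Coord p × Coord p => localRep F.toFun e z.1 z.2)
    (e.target ×ˢ {0}ᶜ) := ContDiffOn.continuousOn h.smooth
  have hdet : ∀ z : Coord p × Metric.sphere (0 : Coord p) 1,
      ((localRep F.toFun e z.1 z.2)⁻¹ • metricMatrix (localRep F.toFun e) z.1 z.2).det =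
      ((localRep F.toFun e z.1 z.2)⁻¹) ^ p * (metricMatrix (localRep F.toFun e) z.1 z.2).det := by
    intro z; rw [Matrix.det_smul, Fintype.card_fin]
  have hdens : AEMeasurable (fun z : Coord p × Metric.sphere (0 : Coord p) 1 =>
      ENNReal.ofReal ((localRep F.toFun e z.1 z.2)⁻¹ •
        metricMatrix (localRep F.toFun e) z.1 z.2).det)
      (((volume : Measure (Coord p)).restrict e.target).prod σ) := by
    simp_rw [hdet]
    rw [hprod]
    refine ContinuousOn.aemeasurable ?_ hms
    refine ENNReal.continuous_ofReal.comp_continuousOn ?_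
    have hc : ContinuousOn (fun z : Coord p × Coord p => ((localRep F.toFun e z.1 z.2)⁻¹) ^ p *
        (metricMatrix (localRep F.toFun e) z.1 z.2).det) (e.target ×ˢ {0}ᶜ) :=
      ((hcL.inv₀ fun z hz => (h.pos hz.1 hz.2).ne').pow p).mul (continuousOn_det he F)
    exact hc.comp continuous_sphere_incl.continuousOn (mapsTo_sphere _)
  have hmap : (fun z : Coord p × Metric.sphere (0 : Coord p) 1 =>
      (⟨e.symm z.1, (localRep F.toFun e z.1 z.2)⁻¹ •
        mfderiv (𝓡 p) (𝓡 p) e.symm z.1 (z.2 : Coord p)⟩ : TangentBundle (𝓡 p) M)) =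
      fun z => normParam F.toFun e (z.1, z.2) := by
    funext z; rw [normParam_eq]
  have hnp : AEMeasurable (fun z : Coord p × Metric.sphere (0 : Coord p) 1 =>
      normParam F.toFun e (z.1, z.2)) (((volume : Measure (Coord p)).restrict e.target).prod σ) := by
    rw [hprod]
    exact ContinuousOn.aemeasurable ((continuousOn_normParam he F).comp
      continuous_sphere_incl.continuousOn (mapsTo_sphere _)) hms
  have hind : Measurable (B.indicator (1 : TangentBundle (𝓡 p) M → ENNReal)) :=
    measurable_one.indicator hB
  have hcomp : AEMeasurable (fun z : Coord p × Metric.sphere (0 : Coord p) 1 =>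
      B.indicator (1 : TangentBundle (𝓡 p) M → ENNReal) (normParam F.toFun e (z.1, z.2)))
      (((volume : Measure (Coord p)).restrict e.target).prod σ) := hind.comp_aemeasurable hnp
  rw [← lintegral_indicator_one hB, localSphereVolume, hmap,
    lintegral_map' hind.aemeasurable (hnp.mono_ac (withDensity_absolutelyContinuous _ _)),
    lintegral_withDensity_eq_lintegral_mul₀ hdens hcomp, lintegral_prod]
  · rw [← lintegral_const_mul' _ _ ENNReal.ofReal_ne_top]
    refine setLIntegral_congr_fun e.open_target.measurableSet fun t ht => ?_
    simp only [Pi.mul_apply]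
    rw [chartFibreMass, lintegral_bump_mul hp (f := localRep F.toFun e t)
      (k := fun s => ENNReal.ofReal (metricMatrix (localRep F.toFun e) t s).det *
        B.indicator 1 (normParam F.toFun e (t, s)))]
    · congr 1
      refine lintegral_congr fun θ => ?_
      rw [show ((localRep F.toFun e t θ)⁻¹ • metricMatrix (localRep F.toFun e) t θ).det = _ from
        hdet (t, θ), ENNReal.ofReal_mul, mul_assoc]
      exact pow_nonneg (inv_nonneg.2 (h.nonneg _ _)) _
    · exact fun s hs => h.pos ht hs
    · exact h.homogeneous t
    · exact continuous_sphere_slice hcL ht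
    · intro s hs c hc
      rw [normParam_smul he F t s hc, metricMatrix_smul hc (h.homogeneous t)]
      have h2 := h.smooth.contDiffAt h.isOpen ht (smul_ne_zero hc.ne' hs)
      exact h2.comp (f := fun s' => (t, s')) (c • s) (contDiffAt_const.prodMk contDiffAt_id)
    · exact (ENNReal.continuous_ofReal.comp (continuous_sphere_slice (continuousOn_det he F) ht)).measurable.mul
        (hind.comp (continuous_sphere_slice (continuousOn_normParam he F) ht).measurable)
  · exact hdens.mul hcomp

end SphereVolume

end FinslerMaps

end

noncomputable section

namespace FinslerMaps

/-! ### Agreement and gluing of the local volumes -/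

section Gluing

variable {p : ℕ} {M : Type*} [TopologicalSpace M] [ChartedSpace (Coord p) M]
  [IsManifold (𝓡 p) ∞ M] {e e' : OpenPartialHomeomorph M (Coord p)}

/-- The part of the tangent bundle lying over a chart domain. -/
def overChart (e : OpenPartialHomeomorph M (Coord p)) : Set (TangentBundle (𝓡 p) M) :=
  Bundle.TotalSpace.proj ⁻¹' e.source

theorem isOpen_overChart (e : OpenPartialHomeomorph M (Coord p)) : IsOpen (overChart e) :=
  e.open_source.preimage (FiberBundle.continuous_proj (Coord p) (TangentSpace (𝓡 p)))

theorem measurableSet_overChart (e : OpenPartialHomeomorph M (Coord p)) :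
    MeasurableSet (overChart e) := (isOpen_overChart e).measurableSet

theorem fibreMass_inter (F : TangentBundle (𝓡 p) M → ℝ) (B : Set (TangentBundle (𝓡 p) M))
    (e : OpenPartialHomeomorph M (Coord p)) (x : M) :
    fibreMass F (B ∩ overChart e) x = e.source.indicator (fibreMass F B) x := by
  by_cases hx : x ∈ e.source
  · rw [indicator_of_mem hx, fibreMass, fibreMass]
    refine lintegral_congr fun v => ?_
    congr 2
    by_cases hB : (⟨x, ((fibreFun F x 0 v)⁻¹ • v : Coord p)⟩ : TangentBundle (𝓡 p) M) ∈ B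
    · rw [indicator_of_mem hB, indicator_of_mem (s := B ∩ overChart e) ⟨hB, hx⟩]
    · rw [indicator_of_notMem hB, indicator_of_notMem fun h => hB h.1]
  · rw [indicator_of_notMem hx, fibreMass]
    have : ∀ v : Coord p, (B ∩ overChart e).indicator (1 : TangentBundle (𝓡 p) M → ENNReal)
        (⟨x, ((fibreFun F x 0 v)⁻¹ • v : Coord p)⟩ : TangentBundle (𝓡 p) M) = 0 :=
      fun v => indicator_of_notMem (fun h => hx h.2) _
    simp [this]

/-- Over an overlap the local volume is an integral over the base of the intrinsic `fibreMass`, so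
only the Jacobian factor still depends on the chart. -/
theorem localSphereVolume_inter (hp : 0 < p) (he : e ∈ IsManifold.maximalAtlas (𝓡 p) ∞ M)
    (F : FinslerStructure p M) {B : Set (TangentBundle (𝓡 p) M)} (hB : MeasurableSet B)
    (e' : OpenPartialHomeomorph M (Coord p)) :
    ENNReal.ofReal (bumpMass p) * localSphereVolume F.toFun e (B ∩ overChart e') =
      ∫⁻ t in e.target ∩ e.symm ⁻¹' e'.source,
        ENNReal.ofReal |(chartLin e t).det| * fibreMass F.toFun B (e.symm t) := by
  have hms : MeasurableSet (e.target ∩ e.symm ⁻¹' e'.source) :=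
    (e.isOpen_inter_preimage_symm e'.open_source).measurableSet
  rw [localSphereVolume_apply hp he F (hB.inter (measurableSet_overChart e')),
    setLIntegral_congr_fun e.open_target.measurableSet
      (fun t ht => chartFibreMass_eq he F (B ∩ overChart e') ht),
    ← lintegral_indicator e.open_target.measurableSet, ← lintegral_indicator hms]
  refine lintegral_congr fun t => ?_
  by_cases ht : t ∈ e.target
  · rw [indicator_of_mem ht, fibreMass_inter]
    by_cases hx : e.symm t ∈ e'.source
    · rw [indicator_of_mem hx, indicator_of_mem (s := e.target ∩ e.symm ⁻¹' e'.source) ⟨ht, hx⟩]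
    · rw [indicator_of_notMem hx, indicator_of_notMem fun h => hx h.2, mul_zero]
  · rw [indicator_of_notMem ht, indicator_of_notMem fun h => ht h.1]

/-- The local volumes agree over the intersection of two chart domains. -/
theorem localSphereVolume_inter_comm (hp : 0 < p) (he : e ∈ IsManifold.maximalAtlas (𝓡 p) ∞ M)
    (he' : e' ∈ IsManifold.maximalAtlas (𝓡 p) ∞ M)
    (F : FinslerStructure p M) {B : Set (TangentBundle (𝓡 p) M)} (hB : MeasurableSet B) :
    localSphereVolume F.toFun e (B ∩ overChart e') =
      localSphereVolume F.toFun e' (B ∩ overChart e) := by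
  have hpos : ENNReal.ofReal (bumpMass p) ≠ 0 := by simpa using bumpMass_pos p
  rw [← ENNReal.mul_right_inj hpos ENNReal.ofReal_ne_top, localSphereVolume_inter hp he F hB e',
    localSphereVolume_inter hp he' F hB e]
  set S := e.target ∩ e.symm ⁻¹' e'.source
  have hS : MeasurableSet S := (e.isOpen_inter_preimage_symm e'.open_source).measurableSet
  have himg : (fun t => e' (e.symm t)) '' S = e'.target ∩ e'.symm ⁻¹' e.source := by
    ext t'
    constructor
    · rintro ⟨t, ⟨ht, ht'⟩, rfl⟩
      exact ⟨e'.map_source ht', by simp only [mem_preimage]; rw [e'.left_inv ht']; exact e.map_target ht⟩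
    · rintro ⟨ht', hx⟩
      exact ⟨e (e'.symm t'), ⟨e.map_source hx, by
        simp only [mem_preimage]; rw [e.left_inv hx]; exact e'.map_target ht'⟩, by
        simp only; rw [e.left_inv hx, e'.right_inv ht']⟩
  have hinj : InjOn (fun t => e' (e.symm t)) S := by
    intro t ht u hu htu
    have h1 := e'.injOn ht.2 hu.2 htu
    exact e.symm.injOn ht.1 hu.1 h1
  -- Change of variables by the transition map. Its Jacobian times |det| of the new chart derivative
  -- is |det| of the old one.
  rw [← himg, lintegral_image_eq_lintegral_abs_det_fderiv_mul volume hS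
    (fun t ht => (chartLin_transition he he' ht.1 ht.2).1.hasFDerivWithinAt) hinj]
  refine setLIntegral_congr_fun hS fun t ht => ?_
  rw [(chartLin_transition he he' ht.1 ht.2).2, e'.left_inv ht.2, ← mul_assoc,
    ← ENNReal.ofReal_mul (abs_nonneg _), ← abs_mul]
  congr 3
  rw [mul_comm]
  exact LinearMap.det_comp _ _

theorem aemeasurable_normParam (he : e ∈ IsManifold.maximalAtlas (𝓡 p) ∞ M)
    (F : FinslerStructure p M) : AEMeasurable (normParam F.toFun e)
      ((volume : Measure (Coord p × Coord p)).restrict (e.target ×ˢ {0}ᶜ)) :=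
  (continuousOn_normParam he F).aemeasurable (isOpen_slit e.open_target).measurableSet

/-- The density of the Liouville measure with the weight `χ(F²)`. -/
def liouvilleDensity (F : TangentBundle (𝓡 p) M → ℝ) (e : OpenPartialHomeomorph M (Coord p))
    (z : Coord p × Coord p) : ℝ :=
  bump (localRep F e z.1 z.2 ^ 2) * (metricMatrix (localRep F e) z.1 z.2).det

theorem continuousOn_liouvilleDensity (he : e ∈ IsManifold.maximalAtlas (𝓡 p) ∞ M)
    (F : FinslerStructure p M) :
    ContinuousOn (liouvilleDensity F.toFun e) (e.target ×ˢ {0}ᶜ) :=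
  (continuous_bump.comp_continuousOn ((ContDiffOn.continuousOn
    (isLocalFinsler_localRep he F).smooth).pow 2)).mul (continuousOn_det he F)

theorem liouvilleDensity_nonneg (he : e ∈ IsManifold.maximalAtlas (𝓡 p) ∞ M)
    (F : FinslerStructure p M) {z : Coord p × Coord p} (hz : z ∈ e.target ×ˢ ({0}ᶜ : Set (Coord p))) :
    0 ≤ liouvilleDensity F.toFun e z :=
  mul_nonneg (bump_nonneg _) ((isLocalFinsler_localRep he F).det_pos hz.1 hz.2).le

/-- The volume of the sphere bundle as a projection of the Liouville measure. -/
theorem bumpMass_smul_localSphereVolume (hp : 0 < p)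
    (he : e ∈ IsManifold.maximalAtlas (𝓡 p) ∞ M) (F : FinslerStructure p M) :
    ENNReal.ofReal (bumpMass p) • localSphereVolume F.toFun e =
      (((volume : Measure (Coord p × Coord p)).restrict (e.target ×ˢ {0}ᶜ)).withDensity
        fun z => ENNReal.ofReal (liouvilleDensity F.toFun e z)).map (normParam F.toFun e) := by
  ext B hB
  have hms := (isOpen_slit e.open_target).measurableSet
  have hnp := aemeasurable_normParam he F
  have hdens : AEMeasurable (fun z => ENNReal.ofReal (liouvilleDensity F.toFun e z))
      ((volume : Measure (Coord p × Coord p)).restrict (e.target ×ˢ {0}ᶜ)) :=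
    (ENNReal.continuous_ofReal.comp_continuousOn
      (continuousOn_liouvilleDensity he F)).aemeasurable hms
  have hind : Measurable (B.indicator (1 : TangentBundle (𝓡 p) M → ENNReal)) :=
    measurable_one.indicator hB
  have hcomp : AEMeasurable (fun z =>
      B.indicator (1 : TangentBundle (𝓡 p) M → ENNReal) (normParam F.toFun e z))
      ((volume : Measure (Coord p × Coord p)).restrict (e.target ×ˢ {0}ᶜ)) :=
    hind.comp_aemeasurable hnp
  have hprod : (volume : Measure (Coord p × Coord p)).restrict (e.target ×ˢ {0}ᶜ) =
      ((volume : Measure (Coord p)).restrict e.target).prod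
        ((volume : Measure (Coord p)).restrict {0}ᶜ) := by
    rw [Measure.prod_restrict]; rfl
  rw [Measure.smul_apply, smul_eq_mul, localSphereVolume_apply hp he F hB,
    ← lintegral_indicator_one hB,
    lintegral_map' hind.aemeasurable (hnp.mono_ac (withDensity_absolutelyContinuous _ _)),
    lintegral_withDensity_eq_lintegral_mul₀ hdens hcomp, hprod, lintegral_prod]
  · refine lintegral_congr fun t => ?_
    rw [chartFibreMass]
    refine lintegral_congr fun s => ?_
    simp only [Pi.mul_apply, liouvilleDensity]
    rw [ENNReal.ofReal_mul (bump_nonneg _), mul_assoc]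
  · rw [← hprod]; exact hdens.mul hcomp

theorem localSphereVolume_compl (hp : 0 < p) (he : e ∈ IsManifold.maximalAtlas (𝓡 p) ∞ M)
    (F : FinslerStructure p M) : localSphereVolume F.toFun e (overChart e)ᶜ = 0 := by
  have hpos : ENNReal.ofReal (bumpMass p) ≠ 0 := by simpa using bumpMass_pos p
  have h1 := localSphereVolume_apply hp he F (measurableSet_overChart e).compl
  rw [setLIntegral_congr_fun e.open_target.measurableSet (g := fun _ => 0)] at h1
  · simpa [hpos] using h1
  · intro t ht
    rw [chartFibreMass]
    have : ∀ s, (overChart e)ᶜ.indicator (1 : TangentBundle (𝓡 p) M → ENNReal)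
        (normParam F.toFun e (t, s)) = 0 := fun s =>
      indicator_of_notMem (s := (overChart e)ᶜ) (fun h => h (e.map_target ht)) _
    simp [this]

/-- Over a chart domain the volume of the sphere bundle is the local volume. -/
theorem sphereVolume_restrict (hp : 0 < p) (he : e ∈ IsManifold.maximalAtlas (𝓡 p) ∞ M)
    (F : FinslerStructure p M) :
    (sphereVolume F.toFun).restrict (overChart e) = localSphereVolume F.toFun e := by
  have hU := measurableSet_overChart e
  have hself : (localSphereVolume F.toFun e).restrict (overChart e) = localSphereVolume F.toFun e :=
    Measure.restrict_eq_self_of_ae_mem (localSphereVolume_compl hp he F)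
  apply le_antisymm
  -- To bound a supremum of measures, one common upper bound is enough. Each local volume is at most
  -- the volume of e over the chart domain plus the restriction of the supremum to the complement,
  -- and restricting this bound to the domain removes the second summand.
  · have h1 : sphereVolume F.toFun ≤ localSphereVolume F.toFun e +
        (sphereVolume F.toFun).restrict (overChart e)ᶜ := by
      refine iSup₂_le fun e' he' => ?_
      rw [← Measure.restrict_add_restrict_compl (μ := localSphereVolume F.toFun e') hU]
      refine add_le_add ?_ (Measure.restrict_mono le_rfl ?_)
      · refine Measure.le_iff.2 fun B hB => ?_
        rw [Measure.restrict_apply hB, localSphereVolume_inter_comm hp he' he F hB]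
        exact measure_mono inter_subset_left
      · exact le_iSup₂ (f := fun e (_ : e ∈ IsManifold.maximalAtlas (𝓡 p) ∞ M) =>
          localSphereVolume F.toFun e) e' he'
    have h2 := Measure.restrict_mono (le_refl (overChart e)) h1
    rw [Measure.restrict_add, Measure.restrict_restrict hU, inter_compl_self,
      Measure.restrict_empty, add_zero, hself] at h2
    exact h2
  · rw [← hself]
    exact Measure.restrict_mono le_rfl (le_iSup₂ (f := fun e
      (_ : e ∈ IsManifold.maximalAtlas (𝓡 p) ∞ M) => localSphereVolume F.toFun e) e he)

/-- A compact set of coordinates `(t, s)` with `1 ≤ L² ≤ 2`. -/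
theorem IsLocalFinsler.isCompact_shell {L : Coord p → Coord p → ℝ} {T C : Set (Coord p)}
    (h : IsLocalFinsler L T) (hC : IsCompact C) (hCT : C ⊆ T) :
    IsCompact {z : Coord p × Coord p | z.1 ∈ C ∧ z.2 ≠ 0 ∧ L z.1 z.2 ^ 2 ∈ Icc (1 : ℝ) 2} := by
  have hcL : ContinuousOn (fun z : Coord p × Coord p => L z.1 z.2) (T ×ˢ {0}ᶜ) :=
    ContDiffOn.continuousOn h.smooth
  have hK : IsCompact (C ×ˢ Metric.sphere (0 : Coord p) 1) := hC.prod (isCompact_sphere _ _)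
  have hKs : C ×ˢ Metric.sphere (0 : Coord p) 1 ⊆ T ×ˢ {0}ᶜ := fun z hz =>
    ⟨hCT hz.1, fun h0 => by
      have h1 := hz.2
      rw [mem_singleton_iff.1 h0] at h1
      simp at h1⟩
  rcases (C ×ˢ Metric.sphere (0 : Coord p) 1).eq_empty_or_nonempty with hemp | hne
  · convert isCompact_empty
    refine eq_empty_of_forall_notMem fun z hz => ?_
    have : (z.1, ‖z.2‖⁻¹ • z.2) ∈ C ×ˢ Metric.sphere (0 : Coord p) 1 :=
      ⟨hz.1, by simp [norm_smul, hz.2.1]⟩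
    rw [hemp] at this
    exact this
  obtain ⟨z₁, hz₁, hmin⟩ := hK.exists_isMinOn hne (hcL.mono hKs)
  obtain ⟨z₂, hz₂, hmax⟩ := hK.exists_isMaxOn hne (hcL.mono hKs)
  set a := L z₁.1 z₁.2
  set b := L z₂.1 z₂.2
  have ha : 0 < a := h.pos (hKs hz₁).1 (hKs hz₁).2
  have hb : 0 < b := h.pos (hKs hz₂).1 (hKs hz₂).2
  -- The extrema a and b of L over C times the unit sphere make L comparable to the Euclidean norm.
  -- Hence 1 ≤ L² ≤ 2 keeps s in the annulus 1/b ≤ ‖s‖ ≤ 2/a, away from zero and infinity.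
  have hbd : ∀ z : Coord p × Coord p, z.1 ∈ C → z.2 ≠ 0 →
      a * ‖z.2‖ ≤ L z.1 z.2 ∧ L z.1 z.2 ≤ b * ‖z.2‖ := by
    intro z hz hs
    have hn : 0 < ‖z.2‖ := norm_pos_iff.2 hs
    have hm : (z.1, ‖z.2‖⁻¹ • z.2) ∈ C ×ˢ Metric.sphere (0 : Coord p) 1 :=
      ⟨hz, by simp [norm_smul, hs]⟩
    have h1 : L z.1 z.2 = ‖z.2‖ * L z.1 (‖z.2‖⁻¹ • z.2) := by
      rw [h.homogeneous _ _ _ (inv_pos.2 hn), ← mul_assoc, mul_inv_cancel₀ hn.ne', one_mul]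
    have h2 : a ≤ L z.1 (‖z.2‖⁻¹ • z.2) := hmin hm
    have h3 : L z.1 (‖z.2‖⁻¹ • z.2) ≤ b := hmax hm
    rw [h1]
    constructor <;> nlinarith
  set K' : Set (Coord p × Coord p) :=
    C ×ˢ (Metric.closedBall (0 : Coord p) (2 / a) ∩ {s | b⁻¹ ≤ ‖s‖})
  have hK' : IsCompact K' := hC.prod ((isCompact_closedBall _ _).inter_right
    (isClosed_le continuous_const continuous_norm))
  have hK's : K' ⊆ T ×ˢ {0}ᶜ := fun z hz => ⟨hCT hz.1, fun h0 => by
    have h1 : b⁻¹ ≤ ‖z.2‖ := hz.2.2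
    rw [mem_singleton_iff.1 h0, norm_zero] at h1
    exact absurd h1 (not_le.2 (inv_pos.2 hb))⟩
  have heq : {z : Coord p × Coord p | z.1 ∈ C ∧ z.2 ≠ 0 ∧ L z.1 z.2 ^ 2 ∈ Icc (1 : ℝ) 2} =
      K' ∩ (fun z : Coord p × Coord p => L z.1 z.2 ^ 2) ⁻¹' Icc (1 : ℝ) 2 := by
    ext z
    constructor
    · rintro ⟨hz, hs, hL⟩
      obtain ⟨h1, h2⟩ := hbd z hz hs
      have hpos := h.pos (hCT hz) hs
      have h3 : 1 ≤ L z.1 z.2 := by nlinarith [hL.1]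
      have h4 : L z.1 z.2 ≤ 2 := by nlinarith [hL.2]
      refine ⟨⟨hz, ?_, ?_⟩, hL⟩
      · rw [mem_closedBall_zero_iff, le_div_iff₀ ha]; linarith
      · rw [mem_ofPred_eq, inv_le_iff_one_le_mul₀ hb]; linarith
    · rintro ⟨hz, hL⟩
      exact ⟨hz.1, (hK's hz).2, hL⟩
  rw [heq]
  exact hK'.of_isClosed_subset (((hcL.mono hK's).pow 2).preimage_isClosed_of_isClosed
    hK'.isClosed isClosed_Icc) inter_subset_left

end Gluing

end FinslerMaps

end

noncomputable section

namespace FinslerMaps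

/-! ### Integrals over the sphere bundle as integrals over the slit tangent bundle -/

section IntegralFormula

variable {p : ℕ} {M : Type*} [TopologicalSpace M] [ChartedSpace (Coord p) M]
  [IsManifold (𝓡 p) ∞ M] {e e' : OpenPartialHomeomorph M (Coord p)}

theorem bundleCoord_snd_eq_zero_iff (he : e ∈ IsManifold.maximalAtlas (𝓡 p) ∞ M)
    {v : TangentBundle (𝓡 p) M} (hv : v.proj ∈ e.source) :
    (bundleCoord e v).2 = 0 ↔ v.2 = 0 := by
  constructor
  · intro h
    exact (mdifferentiable_of_mem_maximalAtlas he).mfderiv_injective hv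
      (h.trans (map_zero (mfderiv (𝓡 p) (𝓡 p) e v.proj)).symm)
  · intro h
    change mfderiv (𝓡 p) (𝓡 p) e v.proj v.2 = 0
    rw [h]
    exact map_zero _

theorem isOpen_slit_overChart (he : e ∈ IsManifold.maximalAtlas (𝓡 p) ∞ M) :
    IsOpen {v : TangentBundle (𝓡 p) M | v ∈ overChart e ∧ v.2 ≠ 0} := by
  have h1 := (contMDiffOn_bundleCoord he).continuousOn.isOpen_inter_preimage (isOpen_overChart e)
    (isOpen_slit (T := (univ : Set (Coord p))) isOpen_univ)
  convert h1 using 1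
  ext v
  simp only [mem_ofPred_eq, mem_inter_iff, mem_preimage, mem_prod, mem_univ, true_and]
  refine and_congr_right fun hv => ?_
  rw [mem_compl_iff, mem_singleton_iff, bundleCoord_snd_eq_zero_iff he hv]

/-- Integration over the sphere bundle of a function supported over a chart domain. -/
theorem integral_sphereVolume (hp : 0 < p) (he : e ∈ IsManifold.maximalAtlas (𝓡 p) ∞ M)
    (F : FinslerStructure p M) {C : Set (Coord p)} (hC : IsCompact C) (hCT : C ⊆ e.target)
    {h : TangentBundle (𝓡 p) M → ℝ}
    (hc : ContinuousOn (fun z => h (bundleParam e z)) (e.target ×ˢ {0}ᶜ))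
    (h0 : ∀ v, v.proj ∉ e.symm '' C → h v = 0) :
    Integrable h (sphereVolume F.toFun) ∧
      bumpMass p * ∫ v, h v ∂(sphereVolume F.toFun) =
        ∫ z in e.target ×ˢ {0}ᶜ, liouvilleDensity F.toFun e z * h (normParam F.toFun e z) := by
  have hF := isLocalFinsler_localRep he F
  have hΩ := isOpen_slit (p := p) e.open_target
  have hpos : ENNReal.ofReal (bumpMass p) ≠ 0 := by simpa using bumpMass_pos p
  set m := (volume : Measure (Coord p × Coord p)).restrict (e.target ×ˢ {0}ᶜ) with hm
  set w : Coord p × Coord p → ENNReal := fun z => ENNReal.ofReal (liouvilleDensity F.toFun e z)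
    with hw
  have hnp := aemeasurable_normParam he F
  have hnp' : AEMeasurable (normParam F.toFun e) (m.withDensity w) :=
    hnp.mono_ac (withDensity_absolutelyContinuous _ _)
  have hdens : AEMeasurable w m := (ENNReal.continuous_ofReal.comp_continuousOn
      (continuousOn_liouvilleDensity he F)).aemeasurable hΩ.measurableSet
  have hν := bumpMass_smul_localSphereVolume hp he F
  -- measurability
  set V := {v : TangentBundle (𝓡 p) M | v ∈ overChart e ∧ v.2 ≠ 0} with hV
  have hVo : IsOpen V := isOpen_slit_overChart he
  have hcV : ContinuousOn h V := by
    have h1 : ContinuousOn (fun v => h (bundleParam e (bundleCoord e v))) V :=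
      hc.comp ((contMDiffOn_bundleCoord he).continuousOn.mono fun v hv => hv.1) fun v hv =>
        ⟨e.map_source hv.1, fun h2 => hv.2 ((bundleCoord_snd_eq_zero_iff he hv.1).1 h2)⟩
    exact h1.congr fun v hv =>
      (congrArg h (bundleParam_bundleCoord he hv.1)).symm
  have hmem : ∀ z ∈ e.target ×ˢ ({0}ᶜ : Set (Coord p)), normParam F.toFun e z ∈ V := fun z hz =>
    ⟨e.map_target hz.1, chartLin_ne_zero he hz.1 (scale_mem he F hz).2⟩
  have haem : ∀ᵐ v ∂((m.withDensity w).map (normParam F.toFun e)), v ∈ V := by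
    rw [ae_map_iff (p := fun v => v ∈ V) hnp' hVo.measurableSet]
    refine (withDensity_absolutelyContinuous m w).ae_le ?_
    filter_upwards [ae_restrict_mem hΩ.measurableSet] with z hz using hmem z hz
  have hsm : AEStronglyMeasurable h ((m.withDensity w).map (normParam F.toFun e)) := by
    rw [← Measure.restrict_eq_self_of_ae_mem haem]
    exact (hcV.aemeasurable hVo.measurableSet).aestronglyMeasurable
  -- integrability in coordinates
  have htoReal : ∀ z ∈ e.target ×ˢ ({0}ᶜ : Set (Coord p)), (w z).toReal • h (normParam F.toFun e z) =
      liouvilleDensity F.toFun e z * h (normParam F.toFun e z) := fun z hz => by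
    rw [hw, ENNReal.toReal_ofReal (liouvilleDensity_nonneg he F hz), smul_eq_mul]
  have hcz : ContinuousOn (fun z => liouvilleDensity F.toFun e z * h (normParam F.toFun e z))
      (e.target ×ˢ {0}ᶜ) :=
    (continuousOn_liouvilleDensity he F).mul (hcV.comp (continuousOn_normParam he F) hmem)
  -- The integrand lives on a compact set: h confines t to C, and the bump function confines F² to
  -- [1, 2].
  have hK := hF.isCompact_shell hC hCT
  have hiz : IntegrableOn (fun z => liouvilleDensity F.toFun e z * h (normParam F.toFun e z))
      (e.target ×ˢ {0}ᶜ) := by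
    rw [← integrable_indicator_iff hΩ.measurableSet]
    refine integrable_of_zero_off_compact hΩ (hcz.congr fun z hz => indicator_of_mem hz _) hK
      (fun z hz => ⟨hCT hz.1, hz.2.1⟩) fun z hz => ?_
    by_cases hz' : z ∈ e.target ×ˢ ({0}ᶜ : Set (Coord p))
    swap
    · exact indicator_of_notMem hz' _
    rw [indicator_of_mem hz']
    by_cases hzC : z.1 ∈ C
    · have : bump (localRep F.toFun e z.1 z.2 ^ 2) = 0 :=
        bump_eq_zero fun h2 => hz ⟨hzC, hz'.2, Ioo_subset_Icc_self h2⟩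
      simp [liouvilleDensity, this]
    · have : h (normParam F.toFun e z) = 0 := by
        refine h0 _ ?_
        rintro ⟨t, ht, htz⟩
        apply hzC
        rwa [← e.symm.injOn (hCT ht) hz'.1 htz]
      simp [this]
  have hi1 : Integrable h ((m.withDensity w).map (normParam F.toFun e)) := by
    rw [integrable_map_measure hsm hnp', integrable_withDensity_iff_integrable_smul₀' hdens
      (Filter.Eventually.of_forall fun z => ENNReal.ofReal_lt_top)]
    refine hiz.congr ?_
    filter_upwards [ae_restrict_mem hΩ.measurableSet] with z hz using (htoReal z hz).symm
  have hi2 : Integrable h (localSphereVolume F.toFun e) := by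
    rw [← hν] at hi1
    exact (integrable_smul_measure hpos ENNReal.ofReal_ne_top).1 hi1
  have hsupp : ∀ v, v ∉ overChart e → h v = 0 := fun v hv => h0 v (by
    rintro ⟨t, ht, htv⟩
    exact hv (by rw [overChart, mem_preimage, ← htv]; exact e.map_target (hCT ht)))
  rw [← sphereVolume_restrict hp he F] at hi2
  refine ⟨(integrableOn_iff_integrable_of_support_subset
    (fun v hv => by_contra fun h2 => hv (hsupp v h2))).1 hi2, ?_⟩
  rw [← setIntegral_eq_integral_of_forall_compl_eq_zero (s := overChart e) hsupp,
    sphereVolume_restrict hp he F]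
  have h3 : ∫ v, h v ∂(ENNReal.ofReal (bumpMass p) • localSphereVolume F.toFun e) =
      bumpMass p * ∫ v, h v ∂(localSphereVolume F.toFun e) := by
    rw [integral_smul_measure, ENNReal.toReal_ofReal (bumpMass_pos p).le, smul_eq_mul]
  rw [← h3, hν, integral_map hnp' hsm, integral_withDensity_eq_integral_toReal_smul₀ hdens
    (Filter.Eventually.of_forall fun z => ENNReal.ofReal_lt_top)]
  exact setIntegral_congr_fun hΩ.measurableSet htoReal

end IntegralFormula

/-! ### The energy density -/

section Density

variable {p n : ℕ} {M N : Type*} [TopologicalSpace M] [ChartedSpace (Coord p) M]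
  [TopologicalSpace N] [ChartedSpace (Coord n) N]

/-- The pull-back of a function on the tangent bundle. -/
def pull (F' : TangentBundle (𝓡 n) N → ℝ) (φ : M → N) (v : TangentBundle (𝓡 p) M) : ℝ :=
  F' (tangentMap (𝓡 p) (𝓡 n) φ v)

/-- The sum is the trace of (BᵀGB)⁻¹(BᵀHB)ᵀ = B⁻¹G⁻¹HᵀB, and the trace is invariant under
conjugation. -/
theorem sum_inv_mul_congruence {G H B : Matrix (Fin p) (Fin p) ℝ} (hB : B.det ≠ 0) :
    ∑ α, ∑ β, (B.transpose * G * B)⁻¹ α β * (B.transpose * H * B) α β =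
      ∑ α, ∑ β, G⁻¹ α β * H α β := by
  have key : ∀ P Q : Matrix (Fin p) (Fin p) ℝ,
      ∑ α, ∑ β, P α β * Q α β = (P * Q.transpose).trace := by
    intro P Q
    simp [Matrix.trace, Matrix.mul_apply]
  rw [key, key, Matrix.mul_inv_rev, Matrix.mul_inv_rev, Matrix.transpose_mul, Matrix.transpose_mul,
    Matrix.transpose_transpose]
  have hB' : IsUnit B.det := hB.isUnit
  have hBt : IsUnit B.transpose.det := by rwa [Matrix.det_transpose]
  have e1 : B⁻¹ * (G⁻¹ * B.transpose⁻¹) * (B.transpose * (H.transpose * B)) =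
      B⁻¹ * (G⁻¹ * H.transpose * B) := by
    calc _ = B⁻¹ * G⁻¹ * (B.transpose⁻¹ * B.transpose) * H.transpose * B := by
          simp only [Matrix.mul_assoc]
      _ = _ := by rw [Matrix.nonsing_inv_mul _ hBt]; simp only [Matrix.mul_assoc, Matrix.mul_one]
  rw [e1, Matrix.trace_mul_comm, Matrix.mul_assoc, Matrix.mul_nonsing_inv _ hB', Matrix.mul_one]

theorem d1_eq {φ : Coord p → Coord n} {t : Coord p} (h : DifferentiableAt ℝ φ t) (i : Fin n)
    (α : Fin p) : d1 φ i α t = fderiv ℝ φ t (EuclideanSpace.single α 1) i := by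
  unfold d1
  have h1 : HasFDerivAt (fun t' => φ t' i)
      ((EuclideanSpace.proj i : Coord n →L[ℝ] ℝ).comp (fderiv ℝ φ t)) t :=
    (EuclideanSpace.proj i : Coord n →L[ℝ] ℝ).hasFDerivAt.comp t h.hasFDerivAt
  rw [h1.fderiv]
  rfl

theorem push_eq {φ : Coord p → Coord n} {t : Coord p} (h : DifferentiableAt ℝ φ t) (s : Coord p) :
    push φ t s = fderiv ℝ φ t s := by
  ext i
  rw [push_apply]
  conv_rhs => rw [← sum_smul_single s]
  simp_rw [d1_eq h]
  simp [mul_comm]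

variable [IsManifold (𝓡 p) ∞ M] [IsManifold (𝓡 n) ∞ N] {e : OpenPartialHomeomorph M (Coord p)}
  {e' : OpenPartialHomeomorph N (Coord n)} {φ : M → N} {t s : Coord p}

theorem differentiableAt_localMap (he : e ∈ IsManifold.maximalAtlas (𝓡 p) ∞ M)
    (he' : e' ∈ IsManifold.maximalAtlas (𝓡 n) ∞ N) (ht : t ∈ e.target)
    (hx : φ (e.symm t) ∈ e'.source) (hφ : MDifferentiableAt (𝓡 p) (𝓡 n) φ (e.symm t)) :
    DifferentiableAt ℝ (localMap φ e e') t := by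
  have h1 := (mdifferentiable_of_mem_maximalAtlas he).mdifferentiableAt_symm ht
  have h2 := (mdifferentiable_of_mem_maximalAtlas he').mdifferentiableAt hx
  exact mdifferentiableAt_iff_differentiableAt.1 (h2.comp t (hφ.comp t h1))

theorem fderiv_localMap (he : e ∈ IsManifold.maximalAtlas (𝓡 p) ∞ M)
    (he' : e' ∈ IsManifold.maximalAtlas (𝓡 n) ∞ N) (ht : t ∈ e.target)
    (hx : φ (e.symm t) ∈ e'.source) (hφ : MDifferentiableAt (𝓡 p) (𝓡 n) φ (e.symm t)) :
    (fderiv ℝ (localMap φ e e') t s : Coord n) =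
      mfderiv (𝓡 n) (𝓡 n) e' (φ (e.symm t)) (mfderiv (𝓡 p) (𝓡 n) φ (e.symm t) (chartLin e t s)) := by
  have h1 := (mdifferentiable_of_mem_maximalAtlas he).mdifferentiableAt_symm ht
  have h2 := (mdifferentiable_of_mem_maximalAtlas he').mdifferentiableAt hx
  have h3 := mfderiv_comp t (I := 𝓡 p) (I' := 𝓡 n) (I'' := 𝓡 n) h2 (hφ.comp t h1)
  rw [mfderiv_comp t hφ h1, mfderiv_eq_fderiv] at h3
  change (fderiv ℝ (e' ∘ φ ∘ e.symm) t) s = _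
  rw [h3]
  rfl

/-- The pulled back function in induced coordinates. -/
theorem localRep_pull (he : e ∈ IsManifold.maximalAtlas (𝓡 p) ∞ M)
    (he' : e' ∈ IsManifold.maximalAtlas (𝓡 n) ∞ N) (ht : t ∈ e.target)
    (hx : φ (e.symm t) ∈ e'.source) (hφ : MDifferentiableAt (𝓡 p) (𝓡 n) φ (e.symm t))
    (F' : TangentBundle (𝓡 n) N → ℝ) :
    localRep (pull F' φ) e t s =
      localRep F' e' (localMap φ e e' t) (fderiv ℝ (localMap φ e e') t s) := by
  rw [fderiv_localMap he he' ht hx hφ]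
  exact congrArg F' (bundleParam_bundleCoord he' (v := tangentMap (𝓡 p) (𝓡 n) φ
    (bundleParam e (t, s))) hx).symm

/-- On a fibre the pulled-back function is F' after the linear map dφ, so its fundamental tensor is
g'_{ij} φ^i_α φ^j_β. The energy density thus becomes a fibrewise elliptic expression in u², to which
the divergence theorem applies. -/
theorem localEnergyDensity_eq (he : e ∈ IsManifold.maximalAtlas (𝓡 p) ∞ M)
    (he' : e' ∈ IsManifold.maximalAtlas (𝓡 n) ∞ N) (ht : t ∈ e.target)
    (hx : φ (e.symm t) ∈ e'.source) (hφ : MDifferentiableAt (𝓡 p) (𝓡 n) φ (e.symm t))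
    (F : TangentBundle (𝓡 p) M → ℝ) (F' : FinslerStructure n N)
    (hs : fderiv ℝ (localMap φ e e') t s ≠ 0) :
    localEnergyDensity (localRep F e) (localRep F'.toFun e') (localMap φ e e') t s =
      (1 / 2) * ∑ α, ∑ β, invMetric (localRep F e) α β t s *
        metric (localRep (pull F'.toFun φ) e) α β t s := by
  have hd := differentiableAt_localMap he he' ht hx hφ
  have hF' := isLocalFinsler_localRep he' F'
  have h1 := hF'.smooth.contDiffAt hF'.isOpen (e'.map_source hx) hs
  have h2 : ContDiffAt ℝ ∞ (localRep F'.toFun e' (localMap φ e e' t))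
      (fderiv ℝ (localMap φ e e') t s) :=
    h1.comp (f := fun y => (localMap φ e e' t, y)) _ (contDiffAt_const.prodMk contDiffAt_id)
  have h3 := metricMatrix_comp_linear (fderiv ℝ (localMap φ e e') t)
    (h := localRep (pull F'.toFun φ) e) (k := localRep F'.toFun e') (t' := localMap φ e e' t)
    (fun s => localRep_pull he he' ht hx hφ F'.toFun) (fun _ => rfl) h2
  unfold localEnergyDensity
  congr 1
  refine Finset.sum_congr rfl fun α _ => Finset.sum_congr rfl fun β _ => ?_
  rw [show metric (localRep (pull F'.toFun φ) e) α β t s =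
    metricMatrix (localRep (pull F'.toFun φ) e) t s α β from rfl, h3, push_eq hd]
  simp only [Matrix.mul_apply, Matrix.transpose_apply, coordMatrix, Matrix.of_apply, d1_eq hd,
    metricMatrix, Finset.sum_mul, Finset.mul_sum]
  rw [Finset.sum_comm]
  exact Finset.sum_congr rfl fun _ _ => Finset.sum_congr rfl fun _ _ => by ring

end Density

end FinslerMaps

end

noncomputable section

namespace FinslerMaps

/-! ### Chart independence of the energy density -/

section FibreDensity

variable {p n : ℕ} {M N : Type*} [TopologicalSpace M] [ChartedSpace (Coord p) M]
  [TopologicalSpace N] [ChartedSpace (Coord n) N]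
  [IsManifold (𝓡 p) ∞ M] [IsManifold (𝓡 n) ∞ N] {e : OpenPartialHomeomorph M (Coord p)}
  {φ : M → N} {t s : Coord p}

/-- The trace of one fundamental tensor with respect to another one does not depend on the chart. -/
theorem trace_localRep_eq (he : e ∈ IsManifold.maximalAtlas (𝓡 p) ∞ M) (ht : t ∈ e.target)
    {F G : TangentBundle (𝓡 p) M → ℝ}
    (hF : ContDiffAt ℝ ∞ (fun v => fibreFun F (e.symm t) 0 v) (chartLin e t s))
    (hG : ContDiffAt ℝ ∞ (fun v => fibreFun G (e.symm t) 0 v) (chartLin e t s)) :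
    ∑ α, ∑ β, invMetric (localRep F e) α β t s * metric (localRep G e) α β t s =
      ∑ α, ∑ β, invMetric (fibreFun F (e.symm t)) α β 0 (chartLin e t s) *
        metric (fibreFun G (e.symm t)) α β 0 (chartLin e t s) := by
  have h1 := metricMatrix_comp_linear (f := fibreFun F (e.symm t) 0) (chartLin e t)
    (h := localRep F e) (k := fibreFun F (e.symm t)) (t := t) (t' := 0) (fun _ => rfl)
    (fun _ => rfl) hF
  have h2 := metricMatrix_comp_linear (f := fibreFun G (e.symm t) 0) (chartLin e t)
    (h := localRep G e) (k := fibreFun G (e.symm t)) (t := t) (t' := 0) (fun _ => rfl)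
    (fun _ => rfl) hG
  have h3 := sum_inv_mul_congruence (G := metricMatrix (fibreFun F (e.symm t)) 0 (chartLin e t s))
    (H := metricMatrix (fibreFun G (e.symm t)) 0 (chartLin e t s)) (B := coordMatrix (chartLin e t))
    (by rw [coordMatrix_det]; exact chartLin_det_ne_zero he ht)
  rw [← h1, ← h2] at h3
  exact h3

theorem contDiffAt_fibreFun_pull (F' : FinslerStructure n N) {x : M} {v : Coord p}
    (hv : mfderiv (𝓡 p) (𝓡 n) φ x v ≠ 0) :
    ContDiffAt ℝ ∞ (fun v => fibreFun (pull F'.toFun φ) x 0 v) v := by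
  let A : Coord p →L[ℝ] Coord n := mfderiv (𝓡 p) (𝓡 n) φ x
  exact (contDiffAt_fibreFun F' (φ x) (v := A v) hv).comp v A.contDiff.contDiffAt

/-- The density is defined through preferred charts, which may jump from point to point. Expressing
it on the tangent space itself removes them and allows passage to any other chart. -/
theorem energyDensity_eq_fibre (F : FinslerStructure p M) (F' : FinslerStructure n N) {x : M}
    {v : Coord p} (hφ : MDifferentiableAt (𝓡 p) (𝓡 n) φ x) (h0 : v ≠ 0)
    (hv : mfderiv (𝓡 p) (𝓡 n) φ x v ≠ 0) :
    energyDensity F.toFun F'.toFun φ ⟨x, v⟩ =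
      (1 / 2) * ∑ α, ∑ β, invMetric (fibreFun F.toFun x) α β 0 v *
        metric (fibreFun (pull F'.toFun φ) x) α β 0 v := by
  have he := IsManifold.chart_mem_maximalAtlas (I := 𝓡 p) (n := ∞) x
  have he' := IsManifold.chart_mem_maximalAtlas (I := 𝓡 n) (n := ∞) (φ x)
  unfold energyDensity
  simp only
  set e := chartAt (Coord p) x with hedef
  set e' := chartAt (Coord n) (φ x) with hedef'
  have hx : x ∈ e.source := mem_chart_source _ x
  have hx' : φ x ∈ e'.source := mem_chart_source _ (φ x)
  have hsx : e.symm (e x) = x := e.left_inv hx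
  let A : Coord p →L[ℝ] Coord p := mfderiv (𝓡 p) (𝓡 p) e x
  change localEnergyDensity (localRep F.toFun e) (localRep F'.toFun e') (localMap φ e e')
    (e x) (A v) = _
  have hlin : chartLin e (e x) (A v) = v :=
    congrArg (fun A : Coord p →L[ℝ] Coord p => A v)
      ((mdifferentiable_of_mem_maximalAtlas he).symm_comp_deriv hx)
  generalize A v = s at hlin ⊢
  have hφ' : MDifferentiableAt (𝓡 p) (𝓡 n) φ (e.symm (e x)) := by rwa [hsx]
  have hxs : φ (e.symm (e x)) ∈ e'.source := by rwa [hsx]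
  have hs : fderiv ℝ (localMap φ e e') (e x) s ≠ 0 := by
    rw [fderiv_localMap he he' (e.map_source hx) hxs hφ', hlin]
    have : ∀ y : M, y = x → (mfderiv (𝓡 n) (𝓡 n) e' (φ y) (mfderiv (𝓡 p) (𝓡 n) φ y v) : Coord n) ≠ 0 := by
      rintro _ rfl h
      exact hv ((mdifferentiable_of_mem_maximalAtlas he').mfderiv_injective hx'
        (h.trans (map_zero (mfderiv (𝓡 n) (𝓡 n) e' (φ _))).symm))
    exact this _ hsx
  rw [localEnergyDensity_eq he he' (e.map_source hx) hxs hφ' F.toFun F' hs,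
    trace_localRep_eq he (e.map_source hx)]
  · rw [hlin, hsx]
  · rw [hlin, hsx]; exact contDiffAt_fibreFun F x h0
  · rw [hlin, hsx]; exact contDiffAt_fibreFun_pull F' hv

/-- The energy density in an arbitrary chart. -/
theorem energyDensity_bundleParam (he : e ∈ IsManifold.maximalAtlas (𝓡 p) ∞ M)
    (ht : t ∈ e.target) (hs : s ≠ 0) (F : FinslerStructure p M) (F' : FinslerStructure n N)
    (hφ : MDifferentiableAt (𝓡 p) (𝓡 n) φ (e.symm t))
    (hv : mfderiv (𝓡 p) (𝓡 n) φ (e.symm t) (chartLin e t s) ≠ 0) :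
    energyDensity F.toFun F'.toFun φ (bundleParam e (t, s)) =
      (1 / 2) * ∑ α, ∑ β, invMetric (localRep F.toFun e) α β t s *
        metric (localRep (pull F'.toFun φ) e) α β t s := by
  have h0 := chartLin_ne_zero he ht hs
  rw [bundleParam_eq, energyDensity_eq_fibre F F' hφ h0 hv,
    trace_localRep_eq he ht (contDiffAt_fibreFun F _ h0) (contDiffAt_fibreFun_pull F' hv)]

end FibreDensity

end FinslerMaps

end

noncomputable section

namespace FinslerMaps

/-! ### Variations in local coordinates -/

section Lift

variable {p n : ℕ} {T : Set (Coord p)} {T' : Set (Coord n)} {L : Coord p → Coord p → ℝ}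
  {L' : Coord n → Coord n → ℝ} {φ : Coord p → Coord n} {t s : Coord p}

/-- The spray derivative as a directional derivative in the vector (s, -G), the form in which the
chain rule can be applied. -/
theorem geo_eq_fderiv {f : Coord p → Coord p → ℝ}
    (h : DifferentiableAt ℝ (fun z : Coord p × Coord p => f z.1 z.2) (t, s)) :
    geo L f t s = fderiv ℝ (fun z : Coord p × Coord p => f z.1 z.2) (t, s)
      (s, WithLp.toLp 2 fun α => - spray L α t s) := by
  rw [fderiv_eq_sum_dT_dS h]
  simp [geo, sub_eq_add_neg]

/-- A function of the position only, differentiated along the spray. -/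
theorem geo_base {f : Coord p → ℝ} : geo L (fun t _ => f t) t s = fderiv ℝ f t s := by
  have h1 := fderiv_fst_eq_sum_dT (f := fun t _ => f t) t s s
  simp only at h1
  rw [h1]
  simp [geo, dS]

theorem contDiffOn_d1 (hT : IsOpen T) (hφ : ContDiffOn ℝ ∞ φ T) (i : Fin n) (α : Fin p) :
    ContDiffOn ℝ ∞ (d1 φ i α) T :=
  contDiffOn_fderiv_apply hT ((EuclideanSpace.proj i : Coord n →L[ℝ] ℝ).contDiff.comp_contDiffOn hφ)
    _

theorem contDiffOn_push (hT : IsOpen T) (hφ : ContDiffOn ℝ ∞ φ T) :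
    ContDiffOn ℝ ∞ (fun z : Coord p × Coord p => push φ z.1 z.2) (T ×ˢ univ) := by
  rw [contDiffOn_piLp]
  intro i
  change ContDiffOn ℝ ∞ (fun z : Coord p × Coord p => ∑ α, d1 φ i α z.1 * z.2 α) _
  refine ContDiffOn.sum fun α _ => ContDiffOn.mul ?_ ?_
  · exact (contDiffOn_d1 hT hφ i α).comp contDiffOn_fst fun z hz => hz.1
  · exact ((EuclideanSpace.proj α : Coord p →L[ℝ] ℝ).contDiff.comp contDiff_snd).contDiffOn

theorem fderiv_push_apply (hT : IsOpen T) (hφ : ContDiffOn ℝ ∞ φ T) (ht : t ∈ T) (v w : Coord p)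
    (i : Fin n) :
    fderiv ℝ (fun z : Coord p × Coord p => push φ z.1 z.2) (t, s) (v, w) i =
      ∑ α, (∑ β, d2 φ i β α t * s α * v β) + ∑ α, d1 φ i α t * w α := by
  have hd : DifferentiableAt ℝ (fun z : Coord p × Coord p => push φ z.1 z.2) (t, s) :=
    ((contDiffOn_push hT hφ).contDiffAt ((hT.prod isOpen_univ).mem_nhds ⟨ht, mem_univ _⟩)).differentiableAt
      (by simp)
  have h1 : HasFDerivAt (fun z : Coord p × Coord p => push φ z.1 z.2 i)
      ((EuclideanSpace.proj i : Coord n →L[ℝ] ℝ).comp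
        (fderiv ℝ (fun z : Coord p × Coord p => push φ z.1 z.2) (t, s))) (t, s) :=
    (EuclideanSpace.proj i : Coord n →L[ℝ] ℝ).hasFDerivAt.comp _ hd.hasFDerivAt
  have h2 : HasFDerivAt (fun z : Coord p × Coord p => ∑ α, d1 φ i α z.1 * z.2 α)
      (∑ α, (d1 φ i α t • ((EuclideanSpace.proj α : Coord p →L[ℝ] ℝ).comp
          (ContinuousLinearMap.snd ℝ (Coord p) (Coord p))) +
        s α • (fderiv ℝ (d1 φ i α) t).comp (ContinuousLinearMap.fst ℝ (Coord p) (Coord p)))) (t, s) := by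
    refine HasFDerivAt.fun_sum fun α _ => ?_
    have h3 := (((contDiffOn_d1 hT hφ i α).contDiffAt (hT.mem_nhds ht)).differentiableAt
      (by simp)).hasFDerivAt
    have h5 : HasFDerivAt (fun z : Coord p × Coord p => d1 φ i α z.1) _ (t, s) :=
      HasFDerivAt.comp (t, s) (f := Prod.fst) h3 hasFDerivAt_fst
    have h6 : HasFDerivAt (fun z : Coord p × Coord p => z.2 α) _ (t, s) :=
      ((EuclideanSpace.proj α : Coord p →L[ℝ] ℝ).comp
        (ContinuousLinearMap.snd ℝ (Coord p) (Coord p))).hasFDerivAt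
    exact h5.mul h6
  have h4 := congrArg (fun A : Coord p × Coord p →L[ℝ] ℝ => A (v, w)) (h1.unique h2)
  change fderiv ℝ (fun z : Coord p × Coord p => push φ z.1 z.2) (t, s) (v, w) i = _ at h4
  rw [h4]
  simp only [FunLike.coe_sum, Finset.sum_apply, add_apply, smul_apply,
    ContinuousLinearMap.comp_apply, ContinuousLinearMap.coe_fst', ContinuousLinearMap.coe_snd',
    smul_eq_mul]
  rw [Finset.sum_add_distrib, add_comm]
  congr 1
  refine Finset.sum_congr rfl fun α _ => ?_
  conv_lhs => rw [← sum_smul_single v]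
  rw [map_sum, Finset.mul_sum]
  refine Finset.sum_congr rfl fun β _ => ?_
  rw [map_smul, smul_eq_mul]
  unfold d2
  ring

/-- An affine map carries the spray of the source to the spray of the target. -/
theorem geo_comp_lift (h : IsLocalFinsler L T) (h' : IsLocalFinsler L' T')
    (hφ : ContDiffOn ℝ ∞ φ T) (ht : t ∈ T) (hs : s ≠ 0) (ht' : φ t ∈ T') (hs' : push φ t s ≠ 0)
    (ha : ∀ i α β, affineExpr L L' φ i α β t s = 0) {f : Coord n → Coord n → ℝ}
    (hf : SmoothOff T' f) :
    geo L (fun t s => f (φ t) (push φ t s)) t s = geo L' f (φ t) (push φ t s) := by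
  have hT := h.isOpen
  have hdφ : DifferentiableAt ℝ φ t := (hφ.contDiffAt (hT.mem_nhds ht)).differentiableAt (by simp)
  have hd : DifferentiableAt ℝ (fun z : Coord p × Coord p => push φ z.1 z.2) (t, s) :=
    ((contDiffOn_push hT hφ).contDiffAt ((hT.prod isOpen_univ).mem_nhds ⟨ht, mem_univ _⟩)).differentiableAt
      (by simp)
  have hdf := hf.differentiableAt h'.isOpen ht' hs'
  have h1 : HasFDerivAt (fun z : Coord p × Coord p => (φ z.1, push φ z.1 z.2))
      (((fderiv ℝ φ t).comp (ContinuousLinearMap.fst ℝ (Coord p) (Coord p))).prod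
        (fderiv ℝ (fun z : Coord p × Coord p => push φ z.1 z.2) (t, s))) (t, s) :=
    (HasFDerivAt.comp (t, s) (f := Prod.fst) hdφ.hasFDerivAt hasFDerivAt_fst).prodMk hd.hasFDerivAt
  have h2 := HasFDerivAt.comp (t, s) (f := fun z : Coord p × Coord p => (φ z.1, push φ z.1 z.2))
    (g := fun z : Coord n × Coord n => f z.1 z.2) hdf.hasFDerivAt h1
  rw [geo_eq_fderiv h2.differentiableAt, geo_eq_fderiv hdf]
  change fderiv ℝ ((fun z : Coord n × Coord n => f z.1 z.2) ∘
    fun z : Coord p × Coord p => (φ z.1, push φ z.1 z.2)) (t, s) _ = _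
  rw [h2.fderiv]
  rw [ContinuousLinearMap.comp_apply]
  congr 1
  refine Prod.ext ?_ ?_
  · exact (push_eq hdφ s).symm
  · ext i
    change fderiv ℝ (fun z : Coord p × Coord p => push φ z.1 z.2) (t, s) _ i = _
    rw [fderiv_push_apply hT hφ ht]
    -- The fibre component of the image of (s, -G) under the differential of the lift is φ_{αβ} s^α
    -- s^β - φ_α G^α. The affine equation makes it -G' at the image point.
    have h3 := spray_push h h' ht hs ht' hs' ha i
    rw [Finset.sum_comm, h3]
    simp only [mul_neg, Finset.sum_neg_distrib]
    rw [Finset.sum_congr rfl fun α _ => mul_comm (spray L α t s) (d1 φ i α t)]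
    ring

end Lift

/-- A variation, through immersions, of a map in local coordinates. -/
structure IsLocalVariation {p n : ℕ} (δ : ℝ) (T : Set (Coord p)) (T' : Set (Coord n))
    (ψ : ℝ → Coord p → Coord n) : Prop where
  pos : 0 < δ
  isOpen : IsOpen T
  smooth : ContDiffOn ℝ ∞ (fun q : ℝ × Coord p => ψ q.1 q.2) (Ioo (-δ) δ ×ˢ T)
  mapsTo : ∀ u ∈ Ioo (-δ) δ, ∀ t ∈ T, ψ u t ∈ T'
  injective : ∀ u ∈ Ioo (-δ) δ, ∀ t ∈ T, Function.Injective (fderiv ℝ (ψ u) t)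

/-- The Finsler function of the target pulled back by a map in local coordinates. -/
def localPull {p n : ℕ} (L' : Coord n → Coord n → ℝ) (φ : Coord p → Coord n) :
    Coord p → Coord p → ℝ :=
  fun t s => L' (φ t) (fderiv ℝ φ t s)

/-- The velocity of a variation at time zero. -/
def localVelocity {p n : ℕ} (ψ : ℝ → Coord p → Coord n) (t : Coord p) : Coord n :=
  deriv (fun u => ψ u t) 0

/-- The derivative of the squared Finsler norm of the target in the direction of the velocity of a
variation. -/
def localMomentum {p n : ℕ} (L' : Coord n → Coord n → ℝ) (ψ : ℝ → Coord p → Coord n) :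
    Coord p → Coord p → ℝ :=
  fun t s => ∑ k, dS k (fun t s => L' t s ^ 2) (ψ 0 t) (push (ψ 0) t s) * localVelocity ψ t k

namespace IsLocalVariation

variable {p n : ℕ} {T : Set (Coord p)} {T' : Set (Coord n)} {L : Coord p → Coord p → ℝ}
  {L' : Coord n → Coord n → ℝ} {ψ : ℝ → Coord p → Coord n} {t s : Coord p} {δ u : ℝ}

theorem zero_mem (hψ : IsLocalVariation δ T T' ψ) : (0 : ℝ) ∈ Ioo (-δ) δ :=
  ⟨by linarith [hψ.pos], hψ.pos⟩

theorem contDiffAt (hψ : IsLocalVariation δ T T' ψ) (hu : u ∈ Ioo (-δ) δ) (ht : t ∈ T) :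
    ContDiffAt ℝ ∞ (fun q : ℝ × Coord p => ψ q.1 q.2) (u, t) :=
  hψ.smooth.contDiffAt ((isOpen_Ioo.prod hψ.isOpen).mem_nhds ⟨hu, ht⟩)

theorem contDiffOn_slice (hψ : IsLocalVariation δ T T' ψ) (hu : u ∈ Ioo (-δ) δ) :
    ContDiffOn ℝ ∞ (ψ u) T :=
  hψ.smooth.comp (f := fun t => (u, t)) (contDiffOn_const.prodMk contDiffOn_id) fun _ ht => ⟨hu, ht⟩

theorem differentiableAt_slice (hψ : IsLocalVariation δ T T' ψ) (hu : u ∈ Ioo (-δ) δ)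
    (ht : t ∈ T) : DifferentiableAt ℝ (ψ u) t :=
  ((hψ.contDiffOn_slice hu).contDiffAt (hψ.isOpen.mem_nhds ht)).differentiableAt (by simp)

theorem fderiv_ne_zero (hψ : IsLocalVariation δ T T' ψ) (hu : u ∈ Ioo (-δ) δ) (ht : t ∈ T)
    (hs : s ≠ 0) : fderiv ℝ (ψ u) t s ≠ 0 := fun h =>
  hs (hψ.injective u hu t ht (h.trans (map_zero _).symm))

theorem fderiv_slice (hψ : IsLocalVariation δ T T' ψ) (hu : u ∈ Ioo (-δ) δ) (ht : t ∈ T)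
    (s : Coord p) :
    fderiv ℝ (ψ u) t s = fderiv ℝ (fun q : ℝ × Coord p => ψ q.1 q.2) (u, t) (0, s) := by
  have h1 := HasFDerivAt.comp t (f := fun t => (u, t))
    ((hψ.contDiffAt hu ht).differentiableAt (by simp)).hasFDerivAt (hasFDerivAt_prodMk_right u t)
  change fderiv ℝ ((fun q : ℝ × Coord p => ψ q.1 q.2) ∘ fun t => (u, t)) t s = _
  rw [h1.fderiv]
  rfl

theorem localVelocity_eq (hψ : IsLocalVariation δ T T' ψ) (ht : t ∈ T) :
    localVelocity ψ t = fderiv ℝ (fun q : ℝ × Coord p => ψ q.1 q.2) (0, t) (1, 0) := by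
  have h1 := HasFDerivAt.comp (0 : ℝ) (f := fun u => (u, t))
    ((hψ.contDiffAt hψ.zero_mem ht).differentiableAt (by simp)).hasFDerivAt
      (hasFDerivAt_prodMk_left 0 t)
  exact h1.hasDerivAt.deriv

theorem contDiffOn_localVelocity (hψ : IsLocalVariation δ T T' ψ) :
    ContDiffOn ℝ ∞ (localVelocity ψ) T := by
  have h1 : ContDiffOn ℝ ∞ (fun q => fderiv ℝ (fun q : ℝ × Coord p => ψ q.1 q.2) q (1, 0))
      (Ioo (-δ) δ ×ˢ T) :=
    (hψ.smooth.fderiv_of_isOpen (isOpen_Ioo.prod hψ.isOpen) (by simp)).clm_apply contDiffOn_const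
  refine (h1.comp (f := fun t => ((0 : ℝ), t)) (contDiffOn_const.prodMk contDiffOn_id)
    fun t ht => ⟨hψ.zero_mem, ht⟩).congr fun t ht => hψ.localVelocity_eq ht

/-- The differentials of the maps of a variation, as a function of all variables. -/
theorem contDiffOn_fderiv (hψ : IsLocalVariation δ T T' ψ) :
    ContDiffOn ℝ ∞ (fun q : ℝ × (Coord p × Coord p) => fderiv ℝ (ψ q.1) q.2.1 q.2.2)
      (Ioo (-δ) δ ×ˢ (T ×ˢ univ)) := by
  have h1 := hψ.smooth.fderiv_of_isOpen (m := ∞) (isOpen_Ioo.prod hψ.isOpen) (by simp)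
  have h2 : ContDiffOn ℝ ∞ (fun q : ℝ × (Coord p × Coord p) =>
      fderiv ℝ (fun q : ℝ × Coord p => ψ q.1 q.2) (q.1, q.2.1) ((0 : ℝ), q.2.2))
      (Ioo (-δ) δ ×ˢ (T ×ˢ univ)) := by
    refine ContDiffOn.clm_apply (h1.comp (f := fun q : ℝ × (Coord p × Coord p) => (q.1, q.2.1))
      (by fun_prop) fun q hq => ⟨hq.1, hq.2.1⟩) (by fun_prop)
  exact h2.congr fun q hq => hψ.fderiv_slice hq.1 hq.2.1 _

theorem contDiffOn_localPull (hψ : IsLocalVariation δ T T' ψ) (h' : IsLocalFinsler L' T') :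
    ContDiffOn ℝ ∞ (fun q : ℝ × (Coord p × Coord p) => localPull L' (ψ q.1) q.2.1 q.2.2)
      (Ioo (-δ) δ ×ˢ (T ×ˢ {0}ᶜ)) := by
  have h1 : ContDiffOn ℝ ∞ (fun q : ℝ × (Coord p × Coord p) =>
      (ψ q.1 q.2.1, fderiv ℝ (ψ q.1) q.2.1 q.2.2)) (Ioo (-δ) δ ×ˢ (T ×ˢ {0}ᶜ)) := by
    refine ContDiffOn.prodMk ?_ (hψ.contDiffOn_fderiv.mono
      (prod_mono_right (prod_mono_right (subset_univ _))))
    exact hψ.smooth.comp (f := fun q : ℝ × (Coord p × Coord p) => (q.1, q.2.1))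
      (by fun_prop) fun q hq => ⟨hq.1, hq.2.1⟩
  exact ContDiffOn.comp (g := fun z : Coord n × Coord n => L' z.1 z.2) h'.smooth h1 fun q hq =>
    ⟨hψ.mapsTo _ hq.1 _ hq.2.1, hψ.fderiv_ne_zero hq.1 hq.2.1 hq.2.2⟩

theorem smoothOff_localPull (hψ : IsLocalVariation δ T T' ψ) (h' : IsLocalFinsler L' T')
    (hu : u ∈ Ioo (-δ) δ) : SmoothOff T (localPull L' (ψ u)) :=
  (hψ.contDiffOn_localPull h').comp (f := fun z => (u, z))
    (contDiffOn_const.prodMk contDiffOn_id) fun _ hz => ⟨hu, hz⟩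

theorem eulerDeg_localPull (hψ : IsLocalVariation δ T T' ψ) (h' : IsLocalFinsler L' T')
    (hu : u ∈ Ioo (-δ) δ) : EulerDeg T 1 (localPull L' (ψ u)) := by
  have := EulerDeg.of_homogeneous (k := 1) (hψ.smoothOff_localPull h' hu) hψ.isOpen
    fun t _ s _ c hc => by
      unfold localPull
      rw [map_smul, h'.homogeneous _ _ c hc, pow_one]
  simpa using this

theorem smoothOff_comp_lift (hψ : IsLocalVariation δ T T' ψ) {f : Coord n → Coord n → ℝ}
    (hf : SmoothOff T' f) : SmoothOff T (fun t s => f (ψ 0 t) (push (ψ 0) t s)) := by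
  have h0 := hψ.contDiffOn_slice hψ.zero_mem
  refine ContDiffOn.comp (g := fun z : Coord n × Coord n => f z.1 z.2)
    (f := fun z : Coord p × Coord p => (ψ 0 z.1, push (ψ 0) z.1 z.2)) hf
    (ContDiffOn.prodMk (h0.comp contDiffOn_fst fun _ hz => hz.1)
      ((contDiffOn_push hψ.isOpen h0).mono (prod_mono_right (subset_univ _)))) fun z hz => ⟨?_, ?_⟩
  · exact hψ.mapsTo 0 hψ.zero_mem _ hz.1
  · change push (ψ 0) z.1 z.2 ≠ 0
    rw [push_eq (hψ.differentiableAt_slice hψ.zero_mem hz.1)]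
    exact hψ.fderiv_ne_zero hψ.zero_mem hz.1 hz.2

theorem smoothOff_localVelocity (hψ : IsLocalVariation δ T T' ψ) (k : Fin n) :
    SmoothOff T (fun t _ => localVelocity ψ t k) :=
  ((EuclideanSpace.proj k : Coord n →L[ℝ] ℝ).contDiff.comp_contDiffOn
    hψ.contDiffOn_localVelocity).comp contDiffOn_fst fun _ hz => hz.1

theorem smoothOff_localMomentum (hψ : IsLocalVariation δ T T' ψ) (h' : IsLocalFinsler L' T') :
    SmoothOff T (localMomentum L' ψ) :=
  SmoothOff.sum fun k _ => (hψ.smoothOff_comp_lift ((h'.smooth.pow 2).dS h'.isOpen k)).mul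
    (hψ.smoothOff_localVelocity k)

/-- Along a variation of an affine map, the derivative of the squared norm of the pushed forward
vector is the derivative of the momentum along the spray. -/
theorem hasDerivAt_localPull_sq (hψ : IsLocalVariation δ T T' ψ) (h : IsLocalFinsler L T)
    (h' : IsLocalFinsler L' T') (ht : t ∈ T) (hs : s ≠ 0)
    (ha : ∀ i α β, affineExpr L L' (ψ 0) i α β t s = 0) :
    HasDerivAt (fun u => localPull L' (ψ u) t s ^ 2) (geo L (localMomentum L' ψ) t s) 0 := by
  have h0 := hψ.zero_mem
  have hd0 := hψ.differentiableAt_slice h0 ht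
  have hmem := hψ.mapsTo 0 h0 t ht
  have hne := hψ.fderiv_ne_zero h0 ht hs
  have hpush := push_eq hd0 s
  have hne' : push (ψ 0) t s ≠ 0 := by rwa [hpush]
  have hq := h'.smooth.pow 2
  set Ψ : ℝ × Coord p → Coord n := fun q => ψ q.1 q.2 with hΨ
  have hΨ0 := hψ.contDiffAt h0 ht
  -- the derivative in the parameter
  have e1 : HasDerivAt (fun u => ψ u t) (localVelocity ψ t) 0 := by
    have h1 := HasFDerivAt.comp (0 : ℝ) (f := fun u => (u, t))
      (hΨ0.differentiableAt (by simp)).hasFDerivAt (hasFDerivAt_prodMk_left 0 t)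
    exact (h1.hasDerivAt.differentiableAt).hasDerivAt
  have e2 : HasDerivAt (fun u => fderiv ℝ (ψ u) t s) (fderiv ℝ (localVelocity ψ) t s) 0 := by
    have hdd : DifferentiableAt ℝ (fun q => fderiv ℝ Ψ q (0, s)) (0, t) :=
      (((hΨ0.fderiv_right (m := ∞) (by simp)).clm_apply contDiffAt_const)).differentiableAt (by simp)
    have h1 := HasFDerivAt.comp (0 : ℝ) (f := fun u => (u, t)) hdd.hasFDerivAt
      (hasFDerivAt_prodMk_left 0 t)
    have hdd' : DifferentiableAt ℝ (fun q => fderiv ℝ Ψ q ((1 : ℝ), (0 : Coord p))) (0, t) :=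
      (((hΨ0.fderiv_right (m := ∞) (by simp)).clm_apply contDiffAt_const)).differentiableAt (by simp)
    have h2 := HasFDerivAt.comp t (f := fun t => ((0 : ℝ), t)) hdd'.hasFDerivAt
      (hasFDerivAt_prodMk_right 0 t)
    have h3 : fderiv ℝ (localVelocity ψ) t s =
        fderiv ℝ (fun q => fderiv ℝ Ψ q ((1 : ℝ), (0 : Coord p))) (0, t) (0, s) := by
      have h4 : localVelocity ψ =ᶠ[nhds t]
          (fun q => fderiv ℝ Ψ q ((1 : ℝ), (0 : Coord p))) ∘ fun t => ((0 : ℝ), t) := by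
        filter_upwards [hψ.isOpen.mem_nhds ht] with t' ht' using hψ.localVelocity_eq ht'
      rw [h4.fderiv_eq, h2.fderiv]
      rfl
    -- Symmetry of second derivatives: differentiating dψ_u(s) in u gives the differential of the
    -- velocity applied to s.
    rw [h3, fderiv_fderiv_apply_comm hΨ0]
    have h5 := h1.hasDerivAt
    refine h5.congr_of_eventuallyEq ?_
    filter_upwards [isOpen_Ioo.mem_nhds h0] with u hu using hψ.fderiv_slice hu ht s
  have hdq := hq.differentiableAt h'.isOpen hmem hne
  have e3 := HasFDerivAt.comp_hasDerivAt (0 : ℝ) (f := fun u => (ψ u t, fderiv ℝ (ψ u) t s))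
    (l := fun z : Coord n × Coord n => L' z.1 z.2 ^ 2) hdq.hasFDerivAt (e1.prodMk e2)
  rw [fderiv_eq_sum_dT_dS (f := fun t s => L' t s ^ 2) hdq] at e3
  refine e3.congr_deriv ?_
  -- the derivative along the spray
  unfold localMomentum
  rw [geo_sum (fun k _ => (hψ.smoothOff_comp_lift (hq.dS h'.isOpen k)).mul
    (hψ.smoothOff_localVelocity k)) hψ.isOpen ht hs, ← Finset.sum_add_distrib]
  refine Finset.sum_congr rfl fun k _ => ?_
  -- Leibniz rule for X(W). X becomes X' on the target factor, where Euler–Lagrange yields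
  -- ∂F'²/∂x^k; on V^k, a function of t alone, X is dV^k(s). These are the two terms of the
  -- derivative in u.
  rw [geo_mul (hψ.smoothOff_comp_lift (hq.dS h'.isOpen k)) (hψ.smoothOff_localVelocity k)
    hψ.isOpen ht hs, geo_comp_lift h h' (hψ.contDiffOn_slice h0) ht hs hmem hne' ha
    (hq.dS h'.isOpen k), h'.geo_dS_sq hmem hne', geo_base, hpush]
  have h6 : HasFDerivAt (fun t => localVelocity ψ t k)
      ((EuclideanSpace.proj k : Coord n →L[ℝ] ℝ).comp (fderiv ℝ (localVelocity ψ) t)) t :=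
    (EuclideanSpace.proj k : Coord n →L[ℝ] ℝ).hasFDerivAt.comp t
      ((hψ.contDiffOn_localVelocity.contDiffAt (hψ.isOpen.mem_nhds ht)).differentiableAt
        (by simp)).hasFDerivAt
  rw [h6.fderiv, ContinuousLinearMap.comp_apply]
  change _ = _ + _ * (fderiv ℝ (localVelocity ψ) t s) k
  ring

end IsLocalVariation

/-- Differentiation under the integral sign, for integrands with a common compact support. -/
theorem hasDerivAt_integral_of_compact {V : Type*} [NormedAddCommGroup V] [NormedSpace ℝ V]
    [MeasurableSpace V] [BorelSpace V] {μ : Measure V}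
    [IsFiniteMeasureOnCompacts μ] {U K : Set V} {δ : ℝ} (hδ : 0 < δ) (hU : IsOpen U)
    (hK : IsCompact K) (hKU : K ⊆ U) {k : V → ℝ} (hk : ContinuousOn k U) (h0 : ∀ z ∉ K, k z = 0)
    {H : ℝ → V → ℝ} (hH : ContDiffOn ℝ ∞ (fun q : ℝ × V => H q.1 q.2) (Ioo (-δ) δ ×ˢ U)) :
    HasDerivAt (fun u => ∫ z, k z * H u z ∂μ) (∫ z, k z * deriv (fun u => H u z) 0 ∂μ) 0 := by
  have hopen : IsOpen (Ioo (-δ) δ ×ˢ U) := isOpen_Ioo.prod hU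
  have hder : ∀ u ∈ Ioo (-δ) δ, ∀ z ∈ U, HasDerivAt (fun u => H u z)
      (fderiv ℝ (fun q : ℝ × V => H q.1 q.2) (u, z) (1, 0)) u := by
    intro u hu z hz
    have h1 := HasFDerivAt.comp u (f := fun u => (u, z))
      ((hH.contDiffAt (hopen.mem_nhds ⟨hu, hz⟩)).differentiableAt (by simp)).hasFDerivAt
      (hasFDerivAt_prodMk_left u z)
    exact h1.hasDerivAt
  have hc : ContinuousOn (fun q => fderiv ℝ (fun q : ℝ × V => H q.1 q.2) q (1, 0))
      (Ioo (-δ) δ ×ˢ U) :=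
    (hH.continuousOn_fderiv_of_isOpen hopen (by simp)).clm_apply continuousOn_const
  have hci : ∀ u ∈ Ioo (-δ) δ, ∀ g : ℝ × V → ℝ, ContinuousOn g (Ioo (-δ) δ ×ˢ U) →
      Integrable (fun z => k z * g (u, z)) μ := by
    intro u hu g hg
    refine integrable_of_zero_off_compact hU (hk.mul (hg.comp (f := fun z => (u, z))
      (by fun_prop) fun z hz => ⟨hu, hz⟩)) hK hKU fun z hz => by rw [h0 z hz, zero_mul]
  have h00 : (0 : ℝ) ∈ Ioo (-δ) δ := ⟨by linarith, hδ⟩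
  have hsub : Icc (-(δ / 2)) (δ / 2) ⊆ Ioo (-δ) δ := fun u hu =>
    ⟨by linarith [hu.1], by linarith [hu.2]⟩
  -- The interval is halved to make it compact. The derivative is then bounded on interval × K, and
  -- this constant on K is the dominating function.
  obtain ⟨B, hB⟩ := ((isCompact_Icc (a := -(δ / 2)) (b := δ / 2)).prod hK).exists_bound_of_continuousOn
    (f := fun q => k q.2 * fderiv ℝ (fun q : ℝ × V => H q.1 q.2) q (1, 0))
    (((hk.mono hKU).comp continuousOn_snd fun q hq => hq.2).mul
      (hc.mono (prod_mono hsub hKU)))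
  have hmain := hasDerivAt_integral_of_dominated_loc_of_deriv_le (μ := μ) (x₀ := (0 : ℝ))
    (s := Icc (-(δ / 2)) (δ / 2)) (F := fun u z => k z * H u z)
    (F' := fun u z => k z * fderiv ℝ (fun q : ℝ × V => H q.1 q.2) (u, z) (1, 0))
    (bound := K.indicator fun _ => B) (Icc_mem_nhds (by linarith) (by linarith)) ?_
    (hci 0 h00 _ hH.continuousOn) (hci 0 h00 _ hc).aestronglyMeasurable ?_ ?_ ?_
  · refine hmain.2.congr_deriv (integral_congr_ae (Filter.Eventually.of_forall fun z => ?_))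
    by_cases hz : z ∈ K
    · simp only
      rw [(hder 0 h00 z (hKU hz)).deriv]
    · simp only [h0 z hz, zero_mul]
  · filter_upwards [isOpen_Ioo.mem_nhds h00] with u hu
      using (hci u hu _ hH.continuousOn).aestronglyMeasurable
  · refine Filter.Eventually.of_forall fun z u hu => ?_
    by_cases hz : z ∈ K
    · rw [indicator_of_mem hz]
      exact hB (u, z) ⟨hu, hz⟩
    · rw [indicator_of_notMem hz, h0 z hz, zero_mul, norm_zero]
  · exact (integrable_indicator_iff hK.isClosed.measurableSet).2
      (integrableOn_const hK.measure_lt_top.ne)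
  · refine Filter.Eventually.of_forall fun z u hu => ?_
    by_cases hz : z ∈ K
    · exact (hder u (hsub hu) z (hKU hz)).const_mul _
    · simp only [h0 z hz, zero_mul]
      exact hasDerivAt_const _ _

end FinslerMaps

end

noncomputable section

namespace FinslerMaps

/-! ### The first variation of the energy in local coordinates -/

section FirstVariation

variable {p n : ℕ} {T C : Set (Coord p)} {T' : Set (Coord n)} {L : Coord p → Coord p → ℝ}
  {L' : Coord n → Coord n → ℝ} {ψ : ℝ → Coord p → Coord n} {t s : Coord p} {δ u : ℝ}

theorem geo_comp {f : Coord p → Coord p → ℝ} {g : ℝ → ℝ}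
    (hf : DifferentiableAt ℝ (fun z : Coord p × Coord p => f z.1 z.2) (t, s))
    (hg : DifferentiableAt ℝ g (f t s)) :
    geo L (fun t s => g (f t s)) t s = deriv g (f t s) * geo L f t s := by
  have h1 := HasDerivAt.comp_hasFDerivAt (t, s) (f := fun z : Coord p × Coord p => f z.1 z.2)
    (h₂ := g) hg.hasDerivAt hf.hasFDerivAt
  rw [geo_eq_fderiv h1.differentiableAt, geo_eq_fderiv hf]
  change fderiv ℝ (g ∘ fun z : Coord p × Coord p => f z.1 z.2) (t, s) _ = _
  rw [h1.fderiv]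
  rfl

theorem dS_comp {f : Coord p → Coord p → ℝ} {g : ℝ → ℝ}
    (hf : DifferentiableAt ℝ (fun s => f t s) s) (hg : DifferentiableAt ℝ g (f t s)) (α : Fin p) :
    dS α (fun t s => g (f t s)) t s = deriv g (f t s) * dS α f t s := by
  have h1 := HasDerivAt.comp_hasFDerivAt s (f := fun s => f t s) (h₂ := g) hg.hasDerivAt
    hf.hasFDerivAt
  unfold dS
  change fderiv ℝ (g ∘ fun s => f t s) s _ = _
  rw [h1.fderiv]
  rfl

theorem fderiv_eq_zero_off {ρ : Coord p → ℝ} (hC : IsCompact C) (h0 : ∀ t ∉ C, ρ t = 0)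
    (ht : t ∉ C) : fderiv ℝ ρ t = 0 := by
  rw [Filter.EventuallyEq.fderiv_eq (f := fun _ => (0 : ℝ))]
  · simp
  · filter_upwards [hC.isClosed.isOpen_compl.mem_nhds ht] with w hw using h0 w hw

theorem IsLocalFinsler.apply_zero (h : IsLocalFinsler L T) (t : Coord p) : L t 0 = 0 := by
  have := h.homogeneous t 0 2 two_pos
  rw [smul_zero] at this
  linarith

theorem bump_zero : bump 0 = 0 := bump_eq_zero (by simp)

/-- The first variation of the energy, localized by a function on the base. -/
theorem IsLocalVariation.hasDerivAt_energy (hψ : IsLocalVariation δ T T' ψ)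
    (h : IsLocalFinsler L T) (h' : IsLocalFinsler L' T')
    (ha : ∀ t ∈ T, ∀ s ≠ 0, ∀ i α β, affineExpr L L' (ψ 0) i α β t s = 0) {ρ : Coord p → ℝ}
    (hρ : ContDiff ℝ ∞ ρ) (hC : IsCompact C) (hCT : C ⊆ T) (h0 : ∀ t ∉ C, ρ t = 0) :
    HasDerivAt (fun u => ∫ z : Coord p × Coord p, ρ z.1 * bump (L z.1 z.2 ^ 2) *
        (metricMatrix L z.1 z.2).det * ((1 / 2) * ∑ α, ∑ β, invMetric L α β z.1 z.2 *
          metric (localPull L' (ψ u)) α β z.1 z.2))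
      (-(p / 2) * ∫ z : Coord p × Coord p, fderiv ℝ ρ z.1 z.2 *
        (bump (L z.1 z.2 ^ 2) * (L z.1 z.2 ^ 2)⁻¹) * (metricMatrix L z.1 z.2).det *
          localMomentum L' ψ z.1 z.2) 0 := by
  have hT := h.isOpen
  have hQ := h.smooth.pow 2
  have hQ0 : ∀ t ∈ T, ∀ s ≠ 0, L t s ^ 2 ≠ 0 := fun t ht s hs => (pow_pos (h.pos ht hs) 2).ne'
  set K := {z : Coord p × Coord p | z.1 ∈ C ∧ z.2 ≠ 0 ∧ L z.1 z.2 ^ 2 ∈ Icc (1 : ℝ) 2} with hKdef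
  have hK : IsCompact K := h.isCompact_shell hC hCT
  have hKT : K ⊆ T ×ˢ {0}ᶜ := fun z hz => ⟨hCT hz.1, hz.2.1⟩
  have hz0 : ∀ z ∉ K, z.1 ∉ C ∨ bump (L z.1 z.2 ^ 2) = 0 := by
    intro z hz
    by_cases h1 : z.1 ∈ C
    swap
    · exact Or.inl h1
    right
    by_cases h2 : z.2 = 0
    · rw [h2, h.apply_zero]
      simpa using bump_zero
    · exact bump_eq_zero fun h3 => hz ⟨h1, h2, Ioo_subset_Icc_self h3⟩
  have sρ : SmoothOff T (fun t _ => ρ t) := (hρ.comp contDiff_fst).contDiffOn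
  have sb : SmoothOff T (fun t s => bump (L t s ^ 2)) := contDiff_bump.comp_contDiffOn hQ
  -- The weight for the trace formula: at fixed t it depends on s only through L².
  set κ : Coord p → Coord p → ℝ := fun t s => ρ t * bump (L t s ^ 2) with hκdef
  have sκ : SmoothOff T κ := sρ.mul sb
  have κ0 : ∀ z ∉ K, κ z.1 z.2 = 0 := fun z hz => by
    rcases hz0 z hz with h1 | h1
    · simp [hκdef, h0 _ h1]
    · simp [hκdef, h1]
  have hη : ∀ t ∈ T, ∀ s ≠ 0, ∀ α, dS α κ t s =
      (ρ t * deriv bump (L t s ^ 2)) * dS α (fun t s => L t s ^ 2) t s := by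
    intro t ht s hs α
    rw [hκdef, dS_mul sρ sb hT ht hs, dS_comp (f := fun t s => L t s ^ 2) (g := bump)
      (hQ.slot_snd hT ht hs) (contDiff_bump.differentiable (by simp) _)]
    simp [dS]
    ring
  -- The weight after the trace has been replaced by p u²/L².
  set κ' : Coord p → Coord p → ℝ := fun t s => ρ t * (bump (L t s ^ 2) * (L t s ^ 2)⁻¹) with hκdef'
  have sκ' : SmoothOff T κ' := sρ.mul (sb.mul (hQ.inv hQ0))
  have κ0' : ∀ z ∉ K, κ' z.1 z.2 = 0 := fun z hz => by
    rcases hz0 z hz with h1 | h1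
    · simp [hκdef', h0 _ h1]
    · simp [hκdef', h1]
  -- X annihilates every function of L², so it acts only on the cut-off ρ, as dρ(s).
  have hgeo : ∀ z : Coord p × Coord p, geo L κ' z.1 z.2 = fderiv ℝ ρ z.1 z.2 *
      (bump (L z.1 z.2 ^ 2) * (L z.1 z.2 ^ 2)⁻¹) := by
    intro ⟨t, s⟩
    by_cases hz : (t, s) ∈ K
    · obtain ⟨ht, hs⟩ := hKT hz
      have hg : DifferentiableAt ℝ (fun x => bump x * x⁻¹) (L t s ^ 2) :=
        (contDiff_bump.differentiable (by simp) _).mul (differentiableAt_inv (hQ0 t ht s hs))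
      have h1 := geo_comp (L := L) (f := fun t s => L t s ^ 2) (hQ.differentiableAt hT ht hs) hg
      rw [h.geo_sq ht hs, mul_zero] at h1
      simp only [hκdef']
      rw [geo_mul sρ (sb.mul (hQ.inv hQ0)) hT ht hs, h1, geo_base]
      ring
    · have h1 : geo L κ' t s = 0 := by
        simp [geo, dT_eq_zero_off hK κ0' hz, dS_eq_zero_off hK κ0' hz]
      rw [h1]
      rcases hz0 _ hz with h2 | h2
      · simp [fderiv_eq_zero_off hC h0 h2]
      · simp only at h2
        simp [h2]
  -- the energy in terms of the squared norm
  have hE : ∀ u ∈ Ioo (-δ) δ, ∫ z : Coord p × Coord p, ρ z.1 * bump (L z.1 z.2 ^ 2) *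
        (metricMatrix L z.1 z.2).det * ((1 / 2) * ∑ α, ∑ β, invMetric L α β z.1 z.2 *
          metric (localPull L' (ψ u)) α β z.1 z.2) =
      (p / 2) * ∫ z : Coord p × Coord p, κ' z.1 z.2 * (metricMatrix L z.1 z.2).det *
        localPull L' (ψ u) z.1 z.2 ^ 2 := by
    intro u hu
    have su := hψ.smoothOff_localPull h' hu
    have h1 := h.integral_trace_eq sκ hK hKT κ0 hη su (hψ.eulerDeg_localPull h' hu)
    have s1 : SmoothOff T (fun t s => κ t s * (metricMatrix L t s).det *
        ∑ α, ∑ β, invMetric L α β t s * metric (localPull L' (ψ u)) α β t s) :=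
      (sκ.mul h.smooth_det).mul (SmoothOff.sum fun α _ => SmoothOff.sum fun β _ =>
        (h.smooth_invMetric α β).mul (su.metric hT α β))
    have s2 : SmoothOff T (fun t s => κ' t s * (metricMatrix L t s).det *
        localPull L' (ψ u) t s ^ 2) := (sκ'.mul h.smooth_det).mul (su.pow 2)
    have i1 := s1.integrable hT hK hKT fun z hz => by rw [κ0 z hz]; ring
    have i2 := s2.integrable hT hK hKT fun z hz => by rw [κ0' z hz]; ring
    have h2 : ∫ z : Coord p × Coord p, (κ z.1 z.2 * (metricMatrix L z.1 z.2).det *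
        ∑ α, ∑ β, invMetric L α β z.1 z.2 * metric (localPull L' (ψ u)) α β z.1 z.2 -
        p * (κ' z.1 z.2 * (metricMatrix L z.1 z.2).det * localPull L' (ψ u) z.1 z.2 ^ 2)) = 0 := by
      rw [← h1]
      refine integral_congr_ae (Filter.Eventually.of_forall fun z => ?_)
      simp only [hκdef, hκdef']
      ring
    rw [integral_sub i1 (i2.const_mul _), integral_const_mul, sub_eq_zero] at h2
    rw [show (p / 2 : ℝ) = 1 / 2 * p by ring, mul_assoc, ← h2, ← integral_const_mul]
    refine integral_congr_ae (Filter.Eventually.of_forall fun z => ?_)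
    simp only [hκdef]
    ring
  have hd := hasDerivAt_integral_of_compact (μ := volume) hψ.pos (isOpen_slit hT) hK hKT
    (k := fun z => κ' z.1 z.2 * (metricMatrix L z.1 z.2).det)
    (ContDiffOn.continuousOn (sκ'.mul h.smooth_det)) (fun z hz => by rw [κ0' z hz, zero_mul])
    (H := fun u z => localPull L' (ψ u) z.1 z.2 ^ 2) ((hψ.contDiffOn_localPull h').pow 2)
  -- The derivative of u² at time zero is X(W), and skew-adjointness moves X onto the weight.
  have hW := h.integral_mul_geo sκ' hK hKT κ0' (hψ.smoothOff_localMomentum h')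
  refine ((hd.const_mul (p / 2 : ℝ)).congr_of_eventuallyEq ?_).congr_deriv ?_
  · filter_upwards [isOpen_Ioo.mem_nhds hψ.zero_mem] with u hu using hE u hu
  · rw [neg_mul, ← mul_neg]
    congr 1
    simp_rw [← hgeo]
    rw [← hW]
    refine integral_congr_ae (Filter.Eventually.of_forall fun z => ?_)
    by_cases hz : z ∈ K
    · simp only
      rw [(hψ.hasDerivAt_localPull_sq h h' (hKT hz).1 (hKT hz).2
        (ha _ (hKT hz).1 _ (hKT hz).2)).deriv]
    · simp only [κ0' z hz, zero_mul]

/-! ### Homogeneity -/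

theorem dS_smul_of_homogeneous {f : Coord p → Coord p → ℝ} {c : ℝ} (hc : 0 < c)
    (hf : ∀ s, f t (c • s) = c ^ 2 * f t s) (α : Fin p) : dS α f t (c • s) = c * dS α f t s := by
  have h1 : (fun s => f t (c • s)) = fun s => (c ^ 2) • f t s := funext hf
  have h2 := congrArg (fun g : Coord p → ℝ => fderiv ℝ g s (EuclideanSpace.single α 1)) h1
  have e2 : fderiv ℝ (fun s => (c ^ 2) • f t s) = (c ^ 2) • fderiv ℝ (f t) :=
    fderiv_const_smul_field (f := f t) (c ^ 2)
  rw [fderiv_comp_smul, e2] at h2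
  simp only [smul_apply, smul_eq_mul, Pi.smul_apply] at h2
  unfold dS
  have h3 : c * (fderiv ℝ (fun s => f t s) (c • s) (EuclideanSpace.single α 1)) =
    c * (c * fderiv ℝ (fun s => f t s) s (EuclideanSpace.single α 1)) := by
    rw [← mul_assoc, ← sq]; exact h2
  exact mul_left_cancel₀ hc.ne' h3

/-- The fibre derivative of F'², a function of degree two, has degree one. -/
theorem localMomentum_smul (h' : IsLocalFinsler L' T') {c : ℝ} (hc : 0 < c) :
    localMomentum L' ψ t (c • s) = c * localMomentum L' ψ t s := by
  have h1 : push (ψ 0) t (c • s) = c • push (ψ 0) t s := by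
    ext i
    simp only [push_apply, PiLp.smul_apply, smul_eq_mul, Finset.mul_sum]
    exact Finset.sum_congr rfl fun _ _ => by ring
  unfold localMomentum
  rw [h1, Finset.mul_sum]
  refine Finset.sum_congr rfl fun k _ => ?_
  rw [dS_smul_of_homogeneous hc fun s => by rw [h'.homogeneous _ _ c hc]; ring]
  ring

/-- Both fundamental tensors have degree zero, so the energy density is a function of rays. -/
theorem IsLocalVariation.trace_smul (hψ : IsLocalVariation δ T T' ψ) (h : IsLocalFinsler L T)
    (h' : IsLocalFinsler L' T') (hu : u ∈ Ioo (-δ) δ) (ht : t ∈ T) (hs : s ≠ 0) {c : ℝ}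
    (hc : 0 < c) :
    ∑ α, ∑ β, invMetric L α β t (c • s) * metric (localPull L' (ψ u)) α β t (c • s) =
      ∑ α, ∑ β, invMetric L α β t s * metric (localPull L' (ψ u)) α β t s := by
  have hcs : c • s ≠ 0 := smul_ne_zero hc.ne' hs
  have slice : ∀ {f : Coord p → Coord p → ℝ}, SmoothOff T f →
      ContDiffAt ℝ ∞ (fun s' => f t s') (c • s) := fun hf =>
    (hf.contDiffAt h.isOpen ht hcs).comp (f := fun s' => (t, s')) _
      (contDiffAt_const.prodMk contDiffAt_id)
  have h1 := metricMatrix_smul hc (h.homogeneous t) (slice h.smooth)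
  have h2 := metricMatrix_smul (h := localPull L' (ψ u)) hc (fun s c hc => by
    unfold localPull
    rw [map_smul, h'.homogeneous _ _ c hc]) (slice (hψ.smoothOff_localPull h' hu))
  unfold invMetric
  rw [h1]
  refine Finset.sum_congr rfl fun α _ => Finset.sum_congr rfl fun β _ => ?_
  rw [show metric (localPull L' (ψ u)) α β t (c • s) =
    metricMatrix (localPull L' (ψ u)) t (c • s) α β from rfl, h2]
  rfl

end FirstVariation

end FinslerMaps

end

noncomputable section

namespace FinslerMaps

/-! ### The first variation of the energy over a chart domain -/

section ChartVariation

variable {p n : ℕ} {M N : Type*} [TopologicalSpace M] [ChartedSpace (Coord p) M]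
  [TopologicalSpace N] [ChartedSpace (Coord n) N]

/-- A variation which is small over a chart domain: it stays in a fixed chart of the target, and
consists of immersions. -/
structure IsChartVariation (δ : ℝ) (e : OpenPartialHomeomorph M (Coord p))
    (e' : OpenPartialHomeomorph N (Coord n)) (Φ : ℝ → M → N) : Prop where
  mem_atlas : e ∈ IsManifold.maximalAtlas (𝓡 p) ∞ M
  mem_atlas' : e' ∈ IsManifold.maximalAtlas (𝓡 n) ∞ N
  isLocalVariation : IsLocalVariation δ e.target e'.target fun u => localMap (Φ u) e e'
  mapsTo : ∀ u ∈ Ioo (-δ) δ, ∀ x ∈ e.source, Φ u x ∈ e'.source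
  mdifferentiableAt : ∀ u ∈ Ioo (-δ) δ, ∀ x ∈ e.source, MDifferentiableAt (𝓡 p) (𝓡 n) (Φ u) x
  mdifferentiableAt_time : ∀ x ∈ e.source,
    MDifferentiableAt 𝓘(ℝ, ℝ) (𝓡 n) (fun u => Φ u x) 0

/-- The velocity of a variation at time zero. -/
def velocity (Φ : ℝ → M → N) (x : M) : Coord n :=
  (mfderiv 𝓘(ℝ, ℝ) (𝓡 n) (fun u => Φ u x) 0 : ℝ →L[ℝ] Coord n) 1

/-- The derivative of the squared Finsler norm of the target, at the image of a tangent vector, in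
the direction of the velocity of a variation. -/
def momentum (F' : TangentBundle (𝓡 n) N → ℝ) (Φ : ℝ → M → N) (v : TangentBundle (𝓡 p) M) : ℝ :=
  fderiv ℝ (fun y : Coord n => F' ⟨Φ 0 v.proj, y⟩ ^ 2)
    ((mfderiv (𝓡 p) (𝓡 n) (Φ 0) v.proj : Coord p →L[ℝ] Coord n) v.2) (velocity Φ v.proj)

/-- The differential of a function, as a function on the tangent bundle. -/
def differential (ρ : M → ℝ) (v : TangentBundle (𝓡 p) M) : ℝ :=
  (mfderiv (𝓡 p) 𝓘(ℝ, ℝ) ρ v.proj : Coord p →L[ℝ] ℝ) v.2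

/-- A function on a manifold, read in a chart and extended by zero. -/
def readIn (e : OpenPartialHomeomorph M (Coord p)) (ρ : M → ℝ) : Coord p → ℝ :=
  e.target.indicator fun t => ρ (e.symm t)

variable [IsManifold (𝓡 p) ∞ M] {e : OpenPartialHomeomorph M (Coord p)} {ρ : M → ℝ}
  {t s : Coord p}

/-- The support of ρ is closed in a compact space, so its chart image is compact. Being Hausdorff,
ℝ^p then has that image closed, and extension by zero is smooth across the boundary of the chart
target. -/
theorem contDiff_readIn [T2Space M] [CompactSpace M] (he : e ∈ IsManifold.maximalAtlas (𝓡 p) ∞ M)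
    (hρ : ContMDiff (𝓡 p) 𝓘(ℝ, ℝ) ∞ ρ) (hsupp : tsupport ρ ⊆ e.source) :
    IsCompact (e '' tsupport ρ) ∧ (∀ t ∉ e '' tsupport ρ, readIn e ρ t = 0) ∧
      ContDiff ℝ ∞ (readIn e ρ) := by
  have hC : IsCompact (e '' tsupport ρ) :=
    (isClosed_tsupport ρ).isCompact.image_of_continuousOn (e.continuousOn.mono hsupp)
  have h0 : ∀ t ∉ e '' tsupport ρ, readIn e ρ t = 0 := by
    intro t ht
    by_cases hT : t ∈ e.target
    · rw [readIn, indicator_of_mem hT]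
      exact image_eq_zero_of_notMem_tsupport fun h => ht ⟨_, h, e.right_inv hT⟩
    · rw [readIn, indicator_of_notMem hT]
  refine ⟨hC, h0, contDiff_iff_contDiffAt.2 fun t => ?_⟩
  by_cases hT : t ∈ e.target
  · have h1 : ContDiffOn ℝ ∞ (fun t => ρ (e.symm t)) e.target :=
      contMDiffOn_iff_contDiffOn.1 (hρ.comp_contMDiffOn (contMDiffOn_symm_of_mem_maximalAtlas he))
    refine (h1.contDiffAt (e.open_target.mem_nhds hT)).congr_of_eventuallyEq ?_
    filter_upwards [e.open_target.mem_nhds hT] with t' ht' using indicator_of_mem ht' _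
  · refine (contDiffAt_const (c := (0 : ℝ))).congr_of_eventuallyEq ?_
    have : t ∉ e '' tsupport ρ := by
      rintro ⟨x, hx, rfl⟩
      exact hT (e.map_source (hsupp hx))
    filter_upwards [hC.isClosed.isOpen_compl.mem_nhds this] with t' ht' using h0 t' ht'

theorem differential_bundleParam (he : e ∈ IsManifold.maximalAtlas (𝓡 p) ∞ M)
    (hρ : ContMDiff (𝓡 p) 𝓘(ℝ, ℝ) ∞ ρ) (ht : t ∈ e.target) :
    differential ρ (bundleParam e (t, s)) = fderiv ℝ (readIn e ρ) t s := by
  have h1 := (mdifferentiable_of_mem_maximalAtlas he).mdifferentiableAt_symm ht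
  have h2 : MDifferentiableAt (𝓡 p) 𝓘(ℝ, ℝ) ρ (e.symm t) := hρ.mdifferentiableAt (by simp)
  have h3 := mfderiv_comp t h2 h1
  rw [mfderiv_eq_fderiv] at h3
  have h4 : readIn e ρ =ᶠ[nhds t] ρ ∘ e.symm := by
    filter_upwards [e.open_target.mem_nhds ht] with t' ht' using indicator_of_mem ht' _
  rw [h4.fderiv_eq, h3]
  rfl

variable [IsManifold (𝓡 n) ∞ N] {e' : OpenPartialHomeomorph N (Coord n)} {Φ : ℝ → M → N}
  {δ u : ℝ}

namespace IsChartVariation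

theorem source_mem (hΦ : IsChartVariation δ e e' Φ) (hu : u ∈ Ioo (-δ) δ) (ht : t ∈ e.target) :
    Φ u (e.symm t) ∈ e'.source := hΦ.mapsTo u hu _ (e.map_target ht)

theorem mfderiv_ne_zero (hΦ : IsChartVariation δ e e' Φ) (hu : u ∈ Ioo (-δ) δ) (ht : t ∈ e.target)
    (hs : s ≠ 0) : mfderiv (𝓡 p) (𝓡 n) (Φ u) (e.symm t) (chartLin e t s) ≠ 0 := by
  intro h
  refine hΦ.isLocalVariation.fderiv_ne_zero hu ht hs ?_
  have h1 := fderiv_localMap (s := s) hΦ.mem_atlas hΦ.mem_atlas' ht (hΦ.source_mem hu ht)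
    (hΦ.mdifferentiableAt u hu _ (e.map_target ht))
  rw [h] at h1
  exact h1.trans (map_zero (mfderiv (𝓡 n) (𝓡 n) e' (Φ u (e.symm t))))

theorem energyDensity_bundleParam (hΦ : IsChartVariation δ e e' Φ) (F : FinslerStructure p M)
    (F' : FinslerStructure n N) (hu : u ∈ Ioo (-δ) δ) (ht : t ∈ e.target) (hs : s ≠ 0) :
    energyDensity F.toFun F'.toFun (Φ u) (bundleParam e (t, s)) =
      (1 / 2) * ∑ α, ∑ β, invMetric (localRep F.toFun e) α β t s *
        metric (localPull (localRep F'.toFun e') (localMap (Φ u) e e')) α β t s := by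
  have hd := hΦ.mdifferentiableAt u hu _ (e.map_target ht)
  rw [FinslerMaps.energyDensity_bundleParam hΦ.mem_atlas ht hs F F' hd (hΦ.mfderiv_ne_zero hu ht hs)]
  have h1 : ∀ s, localRep (pull F'.toFun (Φ u)) e t s =
      localPull (localRep F'.toFun e') (localMap (Φ u) e e') t s := fun s =>
    localRep_pull hΦ.mem_atlas hΦ.mem_atlas' ht (hΦ.source_mem hu ht) hd F'.toFun
  unfold metric dS
  simp only [h1]

/-- Chain rule through the linear differential of the target chart. Since `momentum` involves no
chart, the terms -dρ_i(s) W of different charts can be added. -/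
theorem momentum_bundleParam (hΦ : IsChartVariation δ e e' Φ) (F' : FinslerStructure n N)
    (ht : t ∈ e.target) (hs : s ≠ 0) :
    momentum F'.toFun Φ (bundleParam e (t, s)) =
      localMomentum (localRep F'.toFun e') (fun u => localMap (Φ u) e e') t s := by
  have h0 := hΦ.isLocalVariation.zero_mem
  have hx := hΦ.source_mem h0 ht
  have hd := hΦ.mdifferentiableAt 0 h0 _ (e.map_target ht)
  have hF' := isLocalFinsler_localRep hΦ.mem_atlas' F'
  set x := e.symm t with hxdef
  let A' : Coord n →L[ℝ] Coord n := mfderiv (𝓡 n) (𝓡 n) e' (Φ 0 x)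
  let B : Coord p →L[ℝ] Coord n := mfderiv (𝓡 p) (𝓡 n) (Φ 0) x
  have h1 : (fun y : Coord n => F'.toFun ⟨Φ 0 x, y⟩ ^ 2) =
      fun y => localRep F'.toFun e' (e' (Φ 0 x)) (A' y) ^ 2 := by
    funext y
    exact congrArg (fun v => F'.toFun v ^ 2)
      (bundleParam_bundleCoord hΦ.mem_atlas' (v := ⟨Φ 0 x, y⟩) hx).symm
  have h2 : A' (B (chartLin e t s)) = push (localMap (Φ 0) e e') t s := by
    rw [push_eq (hΦ.isLocalVariation.differentiableAt_slice h0 ht)]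
    exact (fderiv_localMap hΦ.mem_atlas hΦ.mem_atlas' ht hx hd).symm
  have h3 : A' (velocity Φ x) = localVelocity (fun u => localMap (Φ u) e e') t := by
    have h4 := mfderiv_comp (0 : ℝ) (I := 𝓘(ℝ, ℝ)) (I' := 𝓡 n) (I'' := 𝓡 n)
      (f := fun u => Φ u x) (g := e')
      ((mdifferentiable_of_mem_maximalAtlas hΦ.mem_atlas').mdifferentiableAt hx)
      (hΦ.mdifferentiableAt_time x (e.map_target ht))
    rw [mfderiv_eq_fderiv] at h4
    have h5 : localVelocity (fun u => localMap (Φ u) e e') t =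
        fderiv ℝ (e' ∘ fun u => Φ u x) 0 1 := (fderiv_apply_one_eq_deriv).symm
    rw [h5, h4]
    rfl
  have hne : push (localMap (Φ 0) e e') t s ≠ 0 := by
    rw [push_eq (hΦ.isLocalVariation.differentiableAt_slice h0 ht)]
    exact hΦ.isLocalVariation.fderiv_ne_zero h0 ht hs
  have h6 : DifferentiableAt ℝ (fun y => localRep F'.toFun e' (e' (Φ 0 x)) y ^ 2)
      (A' (B (chartLin e t s))) := by
    rw [h2]
    exact (hF'.smooth.pow 2).slot_snd hF'.isOpen (e'.map_source hx) hne
  change fderiv ℝ (fun y : Coord n => F'.toFun ⟨Φ 0 x, y⟩ ^ 2) (B (chartLin e t s))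
    (velocity Φ x) = _
  have h7 := HasFDerivAt.comp (B (chartLin e t s)) (f := A') h6.hasFDerivAt A'.hasFDerivAt
  rw [h1]
  change fderiv ℝ ((fun y => localRep F'.toFun e' (e' (Φ 0 x)) y ^ 2) ∘ A') _ _ = _
  rw [h7.fderiv, ContinuousLinearMap.comp_apply, h2, h3,
    fderiv_snd_eq_sum_dS (f := fun t s => localRep F'.toFun e' t s ^ 2)]
  exact Finset.sum_congr rfl fun k _ => mul_comm _ _

/-- The first variation of the energy, localized by a cut-off function on the base. -/
theorem hasDerivAt_energy [T2Space M] [CompactSpace M] (hp : 0 < p)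
    (hΦ : IsChartVariation δ e e' Φ) (F : FinslerStructure p M) (F' : FinslerStructure n N)
    (ha : IsAffineMap F F' (Φ 0)) (hρ : ContMDiff (𝓡 p) 𝓘(ℝ, ℝ) ∞ ρ)
    (hsupp : tsupport ρ ⊆ e.source) :
    (∀ u ∈ Ioo (-δ) δ, Integrable
      (fun v => ρ v.proj * energyDensity F.toFun F'.toFun (Φ u) v) (sphereVolume F.toFun)) ∧
    Integrable (fun v => differential ρ v * momentum F'.toFun Φ v) (sphereVolume F.toFun) ∧
    HasDerivAt (fun u => ∫ v, ρ v.proj * energyDensity F.toFun F'.toFun (Φ u) v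
        ∂(sphereVolume F.toFun))
      (-(p / 2) * ∫ v, differential ρ v * momentum F'.toFun Φ v ∂(sphereVolume F.toFun)) 0 := by
  obtain ⟨hC, h0, hc⟩ := contDiff_readIn hΦ.mem_atlas hρ hsupp
  have he := hΦ.mem_atlas
  have hL := isLocalFinsler_localRep he F
  have hL' := isLocalFinsler_localRep hΦ.mem_atlas' F'
  have hψ := hΦ.isLocalVariation
  have hCT : e '' tsupport ρ ⊆ e.target := by
    rintro _ ⟨x, hx, rfl⟩
    exact e.map_source (hsupp hx)
  have hsymm : ∀ x, x ∉ e.symm '' (e '' tsupport ρ) → x ∉ tsupport ρ := fun x hx hx' =>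
    hx ⟨e x, ⟨x, hx', rfl⟩, e.left_inv (hsupp hx')⟩
  have hΩ := isOpen_slit (p := p) e.open_target
  have hm := bumpMass_pos p
  set L := localRep F.toFun e with hLdef
  set L' := localRep F'.toFun e' with hLdef'
  set ψ : ℝ → Coord p → Coord n := fun u => localMap (Φ u) e e' with hψdef
  have hread : ∀ t ∈ e.target, ρ (e.symm t) = readIn e ρ t := fun t ht => by
    rw [readIn, indicator_of_mem ht]
  have hin : ∀ z ∈ e.target ×ˢ ({0}ᶜ : Set (Coord p)), 0 < (L z.1 z.2)⁻¹ := fun z hz =>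
    inv_pos.2 (hL.pos hz.1 hz.2)
  have sr : SmoothOff e.target (fun t _ => readIn e ρ t) := (hc.comp contDiff_fst).contDiffOn
  -- the energy
  have hE : ∀ u ∈ Ioo (-δ) δ, Integrable
      (fun v => ρ v.proj * energyDensity F.toFun F'.toFun (Φ u) v) (sphereVolume F.toFun) ∧
      bumpMass p * ∫ v, ρ v.proj * energyDensity F.toFun F'.toFun (Φ u) v ∂(sphereVolume F.toFun) =
        ∫ z : Coord p × Coord p, readIn e ρ z.1 * bump (L z.1 z.2 ^ 2) *
          (metricMatrix L z.1 z.2).det * ((1 / 2) * ∑ α, ∑ β, invMetric L α β z.1 z.2 *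
          metric (localPull L' (ψ u)) α β z.1 z.2) := by
    intro u hu
    have su := hψ.smoothOff_localPull hL' hu
    have hval : ∀ z ∈ e.target ×ˢ ({0}ᶜ : Set (Coord p)),
        ρ (bundleParam e z).proj * energyDensity F.toFun F'.toFun (Φ u) (bundleParam e z) =
        readIn e ρ z.1 * ((1 / 2) * ∑ α, ∑ β, invMetric L α β z.1 z.2 *
          metric (localPull L' (ψ u)) α β z.1 z.2) := by
      rintro ⟨t, s⟩ hz
      rw [hΦ.energyDensity_bundleParam F F' hu hz.1 hz.2, ← hread _ hz.1]
      rfl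
    have hcont : SmoothOff e.target (fun t s => readIn e ρ t * ((1 / 2) *
        ∑ α, ∑ β, invMetric L α β t s * metric (localPull L' (ψ u)) α β t s)) :=
      sr.mul (SmoothOff.const_mul _
        (SmoothOff.sum fun α _ => SmoothOff.sum fun β _ =>
          (hL.smooth_invMetric α β).mul (su.metric hL.isOpen α β)))
    obtain ⟨i1, i2⟩ := integral_sphereVolume hp he F hC hCT
      (h := fun v => ρ v.proj * energyDensity F.toFun F'.toFun (Φ u) v)
      ((ContDiffOn.continuousOn hcont).congr hval) fun v hv => by
        rw [image_eq_zero_of_notMem_tsupport (hsymm _ hv), zero_mul]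
    refine ⟨i1, i2.trans ?_⟩
    -- The integral may be taken over the whole space: χ(0) = 0 handles s = 0, and the cut-off
    -- handles t outside the chart target.
    refine Eq.trans ?_ (setIntegral_eq_integral_of_forall_compl_eq_zero
      (s := e.target ×ˢ {0}ᶜ) ?_)
    · refine setIntegral_congr_fun hΩ.measurableSet fun z hz => ?_
      have h1 := hval _ (scale_mem he F hz)
      change liouvilleDensity F.toFun e z * (ρ (normParam F.toFun e z).proj *
        energyDensity F.toFun F'.toFun (Φ u) (normParam F.toFun e z)) = _
      rw [normParam, h1]
      simp only
      -- Degree zero: normalizing the vector does not change the density.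
      rw [hψ.trace_smul hL hL' hu hz.1 hz.2 (hin z hz)]
      simp only [liouvilleDensity]
      ring
    · intro z hz
      by_cases hzt : z.1 ∈ e.target
      · have hz2 : z.2 = 0 := by_contra fun h => hz ⟨hzt, h⟩
        rw [hz2, hL.apply_zero]
        simp [bump_zero]
      · rw [h0 _ fun h => hzt (hCT h)]
        ring
  -- the boundary term
  have hW : Integrable (fun v => differential ρ v * momentum F'.toFun Φ v) (sphereVolume F.toFun) ∧
      bumpMass p * ∫ v, differential ρ v * momentum F'.toFun Φ v ∂(sphereVolume F.toFun) =
        ∫ z : Coord p × Coord p, fderiv ℝ (readIn e ρ) z.1 z.2 *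
        (bump (L z.1 z.2 ^ 2) * (L z.1 z.2 ^ 2)⁻¹) * (metricMatrix L z.1 z.2).det *
          localMomentum L' ψ z.1 z.2 := by
    have hval : ∀ z ∈ e.target ×ˢ ({0}ᶜ : Set (Coord p)),
        differential ρ (bundleParam e z) * momentum F'.toFun Φ (bundleParam e z) =
        fderiv ℝ (readIn e ρ) z.1 z.2 * localMomentum L' ψ z.1 z.2 := by
      rintro ⟨t, s⟩ hz
      rw [hΦ.momentum_bundleParam F' hz.1 hz.2, differential_bundleParam he hρ hz.1]
    have hcont : ContinuousOn (fun z : Coord p × Coord p =>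
        fderiv ℝ (readIn e ρ) z.1 z.2 * localMomentum L' ψ z.1 z.2) (e.target ×ˢ {0}ᶜ) := by
      refine ContinuousOn.mul (Continuous.continuousOn ?_)
        (ContDiffOn.continuousOn (hψ.smoothOff_localMomentum hL'))
      exact ((hc.continuous_fderiv (by simp)).comp continuous_fst).clm_apply continuous_snd
    obtain ⟨i1, i2⟩ := integral_sphereVolume hp he F hC hCT
      (h := fun v => differential ρ v * momentum F'.toFun Φ v)
      (hcont.congr hval) fun v hv => by
        have h1 : ρ =ᶠ[nhds v.proj] fun _ => (0 : ℝ) := by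
          filter_upwards [(isClosed_tsupport ρ).isOpen_compl.mem_nhds (hsymm _ hv)] with y hy
            using image_eq_zero_of_notMem_tsupport hy
        have h2 : differential ρ v = 0 := by
          unfold differential
          rw [h1.mfderiv_eq, mfderiv_const]
          rfl
        rw [h2, zero_mul]
    refine ⟨i1, i2.trans ?_⟩
    refine Eq.trans ?_ (setIntegral_eq_integral_of_forall_compl_eq_zero
      (s := e.target ×ˢ {0}ᶜ) ?_)
    · refine setIntegral_congr_fun hΩ.measurableSet fun z hz => ?_
      have h1 := hval _ (scale_mem he F hz)
      rw [normParam, h1]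
      simp only
      -- Degree one from dρ and degree one from W: normalization produces the factor L⁻² of the
      -- local formula.
      rw [map_smul, localMomentum_smul hL' (hin z hz)]
      simp only [liouvilleDensity, smul_eq_mul, ← hLdef]
      rw [← inv_pow]
      ring
    · intro z hz
      by_cases hzt : z.1 ∈ e.target
      · have hz2 : z.2 = 0 := by_contra fun h => hz ⟨hzt, h⟩
        rw [hz2, hL.apply_zero]
        simp
      · rw [fderiv_eq_zero_off hC h0 fun h => hzt (hCT h)]
        simp
  refine ⟨fun u hu => (hE u hu).1, hW.1, ?_⟩
  have hd := hψ.hasDerivAt_energy hL hL' (fun t ht s hs i α β =>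
    ha.eq_zero e he e' hΦ.mem_atlas' t ht (hΦ.source_mem hψ.zero_mem ht) s hs i α β) hc hC hCT h0
  refine ((hd.const_mul (bumpMass p)⁻¹).congr_of_eventuallyEq ?_).congr_deriv ?_
  · filter_upwards [isOpen_Ioo.mem_nhds hψ.zero_mem] with u hu
    rw [← (hE u hu).2, inv_mul_cancel_left₀ hm.ne']
  · rw [← hW.2]
    field_simp

end IsChartVariation

end ChartVariation

end FinslerMaps

end

noncomputable section

namespace FinslerMaps

/-! ### Affine maps are harmonic -/

section Harmonic

variable {p n : ℕ} {M N : Type*} [TopologicalSpace M] [ChartedSpace (Coord p) M]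
  [TopologicalSpace N] [ChartedSpace (Coord n) N] [IsManifold (𝓡 p) ∞ M] [IsManifold (𝓡 n) ∞ N]

/-- A smooth variation of an immersion is small over a neighbourhood of any given point. -/
theorem exists_isChartVariation {ε : ℝ} (hε : 0 < ε) {Φ : ℝ × M → N}
    (hΦ : ContMDiffOn (𝓘(ℝ, ℝ).prod (𝓡 p)) (𝓡 n) ∞ Φ (Ioo (-ε) ε ×ˢ univ))
    (hnd : Nondegenerate p n fun x => Φ (0, x)) (x : M) :
    ∃ (δ : ℝ) (e : OpenPartialHomeomorph M (Coord p)) (e' : OpenPartialHomeomorph N (Coord n)),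
      x ∈ e.source ∧ IsChartVariation δ e e' fun u x => Φ (u, x) := by
  have he0 := IsManifold.chart_mem_maximalAtlas (I := 𝓡 p) (n := ∞) x
  have he' := IsManifold.chart_mem_maximalAtlas (I := 𝓡 n) (n := ∞) (Φ (0, x))
  set e0 := chartAt (Coord p) x
  set e' := chartAt (Coord n) (Φ (0, x))
  have hx : x ∈ e0.source := mem_chart_source _ x
  have hx' : Φ (0, x) ∈ e'.source := mem_chart_source _ _
  have hzero : (0 : ℝ) ∈ Ioo (-ε) ε := ⟨by linarith, hε⟩
  have hat : ∀ u ∈ Ioo (-ε) ε, ∀ y : M, ContMDiffAt (𝓘(ℝ, ℝ).prod (𝓡 p)) (𝓡 n) ∞ Φ (u, y) :=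
    fun u hu y => hΦ.contMDiffAt ((isOpen_Ioo.prod isOpen_univ).mem_nhds ⟨hu, mem_univ _⟩)
  have hmd : ∀ u ∈ Ioo (-ε) ε, ∀ y : M, MDifferentiableAt (𝓡 p) (𝓡 n) (fun y => Φ (u, y)) y := by
    intro u hu y
    have h1 : ContMDiffAt (𝓡 p) (𝓘(ℝ, ℝ).prod (𝓡 p)) ∞ (fun y : M => (u, y)) y :=
      contMDiffAt_const.prodMk contMDiffAt_id
    exact ((hat u hu y).comp y h1).mdifferentiableAt (by simp)
  have hmt : ∀ y : M, MDifferentiableAt 𝓘(ℝ, ℝ) (𝓡 n) (fun u => Φ (u, y)) 0 := by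
    intro y
    have h1 : ContMDiffAt 𝓘(ℝ, ℝ) (𝓘(ℝ, ℝ).prod (𝓡 p)) ∞ (fun u : ℝ => (u, y)) 0 :=
      contMDiffAt_id.prodMk contMDiffAt_const
    exact ((hat 0 hzero y).comp (0 : ℝ) h1).mdifferentiableAt (by simp)
  -- the variation in coordinates
  set G : ℝ × Coord p → N := fun q => Φ (q.1, e0.symm q.2) with hG
  have hGs : ContMDiffOn 𝓘(ℝ, ℝ × Coord p) (𝓡 n) ∞ G (Ioo (-ε) ε ×ˢ e0.target) := by
    have h1 : ContMDiffOn 𝓘(ℝ, ℝ × Coord p) 𝓘(ℝ, ℝ) ∞ (fun q : ℝ × Coord p => q.1)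
        (Ioo (-ε) ε ×ˢ e0.target) := contDiff_fst.contMDiff.contMDiffOn
    have h2 : ContMDiffOn 𝓘(ℝ, ℝ × Coord p) (𝓡 p) ∞ (fun q : ℝ × Coord p => q.2)
        (Ioo (-ε) ε ×ˢ e0.target) := contDiff_snd.contMDiff.contMDiffOn
    have h3 : ContMDiffOn 𝓘(ℝ, ℝ × Coord p) (𝓡 p) ∞ (fun q : ℝ × Coord p => e0.symm q.2)
        (Ioo (-ε) ε ×ˢ e0.target) :=
      (contMDiffOn_symm_of_mem_maximalAtlas he0).comp h2 fun q hq => hq.2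
    exact hΦ.comp (h1.prodMk h3) fun q hq => ⟨hq.1, mem_univ _⟩
  set O := (Ioo (-ε) ε ×ˢ e0.target) ∩ G ⁻¹' e'.source with hO
  have hOo : IsOpen O := hGs.continuousOn.isOpen_inter_preimage
    (isOpen_Ioo.prod e0.open_target) e'.open_source
  set Ψ : ℝ × Coord p → Coord n := fun q => e' (G q) with hΨ
  have hΨs : ContDiffOn ℝ ∞ Ψ O := contMDiffOn_iff_contDiffOn.1
    ((contMDiffOn_of_mem_maximalAtlas he').comp (hGs.mono inter_subset_left) fun q hq => hq.2)
  have hslice : ∀ q ∈ O, fderiv ℝ (fun t => Ψ (q.1, t)) q.2 =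
      (fderiv ℝ Ψ q).comp (ContinuousLinearMap.inr ℝ ℝ (Coord p)) := by
    rintro ⟨u, t⟩ hq
    exact (HasFDerivAt.comp t (f := fun t => (u, t))
      ((hΨs.contDiffAt (hOo.mem_nhds hq)).differentiableAt (by simp)).hasFDerivAt
      (hasFDerivAt_prodMk_right u t)).fderiv
  have hcont : ContinuousOn (fun q => (fderiv ℝ Ψ q).comp (ContinuousLinearMap.inr ℝ ℝ (Coord p)))
      O := (hΨs.continuousOn_fderiv_of_isOpen hOo (by simp)).clm_comp continuousOn_const
  -- Injectivity is an open condition on linear maps, so the variation stays an immersion near (0,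
  -- x).
  have hO'o := hcont.isOpen_inter_preimage hOo
    (ContinuousLinearMap.isOpen_injective (𝕜 := ℝ) (E := Coord p) (F := Coord n))
  have hxt : e0 x ∈ e0.target := e0.map_source hx
  have hxO : ((0 : ℝ), e0 x) ∈ O := ⟨⟨hzero, hxt⟩, by
    change Φ (0, e0.symm (e0 x)) ∈ e'.source
    rwa [e0.left_inv hx]⟩
  have hmem : ((0 : ℝ), e0 x) ∈ O ∩ (fun q => (fderiv ℝ Ψ q).comp
      (ContinuousLinearMap.inr ℝ ℝ (Coord p))) ⁻¹' {A | Function.Injective A} := by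
    refine ⟨hxO, ?_⟩
    change Function.Injective ((fderiv ℝ Ψ ((0 : ℝ), e0 x)).comp
      (ContinuousLinearMap.inr ℝ ℝ (Coord p)))
    rw [← hslice _ hxO, injective_iff_map_eq_zero]
    intro s hs
    have h1 := fderiv_localMap (φ := fun x => Φ (0, x)) (s := s) he0 he' hxt hxO.2
      (hmd 0 hzero _)
    have h2 : (fderiv ℝ (localMap (fun x => Φ (0, x)) e0 e') (e0 x) s : Coord n) = 0 := hs
    rw [h2] at h1
    have h3 := (mdifferentiable_of_mem_maximalAtlas he').mfderiv_injective hxO.2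
      (h1.symm.trans (map_zero (mfderiv (𝓡 n) (𝓡 n) e' (Φ (0, e0.symm (e0 x))))).symm)
    have h4 := hnd _ _ h3
    exact chartLin_injective he0 hxt (h4.trans (map_zero (chartLin e0 (e0 x))).symm)
  obtain ⟨U, B, hU, hB, h0U, hxB, hUB⟩ := isOpen_prod_iff.1 hO'o _ _ hmem
  obtain ⟨δ, hδ, hδU⟩ := Metric.isOpen_iff.1 hU 0 h0U
  have hδU' : Ioo (-δ) δ ⊆ U := by
    rwa [Real.ball_eq_Ioo, zero_sub, zero_add] at hδU
  -- the restricted chart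
  have hSo : IsOpen (e0.source ∩ e0 ⁻¹' B) := e0.isOpen_inter_preimage hB
  set e := e0.restr (e0.source ∩ e0 ⁻¹' B) with he_def
  have hes : e.source = e0.source ∩ (e0.source ∩ e0 ⁻¹' B) := e0.restr_source' _ hSo
  have hetB : ∀ t ∈ e.target, t ∈ B := by
    intro t ht
    rw [he_def, e0.restr_target, hSo.interior_eq] at ht
    have := ht.2.2
    rwa [mem_preimage, e0.right_inv ht.1] at this
  have hmain : ∀ u ∈ Ioo (-δ) δ, ∀ t ∈ B, (u, t) ∈ O ∧
      Function.Injective ((fderiv ℝ Ψ (u, t)).comp (ContinuousLinearMap.inr ℝ ℝ (Coord p))) :=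
    fun u hu t ht => hUB (mk_mem_prod (hδU' hu) ht)
  refine ⟨δ, e, e', ?_, ?_, he', ⟨hδ, e.open_target, ?_, ?_, ?_⟩, ?_, ?_, fun y _ => hmt y⟩
  · rw [hes]
    exact ⟨hx, hx, hxB⟩
  · exact restr_mem_maximalAtlas _ he0 hSo
  · exact hΨs.mono fun q hq => (hmain q.1 hq.1 q.2 (hetB _ hq.2)).1
  · exact fun u hu t ht => e'.map_source (hmain u hu t (hetB t ht)).1.2
  · intro u hu t ht
    obtain ⟨h1, h2⟩ := hmain u hu t (hetB t ht)
    rw [← hslice _ h1] at h2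
    exact h2
  · intro u hu y hy
    rw [hes] at hy
    have := (hmain u hu (e0 y) hy.2.2).1.2
    change Φ (u, e0.symm (e0 y)) ∈ e'.source at this
    rwa [e0.left_inv hy.1] at this
  · intro u hu y hy
    rw [hes] at hy
    exact hmd u (hmain u hu (e0 y) hy.2.2).1.1.1 y

/-- Differentiate Σ f_i = 1. This is what cancels the boundary terms of the localization. -/
theorem sum_differential_eq_zero {k : ℕ} {f : Fin k → M → ℝ}
    (hf : ∀ i, ContMDiff (𝓡 p) 𝓘(ℝ, ℝ) ∞ (f i)) (h1 : ∀ x, ∑ i, f i x = 1)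
    (v : TangentBundle (𝓡 p) M) : ∑ i, differential (f i) v = 0 := by
  have h2 := HasMFDerivAt.sum (t := Finset.univ) (f := f) fun i _ =>
    ((hf i).mdifferentiableAt (x := v.proj) (by simp)).hasMFDerivAt
  have h3 : ∑ i, f i = fun _ => (1 : ℝ) := by
    funext x
    rw [Finset.sum_apply, h1]
  rw [h3] at h2
  have h4 := h2.mfderiv
  rw [mfderiv_const] at h4
  let D : Fin k → Coord p →L[ℝ] ℝ := fun i => mfderiv (𝓡 p) 𝓘(ℝ, ℝ) (f i) v.proj
  have h5 : 0 = ∑ i, D i := h4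
  have h6 : ∀ w : Coord p, ∑ i, D i w = 0 := fun w => by
    simpa using (congrArg (fun A : Coord p →L[ℝ] ℝ => A w) h5).symm
  exact h6 v.2

/-- The energy has vanishing derivative along every variation of an affine map. -/
theorem IsAffineMap.hasDerivAt_energy [T2Space M] [CompactSpace M] {F : FinslerStructure p M}
    {F' : FinslerStructure n N} {φ : M → N} (hφ : IsAffineMap F F' φ) {ε : ℝ} (hε : 0 < ε)
    {Φ : ℝ × M → N} (hΦ : ContMDiffOn (𝓘(ℝ, ℝ).prod (𝓡 p)) (𝓡 n) ∞ Φ (Ioo (-ε) ε ×ˢ univ))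
    (h0 : ∀ x, Φ (0, x) = φ x) :
    HasDerivAt (fun u => energy F.toFun F'.toFun fun x => Φ (u, x)) 0 0 := by
  obtain rfl : (fun x => Φ (0, x)) = φ := funext h0
  -- For p = 0 the sphere has volume 0, and the convention 0⁻¹ = 0 makes the energy vanish
  -- identically.
  rcases Nat.eq_zero_or_pos p with rfl | hp
  · have : (fun u => energy F.toFun F'.toFun fun x => Φ (u, x)) = fun _ => (0 : ℝ) := by
      funext u
      simp [energy, Measure.toSphere_real_apply_univ]
    rw [this]
    exact hasDerivAt_const _ _
  choose δ e e' hxe hV using exists_isChartVariation hε hΦ hφ.nondegenerate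
  obtain ⟨A, hA⟩ := isCompact_univ.elim_finite_subcover (fun x => (e x).source)
    (fun x => (e x).open_source) fun x _ => mem_iUnion.2 ⟨x, hxe x⟩
  -- A finite index type turns the partition of unity into finite sums, and a common time interval
  -- exists for all charts.
  let c : Fin A.card → M := fun i => A.equivFin.symm i
  obtain ⟨f, hf⟩ := SmoothPartitionOfUnity.exists_isSubordinate (𝓡 p) (isClosed_univ (X := M))
    (fun i : Fin A.card => (e (c i)).source) (fun i => (e (c i)).open_source) (by
      intro x hx
      obtain ⟨y, hy, hxy⟩ := mem_iUnion₂.1 (hA hx)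
      refine mem_iUnion.2 ⟨A.equivFin ⟨y, hy⟩, ?_⟩
      simpa [c] using hxy)
  have hsm : ∀ i, ContMDiff (𝓡 p) 𝓘(ℝ, ℝ) ∞ (f i) := fun i => (f i).contMDiff
  have hsum : ∀ x, ∑ i, f i x = 1 := fun x => by
    rw [← finsum_eq_sum_of_fintype]
    exact f.sum_eq_one (mem_univ x)
  have hloc := fun i => (hV (c i)).hasDerivAt_energy hp F F' hφ (hsm i) (hf i)
  have hev : ∀ᶠ u in nhds (0 : ℝ), ∀ i, u ∈ Ioo (-δ (c i)) (δ (c i)) :=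
    Filter.eventually_all.2 fun i => isOpen_Ioo.mem_nhds (hV (c i)).isLocalVariation.zero_mem
  have hd := HasDerivAt.fun_sum (u := Finset.univ) fun i _ => (hloc i).2.2
  -- The momentum is the same in every summand, so it factors out and Σ dρ_i = 0 remains.
  have hz : ∑ i, (-(p / 2 : ℝ) * ∫ v, differential (f i) v *
      momentum F'.toFun (fun u x => Φ (u, x)) v ∂(sphereVolume F.toFun)) = 0 := by
    rw [← Finset.mul_sum, ← integral_finsetSum _ fun i _ => (hloc i).2.1]
    simp_rw [← Finset.sum_mul, sum_differential_eq_zero hsm hsum]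
    simp
  rw [hz] at hd
  have hd' := hd.const_mul ((volume : Measure (Coord p)).toSphere.real univ)⁻¹
  rw [mul_zero] at hd'
  refine hd'.congr_of_eventuallyEq ?_
  filter_upwards [hev] with u hu
  unfold energy
  rw [← integral_finsetSum _ fun i _ => (hloc i).1 u (hu i)]
  simp_rw [← Finset.sum_mul, hsum, one_mul]

/-- Nondegeneracy enters to keep φ_ε s^ε ≠ 0, where the homogeneity relations of the target are
available. -/
theorem IsAffineMap.tensionVanishes {F : FinslerStructure p M} {F' : FinslerStructure n N}
    {φ : M → N} (hφ : IsAffineMap F F' φ) : TensionVanishes F F' φ := by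
  intro e he e' he' t ht hx s hs i
  have hd : MDifferentiableAt (𝓡 p) (𝓡 n) φ (e.symm t) := hφ.smooth.mdifferentiableAt (by simp)
  refine tension_eq_zero (isLocalFinsler_localRep he F) (isLocalFinsler_localRep he' F') ht hs
    (e'.map_source hx) ?_ (hφ.eq_zero e he e' he' t ht hx s hs) i
  rw [push_eq (differentiableAt_localMap he he' ht hx hd)]
  intro h
  rw [fderiv_localMap he he' ht hx hd] at h
  have h3 := (mdifferentiable_of_mem_maximalAtlas he').mfderiv_injective hx
    (h.trans (map_zero (mfderiv (𝓡 n) (𝓡 n) e' (φ (e.symm t)))).symm)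
  exact chartLin_ne_zero he ht hs (hφ.nondegenerate _ _ h3)

end Harmonic

end FinslerMaps

end

theorem mainTheorem6 {p n : ℕ}
    {M : Type*} [TopologicalSpace M] [ChartedSpace (FinslerMaps.Coord p) M]
    [IsManifold (𝓡 p) ∞ M] [T2Space M] [CompactSpace M]
    (_orientation : FinslerMaps.SmoothOrientation p M)
    {N : Type*} [TopologicalSpace N] [ChartedSpace (FinslerMaps.Coord n) N]
    [IsManifold (𝓡 n) ∞ N] [T2Space N] [SecondCountableTopology N]
    (F : FinslerMaps.FinslerStructure p M) (F' : FinslerMaps.FinslerStructure n N)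
    (φ : M → N) (hφ : FinslerMaps.IsAffineMap F F' φ) :
    FinslerMaps.IsHarmonicMap F F' φ ∧ FinslerMaps.TensionVanishes F F' φ := by
  exact ⟨⟨hφ.smooth, hφ.nondegenerate, fun _ _ hε hΦ h0 => hφ.hasDerivAt_energy hε hΦ h0⟩,
    hφ.tensionVanishes⟩
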